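/- Let \[R_1=\mathbb{R}\Big[\tfrac{x}{z},\tfrac{y}{z}\Big]\Big/\Big(\big(\tfrac{x}{z}\big)^2+\big(\tfrac{y}{z}\big)^2+1\Big),\qquad R_2=\mathbb{R}\Big[\tfrac{x}{y},\tfrac{z}{y}\Big]\Big/\Big(\big(\tfrac{x}{y}\big)^2+\big(\tfrac{z}{y}\big)^2+1\Big),\qquad R_{12}=\mathbb{R}\Big[\tfrac{x}{y},\tfrac{x}{z},\tfrac{z}{y},\tfrac{y}{z}\Big]\Big/\Big(\big(\tfrac{x}{y}\big)^2+\big(\tfrac{z}{y}\big)^2+1\Big)\] (with the usual relations $\frac{z}{y}\cdot\frac{y}{z}=1$, $\frac{x}{z}=\frac{x}{y}\cdot\frac{y}{z}$ in $R_{12}$) be the coordinate rings of $D_+(z)$, $D_+(y)$ and $D_+(z)\cap D_+(y)$ on the conic $x^2+y^2+z^2=0$ over $\mathbb{R}$. For $i\in\mathbb{Z}$ put \[M_i=\big(-\tfrac{y}{z}\big)^{i/2}\ (i\text{ even}),\qquad M_i=\begin{bmatrix}(-\frac{y}{z})^{(i+1)/2}&\frac{x}{z}(-\frac{y}{z})^{(i-1)/2}\\0&(-\frac{y}{z})^{(i-1)/2}\end{bmatrix}\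 (i\text{ odd}).\] An $n\times n$ matrix over $R_{12}$ is called canonical if it is a block sum $\bigoplus_{i\in\mathbb{Z}}M_i^{\oplus m_i}$ with integers $m_i\ge 0$, the blocks being arranged in ascending order of $i$. For $M\in\mathrm{GL}_n(R_{12})$ let $\varphi^{-1}(M)\in\mathrm{GL}_n(\mathbb{C}(w))$ be obtained by substituting $\frac{x}{y}=\frac{i(w^2-2w+2)}{2(w-1)}$ (here $i=\sqrt{-1}$) and $-\frac{z}{y}=\frac{w^2-2w}{2(w-1)}$, and let $d=d_w(\varphi^{-1}(M))$ be the maximum of the degrees of its entries, where the degree of a rational function $f/g$ in lowest terms is $\max(\deg f,\deg g)$. **Theorem.** There are a polynomial $p$ in two variables and an algorithm (a single program for a random access machine over the field $\mathbb{R}$, using field operations, zero tests, the constants $0,1$, and integer additions, subtractions and comparisons for indexing) with the following property. For every $n\ge 1$ and every $M\in\mathrm{GL}_n(R_{12})$, given by $n$ and the real coefficients of its entries in the basis $(z/y)^k,\ (z/y)^k\frac{x}{y}$ $(k\in\mathbb{Z})$ of $R_{12}$, the algorithm halts after at most $p(n,d)$ operations (in particular after at most $p(n,d)$ field operations) and outputs,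 in the same basis, a canonical matrix $D$ for which there exist $L\in\mathrm{GL}_n(R_2)$ and $R\in\mathrm{GL}_n(R_1)$ with $LMR=D$. This $D$ is the only canonical matrix for which such $L$ and $R$ exist. -/

import Mathlib

open Polynomial
open scoped LaurentPolynomial

noncomputable section

namespace Conic

/-! ## Coordinate rings of the cover of the conic `x² + y² + z² = 0` over `ℝ` -/

/-- The monic polynomial `X² + (s² + 1)` in one variable `X` over a ring containing `s`. -/
def conicPoly {A : Type} [CommRing A] (s : A) : A[X] := X ^ 2 + C (s ^ 2 + 1)

theorem conicPoly_monic {A : Type} [CommRing A] (s : A) : (conicPoly s).Monic :=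
  monic_X_pow_add_C _ two_ne_zero

theorem conicPoly_eval₂ {A B : Type} [CommRing A] [CommRing B] (i : A →+* B) (s : A) (x : B)
    (h : x ^ 2 + (i s ^ 2 + 1) = 0) : (conicPoly s).eval₂ i x = 0 := by
  rw [conicPoly, eval₂_add, eval₂_X_pow, eval₂_C, map_add, map_pow, map_one, h]

/-- `R₁ = ℝ[x/z, y/z] / ((x/z)² + (y/z)² + 1)`, as a quotient of `ℝ[y/z][x/z]`. -/
abbrev R1 : Type := AdjoinRoot (conicPoly (X : ℝ[X]))

/-- `R₂ = ℝ[x/y, z/y] / ((x/y)² + (z/y)² + 1)`, as a quotient of `ℝ[z/y][x/y]`. -/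
abbrev R2 : Type := AdjoinRoot (conicPoly (X : ℝ[X]))

/-- `R₁₂ = ℝ[x/y, x/z, z/y, y/z] / ((x/y)² + (z/y)² + 1)`, as a quotient of `A[x/y]`, where
`A = ℝ[z/y, y/z]` is the ring of Laurent polynomials in `T = z/y`; here `x/z = (x/y)(y/z)`. -/
abbrev R12 : Type := AdjoinRoot (conicPoly (LaurentPolynomial.T 1 : ℝ[T;T⁻¹]))

/-- The element `x/y` of `R₁₂`. -/
def xy : R12 := AdjoinRoot.root _

/-- The unit `z/y` of `R₁₂`, with inverse `y/z`. -/
def zy : R12ˣ where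
  val := AdjoinRoot.of _ (LaurentPolynomial.T 1)
  inv := AdjoinRoot.of _ (LaurentPolynomial.T (-1))
  val_inv := by rw [← map_mul, ← LaurentPolynomial.T_add]; simp
  inv_val := by rw [← map_mul, ← LaurentPolynomial.T_add]; simp

/-- The unit `y/z` of `R₁₂`. -/
def yz : R12ˣ := zy⁻¹

/-- The element `x/z` of `R₁₂`. -/
def xz : R12 := xy * yz

theorem xy_relation : xy ^ 2 + ((zy : R12) ^ 2 + 1) = 0 := by
  have h := AdjoinRoot.eval₂_root (conicPoly (LaurentPolynomial.T 1 : ℝ[T;T⁻¹]))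
  have h2 : (X ^ 2 + C ((LaurentPolynomial.T 1 : ℝ[T;T⁻¹]) ^ 2 + 1)).eval₂
      (AdjoinRoot.of (conicPoly (LaurentPolynomial.T 1 : ℝ[T;T⁻¹]))) xy = 0 := h
  rw [eval₂_add, eval₂_X_pow, eval₂_C, map_add, map_pow, map_one] at h2
  exact h2

theorem xz_relation : xz ^ 2 + ((yz : R12) ^ 2 + 1) = 0 := by
  have h : (zy : R12) * (yz : R12) = 1 := zy.mul_inv
  have h2 : xz ^ 2 + ((yz : R12) ^ 2 + 1) =
      (xy ^ 2 + ((zy : R12) ^ 2 + 1)) * (yz : R12) ^ 2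
        + (1 - ((zy : R12) * (yz : R12)) ^ 2) := by
    rw [xz]; ring
  rw [h2, xy_relation, h]; ring

/-- The restriction map `R₁ → R₁₂`. -/
def res1 : R1 →+* R12 :=
  AdjoinRoot.lift (eval₂RingHom (algebraMap ℝ R12) (yz : R12)) xz
    (conicPoly_eval₂ _ _ _ (by simpa using xz_relation))

/-- The restriction map `R₂ → R₁₂`. -/
def res2 : R2 →+* R12 :=
  AdjoinRoot.lift (eval₂RingHom (algebraMap ℝ R12) (zy : R12)) xy
    (conicPoly_eval₂ _ _ _ (by simpa using xy_relation))

/-! ## The parametrization of the conic over `ℂ`, and the degree `d_w` -/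

theorem w_sub_one_ne_zero : (RatFunc.X - 1 : RatFunc ℂ) ≠ 0 := by
  have h : (algebraMap ℂ[X] (RatFunc ℂ)) (X - C 1) ≠ 0 :=
    RatFunc.algebraMap_ne_zero (X_sub_C_ne_zero 1)
  simpa using h

theorem w_sub_two_ne_zero : (RatFunc.X - 2 : RatFunc ℂ) ≠ 0 := by
  have h : (algebraMap ℂ[X] (RatFunc ℂ)) (X - C 2) ≠ 0 :=
    RatFunc.algebraMap_ne_zero (X_sub_C_ne_zero 2)
  simpa [C_ofNat, map_ofNat] using h

/-- The rational function `-(w² - 2w) / (2(w - 1))`, the value of `z/y`. -/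
def phiZY : RatFunc ℂ :=
  -((RatFunc.X ^ 2 - 2 * RatFunc.X) / (2 * (RatFunc.X - 1)))

/-- The rational function `i(w² - 2w + 2) / (2(w - 1))`, the value of `x/y`. -/
def phiXY : RatFunc ℂ :=
  RatFunc.C Complex.I * (RatFunc.X ^ 2 - 2 * RatFunc.X + 2) / (2 * (RatFunc.X - 1))

theorem phiZY_ne_zero : phiZY ≠ 0 := by
  have h0 : (RatFunc.X : RatFunc ℂ) ≠ 0 := RatFunc.X_ne_zero
  have h1 := w_sub_one_ne_zero
  have h2 := w_sub_two_ne_zero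
  have h3 : (RatFunc.X ^ 2 - 2 * RatFunc.X : RatFunc ℂ) = RatFunc.X * (RatFunc.X - 2) := by ring
  rw [phiZY, h3]
  exact neg_ne_zero.mpr (div_ne_zero (mul_ne_zero h0 h2) (mul_ne_zero two_ne_zero h1))

theorem phi_relation : phiXY ^ 2 + (phiZY ^ 2 + 1) = 0 := by
  have h1 := w_sub_one_ne_zero
  have hI : (RatFunc.C Complex.I : RatFunc ℂ) ^ 2 = -1 := by
    rw [← map_pow, Complex.I_sq, map_neg, map_one]
  rw [phiXY, phiZY, mul_div_assoc, mul_pow, hI]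
  field_simp
  ring

/-- The map `φ⁻¹ : R₁₂ → ℂ(w)`, given by substituting the formulas for `x/y` and `z/y`. -/
def phiInv : R12 →+* RatFunc ℂ :=
  AdjoinRoot.lift
    (LaurentPolynomial.eval₂ (RatFunc.C.comp (algebraMap ℝ ℂ)) (Units.mk0 phiZY phiZY_ne_zero))
    phiXY (conicPoly_eval₂ _ _ _ (by simpa [LaurentPolynomial.eval₂_T] using phi_relation))

/-- The degree of a rational function `f/g` in lowest terms: `max (deg f) (deg g)`. -/
def ratDegree (p : RatFunc ℂ) : ℕ := max p.num.natDegree p.denom.natDegree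

/-- `d_w(N)`: the maximal degree of an entry of a matrix `N` over `ℂ(w)`. -/
def dw {n : ℕ} (N : Matrix (Fin n) (Fin n) (RatFunc ℂ)) : ℕ :=
  Finset.univ.sup fun i => Finset.univ.sup fun j => ratDegree (N i j)

/-! ## Canonical block diagonal matrices -/

/-- The unit `-y/z` of `R₁₂`. -/
def negYZ : R12ˣ := -yz

/-- The size of the block `M_i`. -/
def blockSize (i : ℤ) : ℕ := if Even i then 1 else 2

/-- The block `M_i`: the `1 × 1` matrix `(-y/z)^(i/2)` if `i` is even, and
`[(-y/z)^((i+1)/2), (x/z)(-y/z)^((i-1)/2); 0, (-y/z)^((i-1)/2)]` if `i` is odd. -/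
def block (i : ℤ) : Matrix (Fin (blockSize i)) (Fin (blockSize i)) R12 :=
  fun r c =>
    if Even i then ((negYZ ^ (i / 2) : R12ˣ) : R12)
    else match r.val, c.val with
      | 0, 0 => ((negYZ ^ ((i + 1) / 2) : R12ˣ) : R12)
      | 0, 1 => xz * ((negYZ ^ ((i - 1) / 2) : R12ˣ) : R12)
      | 1, 1 => ((negYZ ^ ((i - 1) / 2) : R12ˣ) : R12)
      | _, _ => 0

/-- The size of the block sum of the `M_i`, `i` running through a list. -/
def totalSize : List ℤ → ℕ
  | [] => 0
  | i :: l => blockSize i + totalSize l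

/-- The block diagonal matrix with diagonal blocks `M_i`, `i` running through a list. -/
def blockSum : (l : List ℤ) → Matrix (Fin (totalSize l)) (Fin (totalSize l)) R12
  | [] => 0
  | i :: l => (Matrix.fromBlocks (block i) 0 0 (blockSum l)).reindex finSumFinEquiv finSumFinEquiv

/-- `D` is in canonical form: `D = ⨁_{i ∈ ℤ} M_i^{⊕ m_i}` with the blocks in ascending order of
`i` (the multiplicity `m_i` is the number of occurrences of `i` in the list). -/
def IsCanonical {n : ℕ} (D : Matrix (Fin n) (Fin n) R12) : Prop :=
  ∃ l : List ℤ, l.SortedLE ∧ ∃ h : totalSize l = n,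
    D = (blockSum l).reindex (finCongr h) (finCongr h)

/-- `LMR = D` for some `L ∈ GL_n(R₂)` and `R ∈ GL_n(R₁)`. -/
def Reduces {n : ℕ} (M D : Matrix (Fin n) (Fin n) R12) : Prop :=
  ∃ (L : GL (Fin n) R2) (R : GL (Fin n) R1),
    (L : Matrix (Fin n) (Fin n) R2).map res2 * M * (R : Matrix (Fin n) (Fin n) R1).map res1 = D

/-! ## Coefficients of elements of `R₁₂` -/

/-- Every `f ∈ R₁₂` is uniquely `f₀ + f₁ · (x/y)` with Laurent polynomials `f₀, f₁` in `T = z/y`;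
`coord f e` is `f_e`. -/
def coord (f : R12) (e : Fin 2) : ℝ[T;T⁻¹] :=
  (AdjoinRoot.modByMonicHom (conicPoly_monic (LaurentPolynomial.T 1 : ℝ[T;T⁻¹])) f).coeff e

/-- The largest `|k|` such that `T^k` occurs in a coordinate of an entry of `M`. -/
def width {n : ℕ} (M : Matrix (Fin n) (Fin n) R12) : ℕ :=
  Finset.univ.sup fun i => Finset.univ.sup fun j => Finset.univ.sup fun e =>
    (coord (M i j) e).coeff.support.sup Int.natAbs

end Conic

/-! ## Algebraic random access machines

A program is a fixed finite text. It works on integer variables and on arrays of elements of a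
field `K`, whose cells are addressed by lists of integers. Its only operations are addition,
subtraction and comparison of integers, the field operations `+, -, *, /`, and the test whether a
field element is zero; the only field constants are `0` and `1`. Every operation, every access to a
variable, a constant or an array cell, every assignment and every branching has cost at least one,
so that the cost of a run bounds the number of its field operations. -/

namespace AlgRAM

/-- Integer expressions. -/
inductive IExpr : Type
  | const (c : ℤ)
  | var (v : ℕ)
  | add (a b : IExpr)
  | sub (a b : IExpr)

/-- Field expressions; `get a idx` is the cell of the array number `a` with address `idx`. -/
inductive FExpr : Type
  | zero
  | one
  | get (a : ℕ) (idx : List IExpr)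
  | add (x y : FExpr)
  | sub (x y : FExpr)
  | mul (x y : FExpr)
  | div (x y : FExpr)

/-- Tests. -/
inductive Test : Type
  | le (a b : IExpr)
  | isZero (x : FExpr)
  | not (t : Test)
  | and (t u : Test)

/-- Programs. -/
inductive Prog : Type
  | skip
  | setInt (v : ℕ) (a : IExpr)
  | setField (a : ℕ) (idx : List IExpr) (x : FExpr)
  | seq (p q : Prog)
  | ite (t : Test) (p q : Prog)
  | while (t : Test) (p : Prog)

/-- A state: the values of the integer variables and of the array cells. -/
structure State (K : Type) where
  int : ℕ → ℤ
  mem : ℕ → List ℤ → K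

variable {K : Type} [Field K]

def IExpr.eval (σ : State K) : IExpr → ℤ
  | .const c => c
  | .var v => σ.int v
  | .add a b => a.eval σ + b.eval σ
  | .sub a b => a.eval σ - b.eval σ

def IExpr.cost : IExpr → ℕ
  | .const _ => 1
  | .var _ => 1
  | .add a b => a.cost + b.cost + 1
  | .sub a b => a.cost + b.cost + 1

/-- The value of a field expression; division by zero returns `0`. -/
def FExpr.eval (σ : State K) : FExpr → K
  | .zero => 0
  | .one => 1
  | .get a idx => σ.mem a (idx.map (IExpr.eval σ))
  | .add x y => x.eval σ + y.eval σ
  | .sub x y => x.eval σ - y.eval σ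
  | .mul x y => x.eval σ * y.eval σ
  | .div x y => x.eval σ / y.eval σ

def FExpr.cost : FExpr → ℕ
  | .zero => 1
  | .one => 1
  | .get _ idx => (idx.map IExpr.cost).sum + 1
  | .add x y => x.cost + y.cost + 1
  | .sub x y => x.cost + y.cost + 1
  | .mul x y => x.cost + y.cost + 1
  | .div x y => x.cost + y.cost + 1

def Test.eval (σ : State K) : Test → Prop
  | .le a b => a.eval σ ≤ b.eval σ
  | .isZero x => x.eval σ = 0
  | .not t => ¬ t.eval σ
  | .and t u => t.eval σ ∧ u.eval σ

def Test.cost : Test → ℕ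
  | .le a b => a.cost + b.cost + 1
  | .isZero x => x.cost + 1
  | .not t => t.cost + 1
  | .and t u => t.cost + u.cost + 1

/-- Assignment to an integer variable. -/
def State.setInt (σ : State K) (v : ℕ) (c : ℤ) : State K :=
  { σ with int := Function.update σ.int v c }

/-- Assignment to an array cell. -/
def State.setMem (σ : State K) (a : ℕ) (idx : List ℤ) (x : K) : State K :=
  { σ with mem := Function.update σ.mem a (Function.update (σ.mem a) idx x) }

/-- `Run p σ s τ`: started in the state `σ`, the program `p` halts in the state `τ`, at
cost `s`. -/
inductive Run : Prog → State K → ℕ → State K → Prop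
  | skip (σ : State K) : Run .skip σ 1 σ
  | setInt (v : ℕ) (a : IExpr) (σ : State K) :
      Run (.setInt v a) σ (a.cost + 1) (σ.setInt v (a.eval σ))
  | setField (a : ℕ) (idx : List IExpr) (x : FExpr) (σ : State K) :
      Run (.setField a idx x) σ ((idx.map IExpr.cost).sum + x.cost + 1)
        (σ.setMem a (idx.map (IExpr.eval σ)) (x.eval σ))
  | seq {p q : Prog} {σ τ ρ : State K} {s t : ℕ} :
      Run p σ s τ → Run q τ t ρ → Run (.seq p q) σ (s + t) ρ
  | ite_true {b : Test} {p q : Prog} {σ τ : State K} {s : ℕ} :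
      b.eval σ → Run p σ s τ → Run (.ite b p q) σ (b.cost + 1 + s) τ
  | ite_false {b : Test} {p q : Prog} {σ τ : State K} {s : ℕ} :
      ¬ b.eval σ → Run q σ s τ → Run (.ite b p q) σ (b.cost + 1 + s) τ
  | while_true {b : Test} {p : Prog} {σ τ ρ : State K} {s t : ℕ} :
      b.eval σ → Run p σ s τ → Run (.while b p) τ t ρ →
      Run (.while b p) σ (b.cost + 1 + s + t) ρ
  | while_false {b : Test} {p : Prog} {σ : State K} :
      ¬ b.eval σ → Run (.while b p) σ (b.cost + 1) σ

end AlgRAM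

namespace Conic

open AlgRAM

/-- The initial state for the input `M`: variable `0` is the size `n`, variable `1` is `width M`,
and the cell `[i, j, e, k]` of array `0`, for `0 ≤ i, j < n` and `e ∈ {0, 1}`, is
the coefficient of `T^k` in `coord (M i j) e`, which vanishes for `|k| > width M`. All other variables and cells are zero. -/
def inputState {n : ℕ} (M : Matrix (Fin n) (Fin n) R12) : State ℝ where
  int v := if v = 0 then (n : ℤ) else if v = 1 then (width M : ℤ) else 0
  mem a idx :=
    match a, idx with
    | 0, [i, j, e, k] =>
      if h : (0 ≤ i ∧ i < n) ∧ (0 ≤ j ∧ j < n) ∧ 0 ≤ e ∧ e < 2 then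
        (coord (M ⟨i.toNat, by omega⟩ ⟨j.toNat, by omega⟩) ⟨e.toNat, by omega⟩).coeff k
      else 0
    | _, _ => 0

/-- In the state `τ`, the array `1` holds the matrix `D`: variable `1` is a number `b ≥ 0`
such that only the `T^k` with `|k| ≤ b` occur in the coordinates of the entries of `D`,
and the coefficients of these `T^k` are in the cells `[i, j, e, k]` of array `1`. -/
def IsOutput {n : ℕ} (τ : State ℝ) (D : Matrix (Fin n) (Fin n) R12) : Prop :=
  (width D : ℤ) ≤ τ.int 1 ∧
  ∀ (i j : Fin n) (e : Fin 2) (k : ℤ), |k| ≤ τ.int 1 →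
    τ.mem 1 [((i : ℕ) : ℤ), ((j : ℕ) : ℤ), ((e : ℕ) : ℤ), k] =
      (coord (D i j) e).coeff k

end Conic

end

/-!
The elements of `GL_n(R₁₂)` are the transition matrices of vector bundles of rank `n` on the conic
`x² + y² + z² = 0` with respect to the affine charts `D₊(y)` and `D₊(z)`, and `LMR = D` is an
isomorphism of bundles. Throughout, `T` stands for `z/y` and `x` for `x/y`, so that `R₁₂` has the
real basis `T ^ k`, `T ^ k x`; the elements of `R₂` are those without negative powers of `T`, and those
of `R₁` the polynomials in `T⁻¹` and `x T⁻¹`.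

The canonical form exists since every bundle is a direct sum of line bundles of even degree and of the
indecomposable bundles of rank two (`exists_blockSum`). As the coordinate rings of the charts are
principal ideal domains whose primes are generated by linear forms, the first nonzero section
of a twist spans a line subbundle (`exists_line_subbundle`), which is split off by induction on the
rank. The only obstruction is the one-dimensional first cohomology of the line bundle of degree
`-2`, and a nontrivial extension there is the bundle of rank two (`eqv_oddBlock`).

The canonical form is unique because its multiplicities can be computed from dimensions of spaces of
global sections. The space `sec` of sections of the twist of index `j` (two copies of a twist by a line
bundle for even `j`, a twist by a bundle of rank two for odd `j`) has for a block of index `i` the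
dimension `2 · size · max (j - i + 1, 0)` (`rank_sec_block_even`, `rank_sec_block_odd`); the case of two
bundles of rank two rests on the splitting of their tensor product (`quaternionEquiv`). The
second difference in `j` of the dimension is the multiplicity of the blocks of index `j`, times twice
their size (`sumDim_second_difference`).

The same formula is the algorithm. The exponents in `M` are bounded by the width `w`, and `w` is at most
the degree `d`, as an exponent gives a pole of this order at `0` or `1` in the parametrization
(`width_le_dw`). By Cramer's rule the exponents of the inverse matrix are at most `2nw + n`
(`inverse_bounds`). Hence the indices of the blocks lie in an interval of length `O(nw)`
(`le_of_mem_list`, `mem_list_le`), and for the twists in this interval the sections are the solutions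
of a system of real linear equations of polynomial size (`nullity_secMat`). The program computes the
ranks of these systems by elimination (`eliminate_spec`) and writes the blocks in ascending order
(`canonicalForm_spec`). It consists of loops whose bounds are polynomials in `n` and `w`, so that its
cost is a polynomial in them.
-/

noncomputable section

namespace Conic

/-! ### Coefficients of elements of `R₁₂`, and the charts -/

/-- The integral power `T ^ k` of `T = z/y` in `R₁₂`. -/
def tp (k : ℤ) : R12 := ((zy ^ k : R12ˣ) : R12)

theorem tp_zero : tp 0 = 1 := by simp [tp]
theorem tp_add (a b : ℤ) : tp (a + b) = tp a * tp b := by simp [tp, zpow_add]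
theorem tp_one : tp 1 = (zy : R12) := by simp [tp]
theorem tp_mul_neg (a : ℤ) : tp a * tp (-a) = 1 := by rw [← tp_add]; simp [tp_zero]
theorem tp_neg_mul (a : ℤ) : tp (-a) * tp a = 1 := by rw [← tp_add]; simp [tp_zero]
theorem tp_neg_one : tp (-1) = (yz : R12) := by simp [tp, yz]

/-- The inclusion of the Laurent polynomials in `T` into `R₁₂`. -/
def lau : ℝ[T;T⁻¹] →+* R12 := AdjoinRoot.of _

theorem lau_T (k : ℤ) : lau (LaurentPolynomial.T k) = tp k := by
  have h : ∀ n : ℕ, lau (LaurentPolynomial.T n) = tp n := by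
    intro n
    have := LaurentPolynomial.T_pow (R := ℝ) 1 n
    rw [mul_one] at this
    rw [← this, map_pow]
    simp [tp, lau, zy]
  obtain ⟨n, rfl | rfl⟩ := k.eq_nat_or_neg
  · exact h n
  · have h1 : lau (LaurentPolynomial.T (-n)) * lau (LaurentPolynomial.T n) = 1 := by
      rw [← map_mul, ← LaurentPolynomial.T_add]; simp
    calc lau (LaurentPolynomial.T (-n)) = lau (LaurentPolynomial.T (-n)) * (tp n * tp (-n)) := by
          rw [tp_mul_neg, mul_one]
      _ = tp (-n) := by rw [← h n, ← mul_assoc, h1, one_mul]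

theorem lau_C (c : ℝ) : lau (LaurentPolynomial.C c) = algebraMap ℝ R12 c := rfl

theorem xy_mul_xy : xy * xy = -(tp 2 + 1) := by
  have h := xy_relation
  have h2 : tp 2 = (zy : R12) ^ 2 := by simp [tp]
  rw [h2]; linear_combination h

theorem modByMonicHom_lau_add (a b : ℝ[T;T⁻¹]) :
    AdjoinRoot.modByMonicHom (conicPoly_monic (LaurentPolynomial.T 1 : ℝ[T;T⁻¹]))
      (lau a + lau b * xy) = Polynomial.C a + Polynomial.C b * X := by
  have : lau a + lau b * xy = AdjoinRoot.mk (conicPoly (LaurentPolynomial.T 1 : ℝ[T;T⁻¹]))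
      (Polynomial.C a + Polynomial.C b * X) := by
    simp [lau, xy, AdjoinRoot.mk_C, AdjoinRoot.mk_X]
  rw [this, AdjoinRoot.modByMonicHom_mk]
  apply (Polynomial.modByMonic_eq_self_iff (conicPoly_monic _)).2
  have hd : (conicPoly (LaurentPolynomial.T 1 : ℝ[T;T⁻¹])).degree = 2 := by
    rw [conicPoly]; exact degree_X_pow_add_C (by norm_num) _
  rw [hd]
  have : (Polynomial.C a + Polynomial.C b * X).degree ≤ 1 := by
    rw [add_comm]; exact degree_linear_le
  exact lt_of_le_of_lt this (by norm_num)

theorem coord_zero (a b : ℝ[T;T⁻¹]) : coord (lau a + lau b * xy) 0 = a := by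
  rw [coord, modByMonicHom_lau_add]; simp

theorem coord_one (a b : ℝ[T;T⁻¹]) : coord (lau a + lau b * xy) 1 = b := by
  rw [coord, modByMonicHom_lau_add]; simp

theorem eq_lau_coord (f : R12) : f = lau (coord f 0) + lau (coord f 1) * xy := by
  obtain ⟨p, rfl⟩ := AdjoinRoot.mk_surjective f
  have hm := conicPoly_monic (LaurentPolynomial.T 1 : ℝ[T;T⁻¹])
  have h1 := AdjoinRoot.mk_leftInverse hm (AdjoinRoot.mk _ p)
  set r := AdjoinRoot.modByMonicHom hm (AdjoinRoot.mk _ p) with hr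
  have hd : r.degree ≤ 1 := by
    have : r.degree < 2 := by
      rw [hr, AdjoinRoot.modByMonicHom_mk]
      refine (degree_modByMonic_lt _ hm).trans_eq ?_
      rw [conicPoly]; exact degree_X_pow_add_C (by norm_num) _
    exact Order.le_of_lt_succ this
  have h2 := Polynomial.eq_X_add_C_of_degree_le_one hd
  have h3 : coord (AdjoinRoot.mk _ p) 0 = r.coeff 0 := rfl
  have h4 : coord (AdjoinRoot.mk _ p) 1 = r.coeff 1 := rfl
  rw [h3, h4, ← h1, h2]
  simp only [map_add, map_mul, AdjoinRoot.mk_C, AdjoinRoot.mk_X, coeff_add, coeff_C_mul,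
    coeff_X_zero, coeff_X_one, coeff_C_zero, coeff_C_succ, lau, xy, mul_zero, zero_add, mul_one,
    add_zero]
  rw [add_comm]

/-- The coefficient of `T ^ k` in the coordinate number `e` of `f`. -/
def cf (f : R12) (e : Fin 2) (k : ℤ) : ℝ := (coord f e).coeff k

theorem cf_ext {f g : R12} (h : ∀ e k, cf f e k = cf g e k) : f = g := by
  rw [eq_lau_coord f, eq_lau_coord g]
  have : ∀ e, coord f e = coord g e := fun e => LaurentPolynomial.ext (h e)
  rw [this, this]

theorem cf_lau_zero (a b : ℝ[T;T⁻¹]) (k : ℤ) : cf (lau a + lau b * xy) 0 k = a.coeff k := by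
  rw [cf, coord_zero]

theorem cf_lau_one (a b : ℝ[T;T⁻¹]) (k : ℤ) : cf (lau a + lau b * xy) 1 k = b.coeff k := by
  rw [cf, coord_one]

theorem cf_add (f g : R12) (e : Fin 2) (k : ℤ) : cf (f + g) e k = cf f e k + cf g e k := by
  simp [cf, coord]

theorem cf_zero (e : Fin 2) (k : ℤ) : cf 0 e k = 0 := by
  simp [cf, coord]

theorem T_mul_coeff (m : ℤ) (a : ℝ[T;T⁻¹]) (k : ℤ) :
    (LaurentPolynomial.T m * a).coeff k = a.coeff (k - m) := by
  rw [LaurentPolynomial.T, AddMonoidAlgebra.coeff_single_mul_apply, one_mul]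
  congr 1; ring

theorem lau_C_mul_coeff (c : ℝ) (a : ℝ[T;T⁻¹]) (k : ℤ) :
    (LaurentPolynomial.C c * a).coeff k = c * a.coeff k := by
  rw [← LaurentPolynomial.smul_eq_C_mul]; rfl

theorem cf_smul (c : ℝ) (f : R12) (e : Fin 2) (k : ℤ) : cf (c • f) e k = c * cf f e k := by
  have h : c • f = lau (LaurentPolynomial.C c * coord f 0) +
      lau (LaurentPolynomial.C c * coord f 1) * xy := by
    rw [Algebra.smul_def, map_mul, map_mul, lau_C]
    conv_lhs => rw [eq_lau_coord f]
    ring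
  fin_cases e
  · simp only [Fin.zero_eta]
    rw [h, cf_lau_zero, lau_C_mul_coeff]; rfl
  · simp only [Fin.mk_one]
    rw [h, cf_lau_one, lau_C_mul_coeff]; rfl

theorem cf_tp_mul (m : ℤ) (f : R12) (e : Fin 2) (k : ℤ) : cf (tp m * f) e k = cf f e (k - m) := by
  have h : tp m * f = lau (LaurentPolynomial.T m * coord f 0) +
      lau (LaurentPolynomial.T m * coord f 1) * xy := by
    rw [map_mul, map_mul, lau_T]
    conv_lhs => rw [eq_lau_coord f]
    ring
  fin_cases e
  · simp only [Fin.zero_eta]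
    rw [h, cf_lau_zero, T_mul_coeff]; rfl
  · simp only [Fin.mk_one]
    rw [h, cf_lau_one, T_mul_coeff]; rfl

theorem cf_xy_mul_zero (f : R12) (k : ℤ) : cf (xy * f) 0 k = -(cf f 1 (k - 2) + cf f 1 k) := by
  have h : xy * f = lau (-(LaurentPolynomial.T 2 * coord f 1 + coord f 1)) +
      lau (coord f 0) * xy := by
    simp only [map_mul, map_neg, map_add, lau_T]
    conv_lhs => rw [eq_lau_coord f]
    linear_combination (lau (coord f 1)) * xy_mul_xy
  rw [h, cf_lau_zero]
  simp only [AddMonoidAlgebra.coeff_neg, AddMonoidAlgebra.coeff_add, Finsupp.neg_apply, Finsupp.add_apply, T_mul_coeff, cf]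

theorem cf_xy_mul_one (f : R12) (k : ℤ) : cf (xy * f) 1 k = cf f 0 k := by
  have h : xy * f = lau (-(LaurentPolynomial.T 2 * coord f 1 + coord f 1)) +
      lau (coord f 0) * xy := by
    simp only [map_mul, map_neg, map_add, lau_T]
    conv_lhs => rw [eq_lau_coord f]
    linear_combination (lau (coord f 1)) * xy_mul_xy
  rw [h, cf_lau_one]; rfl

theorem cf_one_zero (k : ℤ) : cf 1 0 k = if k = 0 then 1 else 0 := by
  have h : (1 : R12) = lau (LaurentPolynomial.T 0) + lau 0 * xy := by rw [lau_T, tp_zero]; simp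
  rw [h, cf_lau_zero, LaurentPolynomial.T_apply]; simp [eq_comm]

theorem cf_one_one (k : ℤ) : cf 1 1 k = 0 := by
  have h : (1 : R12) = lau (LaurentPolynomial.T 0) + lau 0 * xy := by rw [lau_T, tp_zero]; simp
  rw [h, cf_lau_one]; simp

/-- `cf` as a linear functional. -/
def cfL (e : Fin 2) (k : ℤ) : R12 →ₗ[ℝ] ℝ where
  toFun f := cf f e k
  map_add' f g := cf_add f g e k
  map_smul' c f := cf_smul c f e k

theorem cf_sub (f g : R12) (e : Fin 2) (k : ℤ) : cf (f - g) e k = cf f e k - cf g e k :=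
  map_sub (cfL e k) f g

theorem cf_sum {ι : Type*} (s : Finset ι) (f : ι → R12) (e : Fin 2) (k : ℤ) :
    cf (∑ i ∈ s, f i) e k = ∑ i ∈ s, cf (f i) e k :=
  map_sum (cfL e k) f s

/-- The involution of `R₁₂` that exchanges `y` and `z`. -/
def swap : R12 →+* R12 :=
  AdjoinRoot.lift (LaurentPolynomial.eval₂ (algebraMap ℝ R12) yz) xz
    (conicPoly_eval₂ _ _ _ (by simpa [LaurentPolynomial.eval₂_T] using xz_relation))

theorem swap_xy : swap xy = xz := AdjoinRoot.lift_root _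

theorem swap_lau (a : ℝ[T;T⁻¹]) : swap (lau a) = lau (LaurentPolynomial.invert a) := by
  have h : swap (lau a) = LaurentPolynomial.eval₂ (algebraMap ℝ R12) yz a := AdjoinRoot.lift_of _
  rw [h]
  induction a using LaurentPolynomial.induction_on' with
  | add p q hp hq =>
    rw [map_add, map_add, map_add, hp (AdjoinRoot.lift_of _), hq (AdjoinRoot.lift_of _)]
  | C_mul_T n c =>
    rw [LaurentPolynomial.eval₂_C_mul_T, map_mul, map_mul, LaurentPolynomial.invert_C,
      LaurentPolynomial.invert_T, lau_T, lau_C]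
    simp [tp, yz]

theorem swap_tp (k : ℤ) : swap (tp k) = tp (-k) := by
  rw [← lau_T, swap_lau, LaurentPolynomial.invert_T, lau_T]

theorem xz_eq : xz = tp (-1) * xy := by rw [xz, tp_neg_one, mul_comm]

theorem swap_eq (f : R12) : swap f = lau (LaurentPolynomial.invert (coord f 0)) +
    lau (LaurentPolynomial.T (-1) * LaurentPolynomial.invert (coord f 1)) * xy := by
  conv_lhs => rw [eq_lau_coord f]
  rw [map_add, map_mul, swap_lau, swap_lau, swap_xy, xz_eq, map_mul, lau_T]
  ring

theorem cf_swap_zero (f : R12) (k : ℤ) : cf (swap f) 0 k = cf f 0 (-k) := by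
  rw [swap_eq, cf_lau_zero, LaurentPolynomial.invert_apply]; rfl

theorem cf_swap_one (f : R12) (k : ℤ) : cf (swap f) 1 k = cf f 1 (-1 - k) := by
  rw [swap_eq, cf_lau_one, T_mul_coeff, LaurentPolynomial.invert_apply, cf]; congr 1; ring

theorem swap_swap (f : R12) : swap (swap f) = f := by
  apply cf_ext
  intro e k
  fin_cases e
  · simp [cf_swap_zero]
  · simp [cf_swap_one]

theorem swap_algebraMap (c : ℝ) : swap (algebraMap ℝ R12 c) = algebraMap ℝ R12 c := by
  rw [← lau_C, swap_lau, LaurentPolynomial.invert_C]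

theorem swap_res2 (g : R2) : swap (res2 g) = res1 g := by
  have h : swap.comp res2 = res1 := by
    apply Ideal.Quotient.ringHom_ext
    apply Polynomial.ringHom_ext'
    · apply Polynomial.ringHom_ext'
      · ext c
        change swap (res2 (AdjoinRoot.of _ (C c))) = res1 (AdjoinRoot.of _ (C c))
        rw [res2, res1, AdjoinRoot.lift_of, AdjoinRoot.lift_of]
        simp only [coe_eval₂RingHom, eval₂_C]
        exact swap_algebraMap c
      · change swap (res2 (AdjoinRoot.of _ X)) = res1 (AdjoinRoot.of _ X)
        rw [res2, res1, AdjoinRoot.lift_of, AdjoinRoot.lift_of]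
        simp only [coe_eval₂RingHom, eval₂_X]
        rw [← tp_one, swap_tp, tp_neg_one]
    · change swap (res2 (AdjoinRoot.root _)) = res1 (AdjoinRoot.root _)
      rw [res2, res1, AdjoinRoot.lift_root, AdjoinRoot.lift_root, swap_xy]
  exact DFunLike.congr_fun h g

theorem swap_res1 (g : R1) : swap (res1 g) = res2 g := by
  rw [← swap_res2, swap_swap]

/-- The subring `R₂` of `R₁₂`. -/
def S2 : Subring R12 := res2.range

/-- The subring `R₁` of `R₁₂`. -/
def S1 : Subring R12 := res1.range

/-- Normal form of elements of a quadratic extension defined by `conicPoly`. -/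
theorem exists_of_add_of_mul_root {A : Type} [CommRing A] [Nontrivial A] (s : A)
    (f : AdjoinRoot (conicPoly s)) :
    ∃ a b : A, f = AdjoinRoot.of _ a + AdjoinRoot.of _ b * AdjoinRoot.root _ := by
  obtain ⟨p, rfl⟩ := AdjoinRoot.mk_surjective f
  have hm := conicPoly_monic s
  have h1 := AdjoinRoot.mk_leftInverse hm (AdjoinRoot.mk _ p)
  set r := AdjoinRoot.modByMonicHom hm (AdjoinRoot.mk _ p) with hr
  have hd : r.degree ≤ 1 := by
    have : r.degree < 2 := by
      rw [hr, AdjoinRoot.modByMonicHom_mk]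
      refine (degree_modByMonic_lt _ hm).trans_eq ?_
      rw [conicPoly]; exact degree_X_pow_add_C (by norm_num) _
    exact Order.le_of_lt_succ this
  have h2 := Polynomial.eq_X_add_C_of_degree_le_one hd
  refine ⟨r.coeff 0, r.coeff 1, ?_⟩
  rw [← h1, h2]
  simp only [map_add, map_mul, AdjoinRoot.mk_C, AdjoinRoot.mk_X, coeff_add, coeff_C_mul,
    coeff_X_zero, coeff_X_one, coeff_C_zero, coeff_C_succ, mul_zero, zero_add, mul_one,
    add_zero]
  rw [add_comm]

theorem res2_of (a : ℝ[X]) : res2 (AdjoinRoot.of _ a) = lau (toLaurent a) := by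
  rw [res2, AdjoinRoot.lift_of]
  induction a using Polynomial.induction_on' with
  | add p q hp hq => rw [map_add, map_add, map_add, hp, hq]
  | monomial n c =>
    rw [← Polynomial.C_mul_X_pow_eq_monomial, Polynomial.toLaurent_C_mul_X_pow, map_mul, map_mul,
      lau_T, lau_C]
    simp [tp]

theorem res2_root : res2 (AdjoinRoot.root _) = xy := AdjoinRoot.lift_root _

theorem exists_toLaurent {a : ℝ[T;T⁻¹]} (h : ∀ k < 0, a.coeff k = 0) :
    ∃ p : ℝ[X], toLaurent p = a := by
  refine ⟨∑ k ∈ a.coeff.support, Polynomial.monomial k.toNat (a.coeff k), ?_⟩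
  apply LaurentPolynomial.ext
  intro k
  rw [map_sum]
  have : ∀ m ∈ a.coeff.support, toLaurent (Polynomial.monomial m.toNat (a.coeff m)) =
      AddMonoidAlgebra.single m (a.coeff m) := by
    intro m hm
    have : 0 ≤ m := by
      by_contra hlt
      exact (Finsupp.mem_support_iff.1 hm) (h m (by omega))
    rw [← Polynomial.C_mul_X_pow_eq_monomial, Polynomial.toLaurent_C_mul_X_pow,
      ← LaurentPolynomial.single_eq_C_mul_T, Int.toNat_of_nonneg this]
  rw [Finset.sum_congr rfl this]
  simp only [AddMonoidAlgebra.coeff_sum, AddMonoidAlgebra.coeff_single]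
  conv_rhs => rw [← Finsupp.sum_single a.coeff]
  rfl

/-- The regular functions on `D₊(y)` are those without negative powers of `T`. -/
theorem mem_S2 {f : R12} : f ∈ S2 ↔ ∀ e, ∀ k < 0, cf f e k = 0 := by
  constructor
  · rintro ⟨g, rfl⟩ e k hk
    obtain ⟨a, b, rfl⟩ := exists_of_add_of_mul_root _ g
    rw [map_add, map_mul, res2_of, res2_of, res2_root]
    have hc : ∀ p : ℝ[X], (toLaurent p).coeff k = 0 := by
      intro p
      by_contra hne
      have := LaurentPolynomial.support_coeff_toLaurent p
      have hm : k ∈ (toLaurent p).coeff.support := Finsupp.mem_support_iff.2 hne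
      rw [this] at hm
      obtain ⟨m, _, hm⟩ := Finset.mem_map.1 hm
      have : (m : ℤ) = k := hm
      omega
    fin_cases e
    · exact (cf_lau_zero _ _ _).trans (hc a)
    · exact (cf_lau_one _ _ _).trans (hc b)
  · intro h
    obtain ⟨a, ha⟩ := exists_toLaurent (h 0)
    obtain ⟨b, hb⟩ := exists_toLaurent (h 1)
    refine ⟨AdjoinRoot.of _ a + AdjoinRoot.of _ b * AdjoinRoot.root _, ?_⟩
    rw [map_add, map_mul, res2_of, res2_of, res2_root, ha, hb, ← eq_lau_coord]

theorem swap_mem_S1 {f : R12} : swap f ∈ S1 ↔ f ∈ S2 := by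
  constructor
  · rintro ⟨g, hg⟩
    exact ⟨g, by rw [← swap_res1, hg, swap_swap]⟩
  · rintro ⟨g, rfl⟩
    exact ⟨g, by rw [swap_res2]⟩

theorem swap_mem_S2 {f : R12} : swap f ∈ S2 ↔ f ∈ S1 := by
  rw [← swap_mem_S1, swap_swap]

/-- The regular functions on `D₊(z)` are the polynomials in `1 / T` and `x / T`. -/
theorem mem_S1 {f : R12} :
    f ∈ S1 ↔ (∀ k > 0, cf f 0 k = 0) ∧ ∀ k ≥ 0, cf f 1 k = 0 := by
  rw [← swap_mem_S2, mem_S2, Fin.forall_fin_two]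
  simp only [cf_swap_zero, cf_swap_one]
  constructor
  · rintro ⟨h0, h1⟩
    refine ⟨fun k hk => ?_, fun k hk => ?_⟩
    · simpa using h0 (-k) (by omega)
    · simpa using h1 (-1 - k) (by omega)
  · rintro ⟨h0, h1⟩
    exact ⟨fun k hk => h0 _ (by omega), fun k hk => h1 _ (by omega)⟩

theorem res2_injective : Function.Injective res2 := by
  rw [injective_iff_map_eq_zero]
  intro g hg
  obtain ⟨a, b, rfl⟩ := exists_of_add_of_mul_root _ g
  rw [map_add, map_mul, res2_of, res2_of, res2_root] at hg
  have h0 := coord_zero (toLaurent a) (toLaurent b)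
  have h1 := coord_one (toLaurent a) (toLaurent b)
  rw [hg] at h0 h1
  have z : ∀ e, coord 0 e = 0 := fun e => by simp [coord]
  rw [z] at h0 h1
  rw [Polynomial.toLaurent_eq_zero.1 h0.symm, Polynomial.toLaurent_eq_zero.1 h1.symm]
  simp

theorem res1_injective : Function.Injective res1 := by
  intro a b h
  apply res2_injective
  rw [← swap_res1, ← swap_res1, h]

theorem algebraMap_mem_S2 (c : ℝ) : algebraMap ℝ R12 c ∈ S2 := by
  refine ⟨AdjoinRoot.of _ (Polynomial.C c), ?_⟩
  rw [res2_of, Polynomial.toLaurent_C, lau_C]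

theorem algebraMap_mem_S1 (c : ℝ) : algebraMap ℝ R12 c ∈ S1 := by
  rw [← swap_algebraMap, swap_mem_S1]; exact algebraMap_mem_S2 c

theorem smul_mem_S2 (c : ℝ) {f : R12} (h : f ∈ S2) : c • f ∈ S2 := by
  rw [Algebra.smul_def]; exact S2.mul_mem (algebraMap_mem_S2 c) h

theorem smul_mem_S1 (c : ℝ) {f : R12} (h : f ∈ S1) : c • f ∈ S1 := by
  rw [Algebra.smul_def]; exact S1.mul_mem (algebraMap_mem_S1 c) h

theorem tp_mem_S2 {k : ℤ} (h : 0 ≤ k) : tp k ∈ S2 := by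
  obtain ⟨n, rfl⟩ := Int.eq_ofNat_of_zero_le h
  exact ⟨AdjoinRoot.of _ (X ^ n), by rw [res2_of, Polynomial.toLaurent_X_pow, lau_T]⟩

theorem tp_mem_S1 {k : ℤ} (h : k ≤ 0) : tp k ∈ S1 := by
  have := swap_tp (-k)
  rw [neg_neg] at this
  rw [← this, swap_mem_S1]; exact tp_mem_S2 (by omega)

theorem xy_mem_S2 : xy ∈ S2 := ⟨_, res2_root⟩

theorem xz_mem_S1 : xz ∈ S1 := by rw [← swap_xy, swap_mem_S1]; exact xy_mem_S2

theorem cf_tp (m : ℤ) (e : Fin 2) (k : ℤ) :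
    cf (tp m) e k = if e = 0 ∧ k = m then 1 else 0 := by
  rw [← mul_one (tp m), cf_tp_mul]
  fin_cases e
  · simp [cf_one_zero, sub_eq_zero]
  · simp [cf_one_one]

theorem cf_tp_xy (m : ℤ) (e : Fin 2) (k : ℤ) :
    cf (tp m * xy) e k = if e = 1 ∧ k = m then 1 else 0 := by
  rw [cf_tp_mul]
  conv_lhs => rw [← mul_one xy]
  fin_cases e
  · simp only [Fin.zero_eta, cf_xy_mul_zero, cf_one_one]; simp
  · simp only [Fin.mk_one, cf_xy_mul_one, cf_one_zero, sub_eq_zero]; simp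

/-- The functions that are regular everywhere are constant. -/
theorem real_of_mem {f : R12} (h2 : f ∈ S2) (h1 : f ∈ S1) : ∃ c : ℝ, f = algebraMap ℝ R12 c := by
  refine ⟨cf f 0 0, cf_ext fun e k => ?_⟩
  rw [Algebra.algebraMap_eq_smul_one, cf_smul]
  rw [mem_S2] at h2
  rw [mem_S1] at h1
  fin_cases e
  · simp only [Fin.zero_eta, cf_one_zero]
    rcases lt_trichotomy k 0 with h | h | h
    · simp [h2 0 k h, h.ne]
    · simp [h]
    · simp [h1.1 k h, h.ne']
  · simp only [Fin.mk_one, cf_one_one, mul_zero]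
    rcases lt_or_ge k 0 with h | h
    · exact h2 1 k h
    · exact h1.2 k h

/-! ### Orders at a closed point, and the units of `R₁₂` -/

/-- The value of `f ∈ R₂` at the closed point `z = 0`, whose residue field is `ℂ`. -/
def ev (f : R12) : ℂ := ⟨cf f 0 0, cf f 1 0⟩

/-- `ev` as a ring homomorphism on `R₂`. -/
def evR2 : R2 →+* ℂ :=
  AdjoinRoot.lift (eval₂RingHom (algebraMap ℝ ℂ) 0) Complex.I
    (conicPoly_eval₂ _ _ _ (by simp))

theorem coeff_toLaurent_zero (a : ℝ[X]) : (toLaurent a).coeff 0 = a.coeff 0 := by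
  rw [LaurentPolynomial.coeff_toLaurent]
  exact Finsupp.mapDomain_apply Nat.cast_injective _ 0

theorem ev_res2 (g : R2) : ev (res2 g) = evR2 g := by
  obtain ⟨a, b, rfl⟩ := exists_of_add_of_mul_root _ g
  rw [map_add, map_mul, res2_of, res2_of, res2_root, map_add, map_mul]
  simp only [evR2, AdjoinRoot.lift_of, AdjoinRoot.lift_root, ev, cf_lau_zero, cf_lau_one,
    coeff_toLaurent_zero]
  apply Complex.ext <;> simp [Polynomial.eval₂_at_zero]

theorem ev_mul {f g : R12} (hf : f ∈ S2) (hg : g ∈ S2) : ev (f * g) = ev f * ev g := by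
  obtain ⟨f, rfl⟩ := hf
  obtain ⟨g, rfl⟩ := hg
  rw [← map_mul, ev_res2, ev_res2, ev_res2, map_mul]

theorem ev_eq_zero {f : R12} : ev f = 0 ↔ ∀ e, cf f e 0 = 0 := by
  rw [Fin.forall_fin_two, Complex.ext_iff]; rfl

theorem ev_tp_mul {k : ℤ} (hk : 0 < k) {f : R12} (hf : f ∈ S2) : ev (tp k * f) = 0 := by
  rw [ev_eq_zero]
  intro e
  rw [cf_tp_mul]
  exact mem_S2.1 hf e _ (by omega)

/-- Every nonzero element of `R₁₂` is a power of `T` times an element of `R₂` that does not vanish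
at the point `z = 0`. -/
theorem exists_ord {f : R12} (hf : f ≠ 0) : ∃ p g, f = tp p * g ∧ g ∈ S2 ∧ ev g ≠ 0 := by
  set s : Finset ℤ := (coord f 0).coeff.support ∪ (coord f 1).coeff.support with hs
  have hmem : ∀ k, k ∈ s ↔ ∃ e, cf f e k ≠ 0 := by
    intro k
    rw [hs, Finset.mem_union, Finsupp.mem_support_iff, Finsupp.mem_support_iff, Fin.exists_fin_two]
    rfl
  have hne : s.Nonempty := by
    rw [Finset.nonempty_iff_ne_empty]
    intro h0
    apply hf
    apply cf_ext
    intro e k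
    rw [cf_zero]
    by_contra h
    have := (hmem k).2 ⟨e, h⟩
    rw [h0] at this
    simp at this
  refine ⟨s.min' hne, tp (-(s.min' hne)) * f, ?_, ?_, ?_⟩
  · rw [← mul_assoc, tp_mul_neg, one_mul]
  · rw [mem_S2]
    intro e k hk
    rw [cf_tp_mul]
    by_contra h
    have := s.min'_le _ ((hmem _).2 ⟨e, h⟩)
    omega
  · intro h
    rw [ev_eq_zero] at h
    obtain ⟨e, he⟩ := (hmem _).1 (s.min'_mem hne)
    apply he
    have := h e
    rw [cf_tp_mul] at this
    simpa using this

theorem tp_ne_zero (k : ℤ) : tp k ≠ 0 := by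
  intro h
  have := cf_tp k 0 k
  rw [h, cf_zero] at this
  simp at this

theorem mul_ne_zero_R12 {f g : R12} (hf : f ≠ 0) (hg : g ≠ 0) : f * g ≠ 0 := by
  obtain ⟨p, f', rfl, hf', hfe⟩ := exists_ord hf
  obtain ⟨q, g', rfl, hg', hge⟩ := exists_ord hg
  intro h
  have h2 : f' * g' = 0 := by
    calc f' * g' = tp (-(p + q)) * (tp p * f' * (tp q * g')) := by
          rw [mul_mul_mul_comm, ← tp_add, ← mul_assoc, tp_neg_mul, one_mul]
      _ = 0 := by rw [h, mul_zero]
  have h3 := ev_mul hf' hg'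
  rw [h2] at h3
  have h4 : ev 0 = 0 := ev_eq_zero.2 fun e => cf_zero e 0
  rw [h4] at h3
  exact mul_ne_zero hfe hge h3.symm

instance : Nontrivial R12 := ⟨⟨tp 0, 0, tp_ne_zero 0⟩⟩

instance : IsDomain R12 :=
  have : NoZeroDivisors R12 := ⟨fun {a b} h => by
    by_contra hc
    rw [not_or] at hc
    exact mul_ne_zero_R12 hc.1 hc.2 h⟩
  NoZeroDivisors.to_isDomain R12

instance : IsDomain R2 := res2_injective.isDomain res2

/-- An element with a denominator only at `z = 0` has no denominator if a multiple by a function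
that does not vanish there has none. -/
theorem mem_S2_of_mul {g h : R12} (hh : h ∈ S2) (he : ev h ≠ 0) (hgh : g * h ∈ S2) : g ∈ S2 := by
  rcases eq_or_ne g 0 with rfl | hg
  · exact S2.zero_mem
  obtain ⟨p, g', rfl, hg', hge⟩ := exists_ord hg
  rcases le_or_gt 0 p with hp | hp
  · exact S2.mul_mem (tp_mem_S2 hp) hg'
  exfalso
  have h1 := ev_tp_mul (k := -p) (by omega) hgh
  rw [mul_assoc, ← mul_assoc, tp_neg_mul, one_mul, ev_mul hg' hh] at h1
  exact mul_ne_zero hge he h1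

/-- The order at `z = 0` of a unit and the order of its inverse add up to zero. -/
theorem exists_ord_of_isUnit {f g : R12} (h : f * g = 1) :
    ∃ p, tp (-p) * f ∈ S2 ∧ tp p * g ∈ S2 := by
  obtain ⟨p, f', rfl, hf', hfe⟩ := exists_ord (left_ne_zero_of_mul_eq_one h)
  refine ⟨p, by rwa [← mul_assoc, tp_neg_mul, one_mul], ?_⟩
  refine mem_S2_of_mul hf' hfe ?_
  rw [mul_assoc, mul_comm g, ← mul_assoc, h]
  exact S2.one_mem

/-- The exponents of an element of `T ^ a R₂ ∩ T ^ b R₁` lie between `a` and `b`. -/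
theorem le_of_mem {f : R12} (hf : f ≠ 0) {a b : ℤ} (h2 : tp (-a) * f ∈ S2)
    (h1 : tp (-b) * f ∈ S1) : a ≤ b := by
  by_contra hlt
  apply hf
  apply cf_ext
  intro e k
  rw [cf_zero]
  rw [mem_S2] at h2
  rw [mem_S1] at h1
  simp only [cf_tp_mul, sub_neg_eq_add] at h1 h2
  rcases lt_or_ge k a with hk | hk
  · simpa using h2 e (k - a) (by omega)
  · fin_cases e
    · simpa using h1.1 (k - b) (by omega)
    · simpa using h1.2 (k - b) (by omega)

/-- The units of `R₁₂` are the real multiples of the powers of `T`. -/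
theorem unit_eq {f g : R12} (h : f * g = 1) :
    ∃ (c : ℝ) (k : ℤ), c ≠ 0 ∧ f = c • tp k ∧ g = c⁻¹ • tp (-k) := by
  obtain ⟨p, hp, hp'⟩ := exists_ord_of_isUnit h
  obtain ⟨q, hq, hq'⟩ := exists_ord_of_isUnit (f := swap f) (g := swap g)
    (by rw [← map_mul, h, map_one])
  have hq1 : tp q * f ∈ S1 := by
    rw [← swap_mem_S2, map_mul, swap_tp]; exact hq
  have hq1' : tp (-q) * g ∈ S1 := by
    rw [← swap_mem_S2, map_mul, swap_tp, neg_neg]; exact hq'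
  have h1 : p ≤ -q := le_of_mem (left_ne_zero_of_mul_eq_one h) hp (by rwa [neg_neg])
  have h2 : -p ≤ q := le_of_mem (right_ne_zero_of_mul_eq_one h) (by rwa [neg_neg]) hq1'
  have h3 : q = -p := by omega
  rw [h3] at hq1
  obtain ⟨c, hc⟩ := real_of_mem hp hq1
  have hf : f = c • tp p := by
    rw [Algebra.smul_def, ← hc, mul_comm, ← mul_assoc, tp_mul_neg, one_mul]
  have hc0 : c ≠ 0 := by
    rintro rfl
    rw [zero_smul] at hf
    rw [hf, zero_mul] at h
    exact zero_ne_one h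
  refine ⟨c, p, hc0, hf, ?_⟩
  have : f * (c⁻¹ • tp (-p)) = 1 := by
    rw [hf, smul_mul_smul_comm, tp_mul_neg, mul_inv_cancel₀ hc0, one_smul]
  calc g = g * (f * (c⁻¹ • tp (-p))) := by rw [this, mul_one]
    _ = (f * g) * (c⁻¹ • tp (-p)) := by ring
    _ = _ := by rw [h, one_mul]

/-! ### Exponents in the inverse matrix -/

/-- `f` lies in the submodule `T ^ k · S`. -/
def InT (S : Subring R12) (k : ℤ) (f : R12) : Prop := tp (-k) * f ∈ S

theorem InT.mul {S : Subring R12} {k l : ℤ} {f g : R12} (hf : InT S k f) (hg : InT S l g) :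
    InT S (k + l) (f * g) := by
  have := S.mul_mem hf hg
  rwa [mul_mul_mul_comm, ← tp_add, ← neg_add] at this

theorem InT.sum {S : Subring R12} {k : ℤ} {ι : Type*} (s : Finset ι) {f : ι → R12}
    (h : ∀ i ∈ s, InT S k (f i)) : InT S k (∑ i ∈ s, f i) := by
  rw [InT, Finset.mul_sum]
  exact S.sum_mem h

theorem InT.one (S : Subring R12) : InT S 0 1 := by
  rw [InT, neg_zero, tp_zero, one_mul]; exact S.one_mem

theorem InT.prod {S : Subring R12} {k : ℤ} {ι : Type*} (s : Finset ι) {f : ι → R12}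
    (h : ∀ i ∈ s, InT S k (f i)) : InT S (s.card * k) (∏ i ∈ s, f i) := by
  classical
  induction s using Finset.induction_on with
  | empty => simpa using InT.one S
  | insert i s hi ih =>
    rw [Finset.prod_insert hi, Finset.card_insert_of_notMem hi]
    have := (h i (Finset.mem_insert_self _ _)).mul
      (ih fun j hj => h j (Finset.mem_insert_of_mem hj))
    convert this using 1
    push_cast; ring

theorem InT.neg {S : Subring R12} {k : ℤ} {f : R12} (h : InT S k f) : InT S k (-f) := by
  rw [InT, mul_neg]; exact S.neg_mem h

theorem InT.det {S : Subring R12} {k : ℤ} {n : ℕ} {M : Matrix (Fin n) (Fin n) R12}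
    (h : ∀ i j, InT S k (M i j)) : InT S (n * k) M.det := by
  rw [Matrix.det_apply]
  apply InT.sum
  intro σ _
  have h1 : InT S (n * k) (∏ i, M (σ i) i) := by
    simpa using InT.prod Finset.univ (fun i _ => h (σ i) i)
  rcases Int.units_eq_one_or (Equiv.Perm.sign σ) with hs | hs
  · simpa [hs] using h1
  · simpa [hs] using h1.neg

theorem InT.mono2 {k l : ℤ} (hkl : l ≤ k) {f : R12} (h : InT S2 k f) : InT S2 l f := by
  have := S2.mul_mem (tp_mem_S2 (k := k - l) (by omega)) h
  rw [← mul_assoc, ← tp_add] at this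
  rw [InT]
  convert this using 3; ring

theorem InT.mono1 {k l : ℤ} (hkl : k ≤ l) {f : R12} (h : InT S1 k f) : InT S1 l f := by
  have := S1.mul_mem (tp_mem_S1 (k := k - l) (by omega)) h
  rw [← mul_assoc, ← tp_add] at this
  rw [InT]
  convert this using 3; ring

theorem InT.smul2 {k : ℤ} {f : R12} (c : ℝ) (h : InT S2 k f) : InT S2 k (c • f) := by
  rw [InT, mul_smul_comm]; exact smul_mem_S2 c h

theorem InT.smul1 {k : ℤ} {f : R12} (c : ℝ) (h : InT S1 k f) : InT S1 k (c • f) := by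
  rw [InT, mul_smul_comm]; exact smul_mem_S1 c h

theorem InT_tp (S : Subring R12) (k : ℤ) : InT S k (tp k) := by
  rw [InT, tp_neg_mul]; exact S.one_mem

/-- If the entries of an invertible matrix have all their exponents in `[-w, w]`, those of
the inverse have theirs in `[-(2nw + n), 2nw + n]`. -/
theorem inverse_bounds {n : ℕ} (hn : 1 ≤ n) {M N : Matrix (Fin n) (Fin n) R12} (h : M * N = 1)
    {w : ℕ} (h2 : ∀ i j, InT S2 (-w) (M i j)) (h1 : ∀ i j, InT S1 (w + 1) (M i j)) (i j : Fin n) :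
    InT S2 (-(2 * n * w + n)) (N i j) ∧ InT S1 (2 * n * w + n) (N i j) := by
  have hdet : M.det * N.det = 1 := by rw [← Matrix.det_mul, h, Matrix.det_one]
  obtain ⟨c, k, hc, hM, hN⟩ := unit_eq hdet
  have d2 := InT.det h2
  have d1 := InT.det h1
  have hne : M.det ≠ 0 := left_ne_zero_of_mul_eq_one hdet
  have ht2 : InT S2 k M.det := by rw [hM]; exact (InT_tp _ _).smul2 c
  have ht1 : InT S1 k M.det := by rw [hM]; exact (InT_tp _ _).smul1 c
  have hk1 : (n : ℤ) * -w ≤ k := le_of_mem hne d2 ht1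
  have hk2 : k ≤ (n : ℤ) * (w + 1) := le_of_mem hne ht2 d1
  -- the determinant is a multiple of `T ^ k` with `-n w ≤ k ≤ n (w + 1)`, and Cramer's rule applies
  have hadj : N = N.det • M.adjugate := by
    have h3 : M.adjugate * M * N = M.det • N := by
      rw [Matrix.adjugate_mul, smul_mul_assoc, one_mul]
    rw [mul_assoc, h, mul_one] at h3
    rw [h3, smul_smul, mul_comm, hdet, one_smul]
  obtain ⟨m, rfl⟩ : ∃ m, n = m + 1 := ⟨n - 1, by omega⟩
  have hsign : ∀ (S : Subring R12) (l : ℤ) (r : ℕ) (f : R12), InT S l f →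
      InT S l ((-1) ^ r * f) := by
    intro S l r f hf
    rcases neg_one_pow_eq_or R12 r with hr | hr
    · rwa [hr, one_mul]
    · rw [hr, neg_one_mul]; exact hf.neg
  have a2 : InT S2 (m * -w) (M.adjugate i j) := by
    rw [Matrix.adjugate_fin_succ_eq_det_submatrix]
    exact hsign _ _ _ _ (InT.det fun _ _ => h2 _ _)
  have a1 : InT S1 (m * (w + 1)) (M.adjugate i j) := by
    rw [Matrix.adjugate_fin_succ_eq_det_submatrix]
    exact hsign _ _ _ _ (InT.det fun _ _ => h1 _ _)
  have e : N i j = c⁻¹ • (tp (-k) * M.adjugate i j) := by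
    rw [← smul_mul_assoc, ← hN]
    exact congrFun (congrFun hadj i) j
  rw [e]
  push_cast at hk1 hk2 ⊢
  constructor
  · refine InT.mono2 ?_ (((InT_tp S2 (-k)).mul a2).smul2 _)
    nlinarith
  · refine InT.mono1 ?_ (((InT_tp S1 (-k)).mul a1).smul1 _)
    nlinarith

/-! ### The coordinate rings of the charts are principal ideal domains -/

/-- The inhomogeneous linear form `α + β s + γ x` in the coordinate ring of an affine chart. -/
def linForm (α β γ : ℝ) : R2 :=
  AdjoinRoot.of _ (C α + C β * X) + AdjoinRoot.of _ (C γ) * AdjoinRoot.root _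

theorem root_mul_root :
    (AdjoinRoot.root (conicPoly (X : ℝ[X]))) * AdjoinRoot.root _ =
      -AdjoinRoot.of _ (X ^ 2 + 1) := by
  apply res2_injective
  rw [map_mul, map_neg, res2_root, res2_of, xy_mul_xy]
  simp [lau_T]

/-- A homomorphism to `ℂ` is determined by the images of the coordinates. -/
theorem hom_apply (ψ : R2 →ₐ[ℝ] ℂ) (a b : ℝ[X]) :
    ψ (AdjoinRoot.of _ a + AdjoinRoot.of _ b * AdjoinRoot.root _) =
      aeval (ψ (AdjoinRoot.of _ X)) a + aeval (ψ (AdjoinRoot.of _ X)) b * ψ (AdjoinRoot.root _) := by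
  have h : ∀ p : ℝ[X], ψ (AdjoinRoot.of _ p) = aeval (ψ (AdjoinRoot.of _ X)) p := by
    intro p
    have e : ψ.comp (Algebra.algHom ℝ ℝ[X] R2) = aeval (ψ (AdjoinRoot.of _ X)) := by
      apply Polynomial.algHom_ext
      rw [aeval_X]; rfl
    exact DFunLike.congr_fun e p
  rw [map_add, map_mul, h a, h b]

/-- The kernel of a complex point contains a real linear form, as `1, s, x` have values in the real
plane `ℂ`; such a form generates it. -/
theorem ker_eq_span (ψ : R2 →ₐ[ℝ] ℂ) :
    ∃ α β γ : ℝ, (β ≠ 0 ∨ γ ≠ 0) ∧ RingHom.ker ψ = Ideal.span {linForm α β γ} := by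
  set σ := ψ (AdjoinRoot.of _ X) with hσ
  set ξ := ψ (AdjoinRoot.root _) with hξ
  have hrel : ξ * ξ = -(σ ^ 2 + 1) := by
    rw [hξ, ← map_mul, root_mul_root, map_neg, map_add, map_pow]; simp [hσ]
  have hform : ∀ α β γ : ℝ, ψ (linForm α β γ) = α + β * σ + γ * ξ := by
    intro α β γ
    rw [linForm, hom_apply]; simp [← hσ, ← hξ]
  -- if `s` has a real value, `s - s₀` is the linear form; `x` then has an imaginary value
  by_cases him : σ.im = 0
  · have hξim : ξ.im ≠ 0 := by
      intro h0
      have := congrArg Complex.re hrel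
      simp [pow_two, him, h0] at this
      nlinarith [mul_self_nonneg ξ.re, mul_self_nonneg σ.re]
    have hσr : σ = (σ.re : ℂ) := Complex.ext rfl (by simpa using him)
    refine ⟨-σ.re, 1, 0, Or.inl one_ne_zero, le_antisymm ?_ ?_⟩
    · intro f hf
      obtain ⟨a, b, rfl⟩ := exists_of_add_of_mul_root _ f
      have h0 : ψ _ = 0 := hf
      rw [hom_apply, ← hσ, ← hξ, hσr] at h0
      have ev : ∀ p : ℝ[X], aeval (σ.re : ℂ) p = ((p.eval σ.re : ℝ) : ℂ) := by
        intro p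
        have := Polynomial.aeval_algebraMap_apply ℂ σ.re p
        simpa [Polynomial.coe_aeval_eq_eval] using this
      rw [ev, ev] at h0
      have hb : b.eval σ.re = 0 := by
        have := congrArg Complex.im h0
        simpa [hξim] using this
      have ha : a.eval σ.re = 0 := by
        rw [hb] at h0
        simpa using h0
      have hd : ∀ p : ℝ[X], p.eval σ.re = 0 →
          AdjoinRoot.of _ p ∈ Ideal.span {linForm (-σ.re) 1 0} := by
        intro p hp
        obtain ⟨q, rfl⟩ := Polynomial.dvd_iff_isRoot.2 hp
        rw [map_mul, Ideal.mem_span_singleton]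
        refine ⟨AdjoinRoot.of _ q, ?_⟩
        congr 1
        simp [linForm]; ring
      exact Ideal.add_mem _ (hd a ha) (Ideal.mul_mem_right _ _ (hd b hb))
    · rw [Ideal.span_singleton_le_iff_mem]
      change ψ _ = 0
      rw [hform, hσr]; simp
  · set β := -(ξ.im / σ.im) with hβ
    set α := -(ξ.re + β * σ.re) with hα
    refine ⟨α, β, 1, Or.inr one_ne_zero, le_antisymm ?_ ?_⟩
    · intro f hf
      obtain ⟨a, b, rfl⟩ := exists_of_add_of_mul_root _ f
      -- otherwise `ℂ` is spanned by `1` and the value of `s`; modulo the linear form `m + x`, every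
      -- element is a polynomial in `s`, and the quadratic polynomial `q = (m + x)(m - x)` vanishes
      set m : ℝ[X] := C α + C β * X with hm
      set q : ℝ[X] := C (β ^ 2 + 1) * X ^ 2 + C (2 * α * β) * X + C (α ^ 2 + 1) with hq
      have hqe : q = m ^ 2 + X ^ 2 + 1 := by
        rw [hq, hm]; simp only [map_add, map_mul, map_pow, map_one, map_ofNat]; ring
      have hβ1 : β ^ 2 + 1 ≠ 0 := by positivity
      have hqdeg : q.degree = 2 := Polynomial.degree_quadratic hβ1
      have hl : linForm α β 1 = AdjoinRoot.of _ m + AdjoinRoot.root _ := by simp [linForm, hm]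
      have hqm : AdjoinRoot.of _ q ∈ Ideal.span {linForm α β 1} := by
        rw [Ideal.mem_span_singleton]
        refine ⟨AdjoinRoot.of _ m - AdjoinRoot.root _, ?_⟩
        rw [hl, hqe]
        have := root_mul_root
        simp only [map_add, map_pow, map_one] at this ⊢
        linear_combination this
      set g := a - b * m with hg
      have hfg : AdjoinRoot.of _ a + AdjoinRoot.of _ b * AdjoinRoot.root _ =
          AdjoinRoot.of _ g + AdjoinRoot.of _ b * linForm α β 1 := by
        rw [hl, hg, map_sub, map_mul]; ring
      have hlin : ψ (linForm α β 1) = 0 := by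
        rw [hform]
        apply Complex.ext
        · simp [hα]
        · simp [hβ, him]
      have hlk : linForm α β 1 ∈ Ideal.span {linForm α β 1} := Ideal.mem_span_singleton_self _
      rw [hfg]
      refine Ideal.add_mem _ ?_ (Ideal.mul_mem_left _ _ hlk)
      have hqr := EuclideanDomain.div_add_mod g q
      set r := g % q with hr
      have hrdeg : r.degree ≤ 1 := by
        have h1 : r.degree < q.degree := EuclideanDomain.mod_lt g (by
          intro h0; rw [h0] at hqdeg; simp at hqdeg)
        rw [hqdeg] at h1
        exact Order.le_of_lt_succ h1
      have hψg : ψ (AdjoinRoot.of _ g) = 0 := by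
        have h0 : ψ _ = 0 := hf
        rw [hfg, map_add, map_mul, hlin, mul_zero, add_zero] at h0
        exact h0
      have hψq : ψ (AdjoinRoot.of _ q) = 0 := by
        obtain ⟨c, hc⟩ := Ideal.mem_span_singleton.1 hqm
        rw [hc, map_mul, hlin, zero_mul]
      have hψr : ψ (AdjoinRoot.of _ r) = 0 := by
        rw [← hqr, map_add, map_mul, map_add, map_mul, hψq, zero_mul, zero_add] at hψg
        exact hψg
      have hr2 := Polynomial.eq_X_add_C_of_degree_le_one hrdeg
      have h3 := hom_apply ψ r 0
      rw [map_zero, zero_mul, add_zero, hψr, hr2, ← hσ] at h3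
      simp at h3
      have h4 := congrArg Complex.im h3
      simp [him] at h4
      have h5 := congrArg Complex.re h3
      simp [h4] at h5
      have hr0 : r = 0 := by rw [hr2, h4, ← h5]; simp
      rw [← hqr, hr0, add_zero, map_mul]
      exact Ideal.mul_mem_right _ _ hqm
    · rw [Ideal.span_singleton_le_iff_mem]
      change ψ _ = 0
      rw [hform]
      apply Complex.ext
      · simp [hα]
      · simp [hβ, him]

/-- Every nonzero prime ideal of the coordinate ring is generated by a linear form: its residue
field is `ℂ`, since the conic has no real point, and `1, s, x` are linearly dependent there. -/
theorem prime_eq_span (P : Ideal R2) [hP : P.IsPrime] (h0 : P ≠ ⊥) :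
    ∃ α β γ : ℝ, (β ≠ 0 ∨ γ ≠ 0) ∧ P = Ideal.span {linForm α β γ} := by
  obtain ⟨f, hfP, hf0⟩ := Submodule.exists_mem_ne_zero_of_ne_bot h0
  obtain ⟨g, hgP, hg0⟩ : ∃ g : ℝ[X], AdjoinRoot.of _ g ∈ P ∧ g ≠ 0 := by
    obtain ⟨a, b, rfl⟩ := exists_of_add_of_mul_root _ f
    -- the norm of `f = a + b x`, which is a sum of squares in `ℝ[s]`
    refine ⟨a ^ 2 + b ^ 2 * (X ^ 2 + 1), ?_, ?_⟩
    · have := P.mul_mem_right (AdjoinRoot.of _ a - AdjoinRoot.of _ b * AdjoinRoot.root _) hfP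
      convert this using 1
      have h := root_mul_root
      simp only [map_add, map_mul, map_pow, map_one] at h ⊢
      linear_combination (AdjoinRoot.of (conicPoly (X : ℝ[X])) b) ^ 2 * h
    · intro h
      have hev : ∀ t : ℝ, a.eval t = 0 ∧ b.eval t = 0 := by
        intro t
        have := congrArg (Polynomial.eval t) h
        simp at this
        have h1 : 0 ≤ (b.eval t) ^ 2 * (t ^ 2 + 1) := by positivity
        have h2 : (a.eval t) ^ 2 = 0 := by nlinarith [sq_nonneg (a.eval t)]
        have h3 : (b.eval t) ^ 2 * (t ^ 2 + 1) = 0 := by nlinarith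
        refine ⟨by simpa using h2, ?_⟩
        have : t ^ 2 + 1 ≠ 0 := by positivity
        simpa [this] using h3
      have ha : a = 0 := Polynomial.funext fun t => by simpa using (hev t).1
      have hb : b = 0 := Polynomial.funext fun t => by simpa using (hev t).2
      apply hf0
      rw [ha, hb]; simp
  set π : R2 →ₐ[ℝ] R2 ⧸ P := Ideal.Quotient.mkₐ ℝ P with hπ
  have hs : IsIntegral ℝ (π (AdjoinRoot.of _ X)) := by
    rw [← isAlgebraic_iff_isIntegral]
    refine ⟨g, hg0, ?_⟩
    have e : (π.comp (Algebra.algHom ℝ ℝ[X] R2)) = aeval (π (AdjoinRoot.of _ X)) := by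
      apply Polynomial.algHom_ext
      rw [aeval_X]; rfl
    rw [← e]
    exact Ideal.Quotient.eq_zero_iff_mem.2 hgP
  have hof : ∀ a : ℝ[X], IsIntegral ℝ (π (AdjoinRoot.of _ a)) := by
    intro a
    have e : (π.comp (Algebra.algHom ℝ ℝ[X] R2)) = aeval (π (AdjoinRoot.of _ X)) := by
      apply Polynomial.algHom_ext
      rw [aeval_X]; rfl
    have : π (AdjoinRoot.of _ a) = aeval (π (AdjoinRoot.of _ X)) a := by rw [← e]; rfl
    rw [this]
    exact IsIntegral.of_mem_of_fg _ hs.fg_adjoin_singleton _ (aeval_mem_adjoin_singleton ℝ _)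
  have hx : IsIntegral ℝ (π (AdjoinRoot.root _)) := by
    apply IsIntegral.of_pow (n := 2) (by norm_num)
    rw [pow_two, ← map_mul, root_mul_root, map_neg]
    exact (hof _).neg
  have hint : Algebra.IsIntegral ℝ (R2 ⧸ P) := by
    constructor
    intro y
    obtain ⟨f, rfl⟩ := Ideal.Quotient.mkₐ_surjective ℝ P y
    obtain ⟨a, b, rfl⟩ := exists_of_add_of_mul_root _ f
    change IsIntegral ℝ (π _)
    rw [map_add, map_mul]
    exact (hof a).add ((hof b).mul hx)
  have hfield : IsField (R2 ⧸ P) := isField_of_isIntegral_of_isField' (Field.toIsField ℝ)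
  let _ : Field (R2 ⧸ P) := hfield.toField
  have halg : Algebra.IsAlgebraic ℝ (R2 ⧸ P) := Algebra.IsIntegral.isAlgebraic
  have hker : ∀ f, π f = 0 ↔ f ∈ P := fun f => Ideal.Quotient.eq_zero_iff_mem
  -- an algebraic extension of `ℝ` is `ℝ` or `ℂ`, and `x² + s² + 1 = 0` has no solution in `ℝ`
  rcases Real.nonempty_algEquiv_or (R2 ⧸ P) with ⟨⟨φ⟩⟩ | ⟨⟨φ⟩⟩
  · exfalso
    have h := congrArg (fun f => φ (π f)) root_mul_root
    simp only [map_mul, map_neg, map_add, map_pow, map_one] at h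
    nlinarith [mul_self_nonneg (φ (π (AdjoinRoot.root _))),
      sq_nonneg (φ (π (AdjoinRoot.of (conicPoly (X : ℝ[X])) X)))]
  · obtain ⟨α, β, γ, hne, hk⟩ := ker_eq_span (φ.toAlgHom.comp π)
    refine ⟨α, β, γ, hne, ?_⟩
    rw [← hk]
    ext f
    rw [← hker f]
    change _ ↔ φ (π f) = 0
    rw [map_eq_zero_iff φ φ.injective]

instance : IsPrincipalIdealRing R2 := by
  apply IsPrincipalIdealRing.of_prime
  intro P hP
  rcases eq_or_ne P ⊥ with rfl | h
  · exact ⟨0, by simp⟩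
  · obtain ⟨α, β, γ, _, h⟩ := prime_eq_span P h
    exact ⟨_, h⟩

/-- The entries of a nonzero vector generate the unit ideal, unless they have a linear form as a
common divisor. -/
theorem unimodular_or_divisible {n : ℕ} (v : Fin n → R2) (hv : v ≠ 0) :
    Ideal.span (Set.range v) = ⊤ ∨
      ∃ (α β γ : ℝ) (v' : Fin n → R2), (β ≠ 0 ∨ γ ≠ 0) ∧ ∀ i, v i = linForm α β γ * v' i := by
  rw [or_iff_not_imp_left]
  intro h
  obtain ⟨P, hP, hle⟩ := Ideal.exists_le_maximal _ h
  have h0 : P ≠ ⊥ := by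
    rintro rfl
    apply hv
    ext i
    exact Ideal.mem_bot.1 (hle (Ideal.subset_span ⟨i, rfl⟩))
  obtain ⟨α, β, γ, hne, hs⟩ := prime_eq_span P h0
  have : ∀ i, ∃ c, v i = linForm α β γ * c := by
    intro i
    have := hle (Ideal.subset_span ⟨i, rfl⟩)
    rw [hs, Ideal.mem_span_singleton] at this
    exact this
  choose v' hv' using this
  exact ⟨α, β, γ, v', hne, hv'⟩

/-- Over a principal ideal domain, every unimodular vector is the first column of an invertible
matrix. -/
theorem exists_completion {R : Type*} [CommRing R] [IsDomain R] [IsPrincipalIdealRing R] {n : ℕ}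
    (v : Fin (n + 1) → R) (hv : Ideal.span (Set.range v) = ⊤) :
    ∃ A B : Matrix (Fin (n + 1)) (Fin (n + 1)) R, A * B = 1 ∧ B * A = 1 ∧ ∀ i, A i 0 = v i := by
  have h1 : (1 : R) ∈ Ideal.span (Set.range v) := by rw [hv]; trivial
  obtain ⟨c, hc⟩ := (Ideal.mem_span_range_iff_exists_fun).1 h1
  set φ : (Fin (n + 1) → R) →ₗ[R] R := Fintype.linearCombination R c with hφ
  have hφv : φ v = 1 := by
    rw [hφ, Fintype.linearCombination_apply, ← hc]
    exact Finset.sum_congr rfl fun i _ => by rw [smul_eq_mul, mul_comm]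
  -- the functional `φ` splits off the line spanned by `v`, and its kernel is free
  obtain ⟨m, b⟩ := Submodule.basisOfPid (Pi.basisFun R (Fin (n + 1))) (LinearMap.ker φ)
  have hli : ∀ (c : R), ∀ x ∈ LinearMap.ker φ, c • v + x = 0 → c = 0 := by
    intro c x hx h
    have := congrArg φ h
    rw [map_add, map_smul, hφv, LinearMap.mem_ker.1 hx] at this
    simpa using this
  have hsp : ∀ z, ∃ c : R, z + c • v ∈ LinearMap.ker φ := by
    intro z
    refine ⟨-φ z, ?_⟩
    rw [LinearMap.mem_ker, map_add, map_smul, hφv]; simp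
  set B := Module.Basis.mkFinCons v b hli hsp with hB
  have hm : m = n := by
    have h2 := Module.finrank_eq_card_basis B
    rw [Module.finrank_fintype_fun_eq_card] at h2
    simpa using h2.symm
  subst hm
  refine ⟨(Pi.basisFun R _).toMatrix B, B.toMatrix (Pi.basisFun R _),
    Module.Basis.toMatrix_mul_toMatrix_flip _ _, Module.Basis.toMatrix_mul_toMatrix_flip _ _, ?_⟩
  intro i
  rw [Module.Basis.toMatrix_apply, hB, Module.Basis.coe_mkFinCons]
  simp

/-! ### Equivalence of transition matrices -/

/-- All entries of the matrix `A` lie in the subring `S`. -/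
def Ent (S : Subring R12) {κ μ : Type} (A : Matrix κ μ R12) : Prop := ∀ i j, A i j ∈ S

section Ent
variable {S : Subring R12} {κ μ ν κ' μ' : Type}

theorem Ent.mul [Fintype μ] {A : Matrix κ μ R12} {B : Matrix μ ν R12} (hA : Ent S A)
    (hB : Ent S B) : Ent S (A * B) := fun i j => by
  rw [Matrix.mul_apply]
  exact S.sum_mem fun k _ => S.mul_mem (hA i k) (hB k j)

theorem Ent.one [DecidableEq κ] : Ent S (1 : Matrix κ κ R12) := fun i j => by
  rw [Matrix.one_apply]; split_ifs
  · exact S.one_mem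
  · exact S.zero_mem

theorem Ent.zero : Ent S (0 : Matrix κ μ R12) := fun _ _ => S.zero_mem

theorem Ent.neg {A : Matrix κ μ R12} (hA : Ent S A) : Ent S (-A) := fun i j => S.neg_mem (hA i j)

theorem Ent.submatrix {A : Matrix κ μ R12} (hA : Ent S A) (f : κ' → κ) (g : μ' → μ) :
    Ent S (A.submatrix f g) := fun _ _ => hA _ _

theorem Ent.fromBlocks {A : Matrix κ μ R12} {B : Matrix κ μ' R12} {C : Matrix κ' μ R12}
    {D : Matrix κ' μ' R12} (hA : Ent S A) (hB : Ent S B) (hC : Ent S C) (hD : Ent S D) :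
    Ent S (Matrix.fromBlocks A B C D) := by
  rintro (i | i) (j | j)
  exacts [hA i j, hB i j, hC i j, hD i j]

theorem Ent.mulVec [Fintype μ] {A : Matrix κ μ R12} {v : μ → R12} (hA : Ent S A)
    (hv : ∀ i, v i ∈ S) (i : κ) : A.mulVec v i ∈ S :=
  S.sum_mem fun k _ => S.mul_mem (hA i k) (hv k)

end Ent

/-- Equivalence of transition matrices: `L M R = D` with `L` invertible over `R₂` and `R`
invertible over `R₁`. The index types of `M` and `D` are allowed to be different, which makes
permutations of the coordinates special cases. -/
def Eqv {κ μ : Type} [Fintype κ] [Fintype μ] [DecidableEq κ] [DecidableEq μ]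
    (M : Matrix κ κ R12) (D : Matrix μ μ R12) : Prop :=
  ∃ (L : Matrix μ κ R12) (L' : Matrix κ μ R12) (R : Matrix κ μ R12) (R' : Matrix μ κ R12),
    (Ent S2 L ∧ Ent S2 L' ∧ L * L' = 1 ∧ L' * L = 1) ∧
    (Ent S1 R ∧ Ent S1 R' ∧ R * R' = 1 ∧ R' * R = 1) ∧ L * M * R = D

section Eqv
variable {κ μ ν κ' μ' : Type} [Fintype κ] [Fintype μ] [Fintype ν] [Fintype κ'] [Fintype μ']
  [DecidableEq κ] [DecidableEq μ] [DecidableEq ν] [DecidableEq κ'] [DecidableEq μ']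

theorem Eqv.refl (M : Matrix κ κ R12) : Eqv M M :=
  ⟨1, 1, 1, 1, ⟨Ent.one, Ent.one, by simp, by simp⟩, ⟨Ent.one, Ent.one, by simp, by simp⟩,
    by simp⟩

theorem Eqv.of_eq {M D : Matrix κ κ R12} (h : M = D) : Eqv M D := h ▸ Eqv.refl M

theorem Eqv.symm {M : Matrix κ κ R12} {D : Matrix μ μ R12} (h : Eqv M D) : Eqv D M := by
  obtain ⟨L, L', R, R', ⟨h1, h2, h3, h4⟩, ⟨h5, h6, h7, h8⟩, rfl⟩ := h
  refine ⟨L', L, R', R, ⟨h2, h1, h4, h3⟩, ⟨h6, h5, h8, h7⟩, ?_⟩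
  calc L' * (L * M * R) * R' = (L' * L) * M * (R * R') := by simp only [Matrix.mul_assoc]
    _ = M := by rw [h4, h7, Matrix.one_mul, Matrix.mul_one]

theorem Eqv.trans {M : Matrix κ κ R12} {D : Matrix μ μ R12} {F : Matrix ν ν R12} (h : Eqv M D)
    (g : Eqv D F) : Eqv M F := by
  obtain ⟨L, L', R, R', ⟨h1, h2, h3, h4⟩, ⟨h5, h6, h7, h8⟩, rfl⟩ := h
  obtain ⟨P, P', Q, Q', ⟨g1, g2, g3, g4⟩, ⟨g5, g6, g7, g8⟩, rfl⟩ := g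
  refine ⟨P * L, L' * P', R * Q, Q' * R', ⟨g1.mul h1, h2.mul g2, ?_, ?_⟩,
    ⟨h5.mul g5, g6.mul h6, ?_, ?_⟩, by simp only [Matrix.mul_assoc]⟩
  · rw [Matrix.mul_assoc, ← Matrix.mul_assoc L, h3, Matrix.one_mul, g3]
  · rw [Matrix.mul_assoc, ← Matrix.mul_assoc P', g4, Matrix.one_mul, h4]
  · rw [Matrix.mul_assoc, ← Matrix.mul_assoc Q, g7, Matrix.one_mul, h7]
  · rw [Matrix.mul_assoc, ← Matrix.mul_assoc R', h8, Matrix.one_mul, g8]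

theorem Eqv.of_submatrix (M : Matrix κ κ R12) (e : μ ≃ κ) : Eqv M (M.submatrix e e) := by
  have h1 : (1 : Matrix κ κ R12).submatrix e id * (1 : Matrix κ κ R12).submatrix id e = 1 := by
    rw [← Matrix.submatrix_mul _ _ e id e Function.bijective_id, Matrix.mul_one]
    exact Matrix.submatrix_one_equiv e
  have h2 : (1 : Matrix κ κ R12).submatrix id e * (1 : Matrix κ κ R12).submatrix e id = 1 := by
    rw [← Matrix.submatrix_mul _ _ id e id e.bijective, Matrix.mul_one, Matrix.submatrix_id_id]
  refine ⟨(1 : Matrix κ κ R12).submatrix e id, (1 : Matrix κ κ R12).submatrix id e,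
    (1 : Matrix κ κ R12).submatrix id e, (1 : Matrix κ κ R12).submatrix e id,
    ⟨Ent.one.submatrix _ _, Ent.one.submatrix _ _, h1, h2⟩,
    ⟨Ent.one.submatrix _ _, Ent.one.submatrix _ _, h2, h1⟩, ?_⟩
  have : M = M.submatrix id id := rfl
  conv_lhs => rw [this]
  rw [← Matrix.submatrix_mul _ _ e id id Function.bijective_id, Matrix.one_mul,
    ← Matrix.submatrix_mul _ _ e id e Function.bijective_id, Matrix.mul_one]

theorem Eqv.diag {A : Matrix κ κ R12} {A' : Matrix κ' κ' R12} {D : Matrix μ μ R12}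
    {D' : Matrix μ' μ' R12} (h : Eqv A A') (g : Eqv D D') :
    Eqv (Matrix.fromBlocks A 0 0 D) (Matrix.fromBlocks A' 0 0 D') := by
  obtain ⟨L, L', R, R', ⟨h1, h2, h3, h4⟩, ⟨h5, h6, h7, h8⟩, rfl⟩ := h
  obtain ⟨P, P', Q, Q', ⟨g1, g2, g3, g4⟩, ⟨g5, g6, g7, g8⟩, rfl⟩ := g
  refine ⟨Matrix.fromBlocks L 0 0 P, Matrix.fromBlocks L' 0 0 P', Matrix.fromBlocks R 0 0 Q,
    Matrix.fromBlocks R' 0 0 Q', ⟨h1.fromBlocks Ent.zero Ent.zero g1,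
      h2.fromBlocks Ent.zero Ent.zero g2, ?_, ?_⟩, ⟨h5.fromBlocks Ent.zero Ent.zero g5,
      h6.fromBlocks Ent.zero Ent.zero g6, ?_, ?_⟩, ?_⟩
  all_goals simp [Matrix.fromBlocks_multiply, h3, h4, h7, h8, g3, g4, g7, g8]

/-- A change of the lower right block by an equivalence can be extended to the matrix, at the
expense of the upper right block. -/
theorem Eqv.triangular (A : Matrix κ κ R12) (B : Matrix κ μ R12) {D : Matrix μ μ R12}
    {D' : Matrix μ' μ' R12} (g : Eqv D D') :
    ∃ B', Eqv (Matrix.fromBlocks A B 0 D) (Matrix.fromBlocks A B' 0 D') := by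
  obtain ⟨P, P', Q, Q', ⟨g1, g2, g3, g4⟩, ⟨g5, g6, g7, g8⟩, rfl⟩ := g
  refine ⟨B * Q, Matrix.fromBlocks 1 0 0 P, Matrix.fromBlocks 1 0 0 P', Matrix.fromBlocks 1 0 0 Q,
    Matrix.fromBlocks 1 0 0 Q', ⟨Ent.one.fromBlocks Ent.zero Ent.zero g1,
      Ent.one.fromBlocks Ent.zero Ent.zero g2, ?_, ?_⟩, ⟨Ent.one.fromBlocks Ent.zero Ent.zero g5,
      Ent.one.fromBlocks Ent.zero Ent.zero g6, ?_, ?_⟩, ?_⟩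
  all_goals simp [Matrix.fromBlocks_multiply, g3, g4, g7, g8]

/-- The upper right block can be changed by left multiples of `D` and right multiples of `A`. -/
theorem Eqv.clear (A : Matrix κ κ R12) (B B' : Matrix κ μ R12) (D : Matrix μ μ R12)
    (X : Matrix κ μ R12) (Y : Matrix κ μ R12) (hX : Ent S2 X) (hY : Ent S1 Y)
    (h : B = B' + (X * D + A * Y)) :
    Eqv (Matrix.fromBlocks A B 0 D) (Matrix.fromBlocks A B' 0 D) := by
  refine ⟨Matrix.fromBlocks 1 (-X) 0 1, Matrix.fromBlocks 1 X 0 1, Matrix.fromBlocks 1 (-Y) 0 1,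
    Matrix.fromBlocks 1 Y 0 1, ⟨Ent.one.fromBlocks hX.neg Ent.zero Ent.one,
      Ent.one.fromBlocks hX Ent.zero Ent.one, ?_, ?_⟩, ⟨Ent.one.fromBlocks hY.neg Ent.zero Ent.one,
      Ent.one.fromBlocks hY Ent.zero Ent.one, ?_, ?_⟩, ?_⟩
  · simp [Matrix.fromBlocks_multiply]
  · simp [Matrix.fromBlocks_multiply]
  · simp [Matrix.fromBlocks_multiply]
  · simp [Matrix.fromBlocks_multiply]
  · subst h
    simp [Matrix.fromBlocks_multiply]
    abel

theorem Eqv.card_eq {M : Matrix κ κ R12} {D : Matrix μ μ R12} (h : Eqv M D) :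
    Fintype.card κ = Fintype.card μ := by
  obtain ⟨L, L', R, R', ⟨h1, h2, h3, h4⟩, -, rfl⟩ := h
  have e := (Matrix.toLin'OfInv h3 h4).finrank_eq
  simpa using e.symm

theorem Eqv.isUnit_det {κ : Type} [Fintype κ] [DecidableEq κ] {M D : Matrix κ κ R12} (h : Eqv M D)
    (hM : IsUnit M.det) : IsUnit D.det := by
  obtain ⟨L, L', R, R', ⟨h1, h2, h3, h4⟩, ⟨h5, h6, h7, h8⟩, rfl⟩ := h
  rw [Matrix.det_mul, Matrix.det_mul]
  have hL : IsUnit L.det := IsUnit.of_mul_eq_one L'.det (by rw [← Matrix.det_mul, h3, Matrix.det_one])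
  have hR : IsUnit R.det := IsUnit.of_mul_eq_one R'.det (by rw [← Matrix.det_mul, h7, Matrix.det_one])
  exact (hL.mul hM).mul hR

end Eqv

/-! ### The blocks as transition matrices -/

theorem negYZ_zpow (k : ℤ) : ((negYZ ^ k : R12ˣ) : R12) = (-1 : ℝ) ^ k • tp (-k) := by
  have h : negYZ ^ k = (-1) ^ k * zy ^ (-k) := by
    rw [negYZ, ← neg_one_mul, mul_zpow, yz, inv_zpow, zpow_neg]
  rw [h]
  rcases Int.even_or_odd k with hk | hk
  · simp [hk.neg_one_zpow, tp]
  · simp [hk.neg_one_zpow, tp]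

theorem tp_neg_mul_yz (k : ℤ) : xz * tp k = xy * tp (k - 1) := by
  rw [xz_eq, mul_comm (tp (-1)), mul_assoc, ← tp_add]; congr 2; ring

/-- The transition matrix of the line bundle that corresponds to the block of index `2b`. -/
def evenBlock (b : ℤ) : Matrix (Fin 1) (Fin 1) R12 := !![tp (-b)]

/-- A transition matrix of the indecomposable bundle of rank two that corresponds to the block of
index `2b + 1`. -/
def oddBlock (b : ℤ) : Matrix (Fin 2) (Fin 2) R12 := !![tp (-b - 1), xy * tp (-b - 1); 0, tp (-b)]

theorem neg_one_zpow_sq (b : ℤ) : ((-1 : ℝ) ^ b) * (-1 : ℝ) ^ b = 1 := by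
  rw [← zpow_add₀ (by norm_num)]
  exact Even.neg_one_zpow ⟨b, rfl⟩

theorem blockSize_even (b : ℤ) : blockSize (2 * b) = 1 := by simp [blockSize]

theorem blockSize_odd (b : ℤ) : blockSize (2 * b + 1) = 2 := by
  simp [blockSize]

theorem Eqv.smul_right {κ : Type} [Fintype κ] [DecidableEq κ] (M : Matrix κ κ R12) (d : κ → ℝ)
    (hd : ∀ i, d i ≠ 0) :
    Eqv M (M * Matrix.diagonal fun i => algebraMap ℝ R12 (d i)) := by
  refine ⟨1, 1, Matrix.diagonal fun i => algebraMap ℝ R12 (d i),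
    Matrix.diagonal fun i => algebraMap ℝ R12 (d i)⁻¹, ⟨Ent.one, Ent.one, by simp, by simp⟩,
    ⟨?_, ?_, ?_, ?_⟩, by simp⟩
  · intro i j
    rw [Matrix.diagonal_apply]; split_ifs
    exacts [algebraMap_mem_S1 _, S1.zero_mem]
  · intro i j
    rw [Matrix.diagonal_apply]; split_ifs
    exacts [algebraMap_mem_S1 _, S1.zero_mem]
  · rw [Matrix.diagonal_mul_diagonal, ← Matrix.diagonal_one]
    congr 1; ext i; rw [← map_mul, mul_inv_cancel₀ (hd i), map_one]
  · rw [Matrix.diagonal_mul_diagonal, ← Matrix.diagonal_one]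
    congr 1; ext i; rw [← map_mul, inv_mul_cancel₀ (hd i), map_one]

theorem Eqv.smul_left {κ : Type} [Fintype κ] [DecidableEq κ] (M : Matrix κ κ R12) (d : κ → ℝ)
    (hd : ∀ i, d i ≠ 0) :
    Eqv M ((Matrix.diagonal fun i => algebraMap ℝ R12 (d i)) * M) := by
  refine ⟨Matrix.diagonal fun i => algebraMap ℝ R12 (d i),
    Matrix.diagonal fun i => algebraMap ℝ R12 (d i)⁻¹, 1, 1, 
    ⟨?_, ?_, ?_, ?_⟩, ⟨Ent.one, Ent.one, by simp, by simp⟩, by simp⟩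
  · intro i j
    rw [Matrix.diagonal_apply]; split_ifs
    exacts [algebraMap_mem_S2 _, S2.zero_mem]
  · intro i j
    rw [Matrix.diagonal_apply]; split_ifs
    exacts [algebraMap_mem_S2 _, S2.zero_mem]
  · rw [Matrix.diagonal_mul_diagonal, ← Matrix.diagonal_one]
    congr 1; ext i; rw [← map_mul, mul_inv_cancel₀ (hd i), map_one]
  · rw [Matrix.diagonal_mul_diagonal, ← Matrix.diagonal_one]
    congr 1; ext i; rw [← map_mul, inv_mul_cancel₀ (hd i), map_one]

theorem block_even_apply (b : ℤ) (r c) : block (2 * b) r c = (-1 : ℝ) ^ b • tp (-b) := by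
  have h : Even (2 * b) := even_two_mul b
  rw [block, if_pos h, negYZ_zpow]
  simp

theorem eqv_block_even (b : ℤ) : Eqv (block (2 * b)) (evenBlock b) := by
  refine Eqv.trans (Eqv.of_submatrix (block (2 * b)) (finCongr (blockSize_even b).symm)) ?_
  refine Eqv.trans (Eqv.smul_right _ (fun _ => (-1 : ℝ) ^ b) fun _ => zpow_ne_zero _ (by norm_num)) ?_
  refine Eqv.of_eq ?_
  ext i j
  fin_cases i; fin_cases j
  simp [evenBlock, Matrix.mul_apply, block_even_apply, Algebra.algebraMap_eq_smul_one, smul_smul,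
    neg_one_zpow_sq]

theorem block_odd_apply (b : ℤ) (r c) : block (2 * b + 1) r c =
    match r.val, c.val with
    | 0, 0 => (-1 : ℝ) ^ (b + 1) • tp (-b - 1)
    | 0, 1 => (-1 : ℝ) ^ b • (xy * tp (-b - 1))
    | 1, 1 => (-1 : ℝ) ^ b • tp (-b)
    | _, _ => 0 := by
  have h : ¬ Even (2 * b + 1) := by simp
  have h1 : (2 * b + 1 + 1) / 2 = b + 1 := by omega
  have h2 : (2 * b + 1 - 1) / 2 = b := by omega
  have h3 : -(b + 1) = -b - 1 := by ring
  rw [block, if_neg h, h1, h2, negYZ_zpow, negYZ_zpow, h3, mul_smul_comm, tp_neg_mul_yz]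

theorem eqv_block_odd (b : ℤ) : Eqv (block (2 * b + 1)) (oddBlock b) := by
  refine Eqv.trans (Eqv.of_submatrix (block (2 * b + 1)) (finCongr (blockSize_odd b).symm)) ?_
  refine Eqv.trans (Eqv.smul_right _ ![(-1 : ℝ) ^ (b + 1), (-1 : ℝ) ^ b]
    (by intro i; fin_cases i <;> exact zpow_ne_zero _ (by norm_num))) ?_
  refine Eqv.of_eq ?_
  ext i j
  fin_cases i <;> fin_cases j <;>
  simp [oddBlock, Matrix.mul_apply, block_odd_apply, Algebra.algebraMap_eq_smul_one, smul_smul,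
    neg_one_zpow_sq]

theorem eqv_blockSum_cons (i : ℤ) (l : List ℤ) :
    Eqv (blockSum (i :: l)) (Matrix.fromBlocks (block i) 0 0 (blockSum l)) :=
  (Eqv.of_submatrix (Matrix.fromBlocks (block i) 0 0 (blockSum l)) finSumFinEquiv.symm).symm

theorem eqv_of_perm {l l' : List ℤ} (h : l.Perm l') : Eqv (blockSum l) (blockSum l') := by
  induction h with
  | nil => exact Eqv.refl _
  | cons i _ ih =>
    exact ((eqv_blockSum_cons _ _).trans ((Eqv.refl _).diag ih)).trans (eqv_blockSum_cons _ _).symm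
  | swap i j l =>
    refine ((eqv_blockSum_cons _ _).trans ((Eqv.refl _).diag (eqv_blockSum_cons _ _))).trans ?_
    refine Eqv.trans ?_ ((eqv_blockSum_cons _ _).trans
      ((Eqv.refl _).diag (eqv_blockSum_cons _ _))).symm
    let e : Fin (blockSize i) ⊕ (Fin (blockSize j) ⊕ Fin (totalSize l)) ≃
        Fin (blockSize j) ⊕ (Fin (blockSize i) ⊕ Fin (totalSize l)) :=
      ((Equiv.sumAssoc _ _ _).symm.trans ((Equiv.sumComm _ _).sumCongr (Equiv.refl _))).trans
        (Equiv.sumAssoc _ _ _)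
    convert Eqv.of_submatrix _ e using 1
    ext a b
    rcases a with a | a | a <;> rcases b with b | b | b <;> rfl
  | trans _ _ ih1 ih2 => exact ih1.trans ih2

/-! ### Extensions and sections of bundles -/

/-- The part of `f` with negative powers of `T`. -/
def negPart (f : R12) : R12 :=
  lau (AddMonoidAlgebra.ofCoeff ((coord f 0).coeff.filter (· < 0))) +
    lau (AddMonoidAlgebra.ofCoeff ((coord f 1).coeff.filter (· < 0))) * xy

theorem cf_negPart (f : R12) (e : Fin 2) (k : ℤ) :
    cf (negPart f) e k = if k < 0 then cf f e k else 0 := by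
  fin_cases e
  · exact (cf_lau_zero _ _ _).trans (Finsupp.filter_apply _ _ _)
  · exact (cf_lau_one _ _ _).trans (Finsupp.filter_apply _ _ _)

theorem negPart_mem_S1 (f : R12) : negPart f ∈ S1 := by
  rw [mem_S1]
  exact ⟨fun k hk => by rw [cf_negPart, if_neg (by omega)],
    fun k hk => by rw [cf_negPart, if_neg (by omega)]⟩

theorem sub_negPart_mem_S2 (f : R12) : f - negPart f ∈ S2 := by
  rw [mem_S2]
  intro e k hk
  rw [cf_sub, cf_negPart, if_pos hk, sub_self]

/-- The vanishing of the first cohomology of the line bundles of nonnegative degree. -/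
theorem exists_split (f : R12) {k : ℤ} (hk : 0 ≤ k) :
    ∃ z ∈ S2, ∃ y ∈ S1, f = z + tp k * y := by
  refine ⟨_, sub_negPart_mem_S2 f, tp (-k) * negPart f,
    S1.mul_mem (tp_mem_S1 (by omega)) (negPart_mem_S1 f), ?_⟩
  rw [← mul_assoc, tp_mul_neg, one_mul]; ring

/-- For the line bundle of degree `-2`, the coefficient of `x T⁻¹` is the only obstruction. -/
theorem exists_split_neg_one (f : R12) (hf : cf f 1 (-1) = 0) :
    ∃ z ∈ S2, ∃ y ∈ S1, f = z + tp (-1) * y := by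
  refine ⟨_, sub_negPart_mem_S2 f, tp 1 * negPart f, ?_, ?_⟩
  · rw [mem_S1]
    refine ⟨fun k hk => ?_, fun k hk => ?_⟩
    · rw [cf_tp_mul, cf_negPart, if_neg (by omega)]
    · rw [cf_tp_mul, cf_negPart]
      split_ifs
      · have : k - 1 = -1 := by omega
        rw [this, hf]
      · rfl
  · rw [← mul_assoc, tp_neg_mul, one_mul]; ring

section
variable {κ μ : Type} [Fintype κ] [Fintype μ]

/-- The extensions of the bundle `M` by the line bundle with transition function `T ^ (-a)`
split. -/
def Splits (a : ℤ) (M : Matrix κ κ R12) : Prop :=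
  ∀ B : Matrix (Fin 1) κ R12, ∃ X Y : Matrix (Fin 1) κ R12, Ent S2 X ∧ Ent S1 Y ∧
    B = X * M + evenBlock a * Y

theorem Splits.of_eqv [DecidableEq κ] [DecidableEq μ] {a : ℤ} {M : Matrix κ κ R12}
    {D : Matrix μ μ R12} (h : Eqv M D) (hM : Splits a M) : Splits a D := by
  obtain ⟨L, L', R, R', ⟨h1, h2, h3, h4⟩, ⟨h5, h6, h7, h8⟩, rfl⟩ := h
  intro B
  obtain ⟨X, Y, hX, hY, hB⟩ := hM (B * R')
  refine ⟨X * L', Y * R, hX.mul h2, hY.mul h5, ?_⟩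
  calc B = B * R' * R := by rw [Matrix.mul_assoc, h8, Matrix.mul_one]
    _ = X * (L' * L) * M * R + evenBlock a * Y * R := by
      rw [hB, h4, Matrix.mul_one, Matrix.add_mul]
    _ = _ := by simp only [Matrix.mul_assoc]

theorem Splits.diag {a : ℤ} {M : Matrix κ κ R12} {D : Matrix μ μ R12} (hM : Splits a M)
    (hD : Splits a D) : Splits a (Matrix.fromBlocks M 0 0 D) := by
  intro B
  obtain ⟨X, Y, hX, hY, h1⟩ := hM (B.submatrix id Sum.inl)
  obtain ⟨X', Y', hX', hY', h2⟩ := hD (B.submatrix id Sum.inr)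
  refine ⟨Matrix.fromCols X X', Matrix.fromCols Y Y', ?_, ?_, ?_⟩
  · rintro i (j | j); exacts [hX i j, hX' i j]
  · rintro i (j | j); exacts [hY i j, hY' i j]
  · have hB : B = Matrix.fromCols (B.submatrix id Sum.inl) (B.submatrix id Sum.inr) := by
      ext i (j | j) <;> rfl
    rw [hB, h1, h2, Matrix.fromCols_mul_fromBlocks, Matrix.mul_fromCols]
    ext i (j | j) <;> simp

/-- The first cohomology of the line bundle of degree `2(b - a) ≥ 0` vanishes. -/
theorem splits_evenBlock {a b : ℤ} (h : a ≤ b) : Splits a (evenBlock b) := by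
  intro B
  obtain ⟨z, hz, y, hy, hB⟩ := exists_split (tp b * B 0 0) (k := b - a) (by omega)
  refine ⟨!![z], !![y], ?_, ?_, ?_⟩
  · intro i j; fin_cases i; fin_cases j; exact hz
  · intro i j; fin_cases i; fin_cases j; exact hy
  · ext i j
    fin_cases i; fin_cases j
    have : B 0 0 = tp (-b) * (tp b * B 0 0) := by rw [← mul_assoc, tp_neg_mul, one_mul]
    simp only [evenBlock, Fin.zero_eta, Matrix.add_apply, Matrix.mul_apply, Finset.univ_unique,
      Fin.default_eq_zero, Finset.sum_singleton, Matrix.of_apply,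
      Matrix.cons_val_fin_one]
    rw [this, hB, mul_add, ← mul_assoc, ← tp_add, mul_comm z]
    congr 3; ring

/-- The borderline case is `a = b + 1`: there the obstruction in the second column is removed by a
change of the first column by a constant. -/
theorem splits_oddBlock {a b : ℤ} (h : a ≤ b + 1) : Splits a (oddBlock b) := by
  intro B
  obtain ⟨z, hz, y, hy, h0⟩ := exists_split (tp (b + 1) * B 0 0) (k := b + 1 - a) (by omega)
  have key : ∃ z ∈ S2, ∃ y ∈ S1, ∃ z' ∈ S2, ∃ y' ∈ S1,
      tp (b + 1) * B 0 0 = z + tp (b + 1 - a) * y ∧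
      tp b * B 0 1 - tp (-1) * xy * z = z' + tp (b - a) * y' := by
    rcases le_or_gt a b with hab | hab
    · obtain ⟨z', hz', y', hy', h1⟩ := exists_split (tp b * B 0 1 - tp (-1) * xy * z)
        (k := b - a) (by omega)
      exact ⟨z, hz, y, hy, z', hz', y', hy', h0, h1⟩
    · have hab' : b - a = -1 := by omega
      have hab2 : b + 1 - a = 0 := by omega
      rw [hab2, tp_zero, one_mul] at h0
      rw [hab', hab2, tp_zero]
      simp only [one_mul]
      set c := cf (tp b * B 0 1 - tp (-1) * xy * z) 1 (-1) with hc
      obtain ⟨z', hz', y', hy', h1⟩ := exists_split_neg_one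
        (tp b * B 0 1 - tp (-1) * xy * (z + algebraMap ℝ R12 c)) (by
          have : tp b * B 0 1 - tp (-1) * xy * (z + algebraMap ℝ R12 c) =
              (tp b * B 0 1 - tp (-1) * xy * z) - c • (tp (-1) * xy) := by
            rw [Algebra.smul_def]; ring
          rw [this, cf_sub, cf_smul, cf_tp_xy, ← hc]; simp)
      exact ⟨_, S2.add_mem hz (algebraMap_mem_S2 c), _, S1.sub_mem hy (algebraMap_mem_S1 c),
        z', hz', y', hy', by rw [h0]; ring, h1⟩
  obtain ⟨z, hz, y, hy, z', hz', y', hy', h0, h1⟩ := key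
  refine ⟨!![z, z'], !![y, y'], ?_, ?_, ?_⟩
  · intro i j; fin_cases i; fin_cases j; exacts [hz, hz']
  · intro i j; fin_cases i; fin_cases j; exacts [hy, hy']
  · have e0 : B 0 0 = tp (-b - 1) * (tp (b + 1) * B 0 0) := by
      rw [← mul_assoc, ← tp_add]; ring_nf; rw [tp_zero, one_mul]
    have e1 : B 0 1 = tp (-b) * (tp b * B 0 1) := by rw [← mul_assoc, tp_neg_mul, one_mul]
    have e2 : tp (-b - 1) = tp (-b) * tp (-1) := by rw [← tp_add]; congr 1
    have e3 : tp (-a) = tp (-b - 1) * tp (b + 1 - a) := by rw [← tp_add]; congr 1; ring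
    have e4 : tp (-a) = tp (-b) * tp (b - a) := by rw [← tp_add]; congr 1; ring
    ext i j
    fin_cases i; fin_cases j
    · simp [evenBlock, oddBlock]
      rw [e0, h0, e3]; ring
    · simp [evenBlock, oddBlock]
      rw [e1, e4, e2]
      linear_combination tp (-b) * h1

theorem even_or_odd_form (i : ℤ) : ∃ b, i = 2 * b ∨ i = 2 * b + 1 := Int.even_or_odd' i

theorem splits_blockSum {a : ℤ} (l : List ℤ) (h : ∀ i ∈ l, 2 * a - 1 ≤ i) :
    Splits a (blockSum l) := by
  induction l with
  | nil => exact fun B => ⟨0, 0, Ent.zero, Ent.zero, by ext i j; exact j.elim0⟩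
  | cons i l ih =>
    refine Splits.of_eqv (eqv_blockSum_cons i l).symm (Splits.diag ?_ (ih fun j hj =>
      h j (List.mem_cons_of_mem _ hj)))
    have hi := h i List.mem_cons_self
    obtain ⟨b, rfl | rfl⟩ := even_or_odd_form i
    · exact (splits_evenBlock (by omega)).of_eqv (eqv_block_even b).symm
    · exact (splits_oddBlock (by omega)).of_eqv (eqv_block_odd b).symm

/-- The bundle `T ^ k M` has two independent global sections. -/
def TwoSections (k : ℤ) (M : Matrix κ κ R12) : Prop :=
  ∃ w : Fin 2 → κ → R12, (∀ e i, w e i ∈ S1) ∧ (∀ e i, tp k * M.mulVec (w e) i ∈ S2) ∧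
    ∀ c d : ℝ, c • w 0 + d • w 1 = 0 → c = 0 ∧ d = 0

theorem TwoSections.of_eqv [DecidableEq κ] [DecidableEq μ] {k : ℤ} {M : Matrix κ κ R12}
    {D : Matrix μ μ R12} (h : Eqv M D) (hM : TwoSections k M) : TwoSections k D := by
  obtain ⟨L, L', R, R', ⟨h1, h2, h3, h4⟩, ⟨h5, h6, h7, h8⟩, rfl⟩ := h
  obtain ⟨w, hw1, hw2, hw⟩ := hM
  refine ⟨fun e => R'.mulVec (w e), fun e => h6.mulVec (hw1 e), ?_, ?_⟩
  · intro e i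
    have : (L * M * R).mulVec (R'.mulVec (w e)) = L.mulVec (M.mulVec (w e)) := by
      rw [Matrix.mulVec_mulVec, Matrix.mul_assoc, h7, Matrix.mul_one, Matrix.mulVec_mulVec]
    rw [this]
    have h9 := h1.mulVec (hw2 e) i
    have : (L.mulVec fun i => tp k * M.mulVec (w e) i) = tp k • L.mulVec (M.mulVec (w e)) := by
      rw [← Matrix.mulVec_smul]; rfl
    rw [this] at h9
    exact h9
  · intro c d h
    apply hw
    have := congrArg R.mulVec h
    rw [Matrix.mulVec_add, Matrix.mulVec_smul, Matrix.mulVec_smul, Matrix.mulVec_mulVec, Matrix.mulVec_mulVec, h7,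
      Matrix.one_mulVec, Matrix.one_mulVec, Matrix.mulVec_zero] at this
    exact this

theorem TwoSections.inl {k : ℤ} {M : Matrix κ κ R12} {D : Matrix μ μ R12}
    (hM : TwoSections k M) : TwoSections k (Matrix.fromBlocks M 0 0 D) := by
  obtain ⟨w, hw1, hw2, hw⟩ := hM
  refine ⟨fun e => Sum.elim (w e) 0, ?_, ?_, ?_⟩
  · rintro e (i | i)
    exacts [hw1 e i, S1.zero_mem]
  · rintro e (i | i)
    · rw [Matrix.fromBlocks_mulVec]
      simpa using hw2 e i
    · rw [Matrix.fromBlocks_mulVec]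
      simp
  · intro c d h
    apply hw
    ext i
    exact congrFun h (Sum.inl i)

theorem twoSections_evenBlock {k b : ℤ} (h : b < k) : TwoSections k (evenBlock b) := by
  refine ⟨fun e _ => if e = 0 then 1 else tp (-1), ?_, ?_, ?_⟩
  · intro e i
    simp only
    split_ifs
    exacts [S1.one_mem, tp_mem_S1 (by norm_num)]
  · intro e i
    fin_cases i
    have : (evenBlock b).mulVec (fun _ => if e = 0 then 1 else tp (-1)) 0 =
        tp (-b) * if e = 0 then 1 else tp (-1) := by
      simp [evenBlock, Matrix.mulVec, dotProduct]
    simp only [Fin.zero_eta, this]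
    split_ifs
    · rw [mul_one, ← tp_add]; exact tp_mem_S2 (by omega)
    · rw [← tp_add, ← tp_add]; exact tp_mem_S2 (by omega)
  · intro c d h
    have h0 : c • (1 : R12) + d • tp (-1) = 0 := by simpa using congrFun h 0
    have h1 := congrArg (fun f => cf f 0 0) h0
    have h2 := congrArg (fun f => cf f 0 (-1)) h0
    simp [cf_add, cf_smul, cf_tp, cf_one_zero, cf_zero] at h1 h2
    exact ⟨h1, h2⟩

theorem twoSections_oddBlock {k b : ℤ} (h : b < k) : TwoSections k (oddBlock b) := by
  refine ⟨fun e => Pi.single e 1, ?_, ?_, ?_⟩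
  · intro e i
    simp only [Pi.single_apply]
    split_ifs
    exacts [S1.one_mem, S1.zero_mem]
  · intro e i
    have h1 : tp k * tp (-b - 1) ∈ S2 := by rw [← tp_add]; exact tp_mem_S2 (by omega)
    have h2 : tp k * tp (-b) ∈ S2 := by rw [← tp_add]; exact tp_mem_S2 (by omega)
    have h3 : tp k * (xy * tp (-b - 1)) ∈ S2 := by
      rw [mul_left_comm]; exact S2.mul_mem xy_mem_S2 h1
    rw [Matrix.mulVec_single_one]
    fin_cases e <;> fin_cases i <;> simp [oddBlock, h1, h2, h3, S2.zero_mem]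
  · intro c d h
    have h0 := congrFun h 0
    have h1 := congrFun h 1
    simp at h0 h1
    exact ⟨h0, h1⟩

/-- There is no nonzero global section of `T ^ k M`. -/
def NoSection (k : ℤ) (M : Matrix κ κ R12) : Prop :=
  ∀ w : κ → R12, (∀ i, w i ∈ S1) → (∀ i, tp k * M.mulVec w i ∈ S2) → w = 0

theorem NoSection.of_eqv [DecidableEq κ] [DecidableEq μ] {k : ℤ} {M : Matrix κ κ R12}
    {D : Matrix μ μ R12} (h : Eqv M D) (hM : NoSection k M) : NoSection k D := by
  obtain ⟨L, L', R, R', ⟨h1, h2, h3, h4⟩, ⟨h5, h6, h7, h8⟩, rfl⟩ := h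
  intro w hw1 hw2
  have h9 : R.mulVec w = 0 := by
    apply hM _ (h5.mulVec hw1)
    intro i
    have h10 := h2.mulVec hw2 i
    have : (L'.mulVec fun i => tp k * (L * M * R).mulVec w i) = tp k • M.mulVec (R.mulVec w) := by
      rw [show (fun i => tp k * (L * M * R).mulVec w i) = tp k • (L * M * R).mulVec w from rfl,
        Matrix.mulVec_smul, Matrix.mulVec_mulVec, Matrix.mulVec_mulVec, Matrix.mul_assoc L,
        ← Matrix.mul_assoc L', h4, Matrix.one_mul]
    rw [this] at h10
    exact h10
  calc w = R'.mulVec (R.mulVec w) := by rw [Matrix.mulVec_mulVec, h8, Matrix.one_mulVec]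
    _ = 0 := by rw [h9, Matrix.mulVec_zero]

/-- After the twist by `T ^ (a - 1)`, the line subbundle has the transition function `T⁻¹` and hence
a first cohomology group of dimension one. So a nontrivial combination of two independent sections
of the quotient `D` lifts to a section of the extension. -/
theorem not_twoSections {a : ℤ} {B : Matrix (Fin 1) κ R12} {D : Matrix κ κ R12}
    (h : NoSection (a - 1) (Matrix.fromBlocks (evenBlock a) B 0 D)) : ¬ TwoSections (a - 1) D := by
  rintro ⟨w, hw1, hw2, hw⟩
  set f : Fin 2 → R12 := fun e => tp (a - 1) * B.mulVec (w e) 0 with hf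
  -- a combination whose obstruction, the coefficient of `x T⁻¹`, vanishes
  obtain ⟨c, d, hcd, h0⟩ : ∃ c d : ℝ, ¬ (c = 0 ∧ d = 0) ∧
      c * cf (f 0) 1 (-1) + d * cf (f 1) 1 (-1) = 0 := by
    by_cases h0 : cf (f 0) 1 (-1) = 0
    · exact ⟨1, 0, by simp, by simp [h0]⟩
    · exact ⟨cf (f 1) 1 (-1), -cf (f 0) 1 (-1), by simp [h0], by ring⟩
  obtain ⟨z, hz, y, hy, hzy⟩ := exists_split_neg_one (c • f 0 + d • f 1)
    (by rw [cf_add, cf_smul, cf_smul, h0])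
  have key := h (Sum.elim (fun _ => -y) (c • w 0 + d • w 1)) ?_ ?_
  · apply hcd
    apply hw
    ext i
    exact congrFun key (Sum.inr i)
  · rintro (i | i)
    · exact S1.neg_mem hy
    · exact S1.add_mem (smul_mem_S1 c (hw1 0 i)) (smul_mem_S1 d (hw1 1 i))
  · rintro (i | i)
    · rw [Matrix.fromBlocks_mulVec]
      fin_cases i
      have e1 : (evenBlock a).mulVec (fun _ : Fin 1 => -y) 0 = tp (-a) * -y := by
        simp [evenBlock, Matrix.mulVec, dotProduct]
      have e2 : tp (a - 1) * tp (-a) = tp (-1) := by rw [← tp_add]; congr 1; ring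
      have e3 : B.mulVec (c • w 0 + d • w 1) 0 = c • B.mulVec (w 0) 0 + d • B.mulVec (w 1) 0 := by
        rw [Matrix.mulVec_add, Matrix.mulVec_smul, Matrix.mulVec_smul]; rfl
      change tp (a - 1) * ((evenBlock a).mulVec (fun _ : Fin 1 => -y) 0 +
        B.mulVec (c • w 0 + d • w 1) 0) ∈ S2
      rw [e1, e3, mul_add, ← mul_assoc, e2, mul_add, mul_smul_comm, mul_smul_comm]
      have : tp (-1) * -y + (c • f 0 + d • f 1) = z := by rw [hzy]; ring
      exact this ▸ hz
    · rw [Matrix.fromBlocks_mulVec]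
      change tp (a - 1) * ((0 : Matrix κ (Fin 1) R12).mulVec (fun _ => -y) i +
        D.mulVec (c • w 0 + d • w 1) i) ∈ S2
      rw [Matrix.zero_mulVec, Matrix.mulVec_add, Matrix.mulVec_smul, Matrix.mulVec_smul, Pi.zero_apply,
        zero_add]
      change tp (a - 1) * (c • D.mulVec (w 0) i + d • D.mulVec (w 1) i) ∈ S2
      rw [mul_add, mul_smul_comm, mul_smul_comm]
      exact S2.add_mem (smul_mem_S2 c (hw2 0 i)) (smul_mem_S2 d (hw2 1 i))

end

/-! ### Decomposition of bundles -/

theorem exists_InT_S2 (f : R12) : ∃ p : ℤ, InT S2 p f := by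
  rcases eq_or_ne f 0 with rfl | hf
  · exact ⟨0, by rw [InT, mul_zero]; exact S2.zero_mem⟩
  · obtain ⟨p, g, rfl, hg, -⟩ := exists_ord hf
    exact ⟨p, by rwa [InT, ← mul_assoc, tp_neg_mul, one_mul]⟩

theorem InT_zero {S : Subring R12} {f : R12} : InT S 0 f ↔ f ∈ S := by
  rw [InT, neg_zero, tp_zero, one_mul]

theorem InT.mulVec {S : Subring R12} {κ μ : Type} [Fintype μ] {k l : ℤ} {M : Matrix κ μ R12}
    {v : μ → R12} (hM : ∀ i j, InT S k (M i j)) (hv : ∀ j, InT S l (v j)) (i : κ) :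
    InT S (k + l) (M.mulVec v i) := by
  change InT S (k + l) (∑ j, M i j * v j)
  exact InT.sum _ fun j _ => (hM i j).mul (hv j)

theorem swap_InT {k : ℤ} {f : R12} : InT S1 k (swap f) ↔ InT S2 (-k) f := by
  rw [InT, InT, ← swap_mem_S1, map_mul, swap_tp, neg_neg]

theorem exists_InT_S1 (f : R12) : ∃ p : ℤ, InT S1 p f := by
  obtain ⟨p, hp⟩ := exists_InT_S2 (swap f)
  refine ⟨-p, ?_⟩
  rw [← swap_swap f, swap_InT, neg_neg]
  exact hp

theorem exists_InT_matrix {n : ℕ} (M : Matrix (Fin n) (Fin n) R12) :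
    ∃ W : ℤ, ∀ i j, InT S2 (-W) (M i j) ∧ InT S1 W (M i j) := by
  have h : ∀ p : Fin n × Fin n, ∃ W : ℤ, InT S2 (-W) (M p.1 p.2) ∧ InT S1 W (M p.1 p.2) := by
    intro p
    obtain ⟨a, ha⟩ := exists_InT_S2 (M p.1 p.2)
    obtain ⟨b, hb⟩ := exists_InT_S1 (M p.1 p.2)
    exact ⟨max (-a) b, ha.mono2 (by omega), hb.mono1 (by omega)⟩
  choose W hW using h
  obtain ⟨V, hV⟩ := (Set.finite_range W).bddAbove
  refine ⟨V, fun i j => ?_⟩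
  have h1 : W (i, j) ≤ V := hV ⟨_, rfl⟩
  exact ⟨(hW (i, j)).1.mono2 (by omega), (hW (i, j)).2.mono1 h1⟩

/-- Among the twists of `M` there is a first one with a nonzero global section. -/
theorem exists_min_section {n : ℕ} (M : Matrix (Fin (n + 1)) (Fin (n + 1)) R12)
    (hM : IsUnit M.det) : ∃ (a : ℤ) (v : Fin (n + 1) → R12), v ≠ 0 ∧ (∀ i, v i ∈ S1) ∧
      (∀ i, tp a * M.mulVec v i ∈ S2) ∧ NoSection (a - 1) M := by
  obtain ⟨W, hW⟩ := exists_InT_matrix M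
  set P : ℤ → Prop := fun a => ∃ v : Fin (n + 1) → R12, v ≠ 0 ∧ (∀ i, v i ∈ S1) ∧
    ∀ i, tp a * M.mulVec v i ∈ S2 with hP
  -- in a twist of very negative degree, the exponents of a section would contradict each other
  have hbdd : ∃ b : ℤ, ∀ z, P z → b ≤ z := by
    refine ⟨-W, ?_⟩
    rintro a ⟨v, hv0, hv1, hv2⟩
    have hne : M.mulVec v ≠ 0 := by
      intro h
      apply hv0
      exact Matrix.eq_zero_of_mulVec_eq_zero hM.ne_zero h
    obtain ⟨i, hi⟩ := Function.ne_iff.1 hne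
    have h2 := hv2 i
    have h1 : InT S1 W (M.mulVec v i) := by
      have := InT.mulVec (fun i j => (hW i j).2) (fun j => InT_zero.2 (hv1 j)) i
      rwa [add_zero] at this
    have := le_of_mem (a := -a) hi (by rwa [neg_neg]) h1
    omega
  have hne : ∃ z, P z := by
    refine ⟨W, Pi.single 0 1, ?_, ?_, ?_⟩
    · intro h
      have := congrFun h 0
      simp at this
    · intro i
      rw [Pi.single_apply]; split_ifs
      exacts [S1.one_mem, S1.zero_mem]
    · intro i
      rw [Matrix.mulVec_single_one]
      have := (hW i 0).1
      rwa [InT, neg_neg] at this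
  obtain ⟨a, ⟨v, hv0, hv1, hv2⟩, hmin⟩ := Int.exists_least_of_bdd hbdd hne
  refine ⟨a, v, hv0, hv1, hv2, fun w hw1 hw2 => ?_⟩
  by_contra h
  have := hmin _ ⟨w, h, hw1, hw2⟩
  omega

theorem res2_linForm (α β γ : ℝ) :
    res2 (linForm α β γ) = algebraMap ℝ R12 α + algebraMap ℝ R12 β * tp 1
      + algebraMap ℝ R12 γ * xy := by
  rw [linForm, map_add, map_mul, res2_of, res2_of, res2_root, map_add, map_mul,
    Polynomial.toLaurent_C, Polynomial.toLaurent_C, Polynomial.toLaurent_C, Polynomial.toLaurent_X,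
    map_add, map_mul, lau_T, lau_C, lau_C, lau_C]

theorem res1_linForm (α β γ : ℝ) : tp 1 * res1 (linForm α β γ) =
    algebraMap ℝ R12 α * tp 1 + algebraMap ℝ R12 β + algebraMap ℝ R12 γ * xy := by
  rw [← swap_res2, res2_linForm, map_add, map_add, map_mul, map_mul, swap_algebraMap,
    swap_algebraMap, swap_algebraMap, swap_tp, swap_xy, xz_eq]
  linear_combination (algebraMap ℝ R12 β + algebraMap ℝ R12 γ * xy) * tp_mul_neg 1

/-- The linear form `α z + β y + γ x`, divided by `y` instead of `z`, does not vanish at the point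
`z = 0` if it is not proportional to `z`. -/
theorem linForm_dual {α β γ : ℝ} (h : β ≠ 0 ∨ γ ≠ 0) :
    tp 1 * res1 (linForm α β γ) ∈ S2 ∧ ev (tp 1 * res1 (linForm α β γ)) ≠ 0 := by
  rw [res1_linForm]
  constructor
  · exact S2.add_mem (S2.add_mem (S2.mul_mem (algebraMap_mem_S2 _) (tp_mem_S2 (by norm_num)))
      (algebraMap_mem_S2 _)) (S2.mul_mem (algebraMap_mem_S2 _) xy_mem_S2)
  · intro h0
    rw [ev_eq_zero, Fin.forall_fin_two] at h0
    have e1 : ∀ e, cf xy e 0 = if e = 1 then 1 else 0 := fun e => by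
      have := cf_tp_xy 0 e 0
      rw [tp_zero, one_mul] at this
      simpa using this
    simp [Algebra.algebraMap_eq_smul_one, cf_add, cf_smul, cf_tp, cf_one_zero, cf_one_one, e1]
      at h0
    rcases h with h | h
    exacts [h h0.1, h h0.2]

/-- The first nonzero section of a twist of `M` spans a line subbundle: otherwise it could be
divided by a linear form, which would give a section of the preceding twist. -/
theorem exists_line_subbundle {n : ℕ} (M : Matrix (Fin (n + 1)) (Fin (n + 1)) R12)
    (hM : IsUnit M.det) : ∃ (a : ℤ) (B : Matrix (Fin 1) (Fin n) R12)
      (M' : Matrix (Fin n) (Fin n) R12), NoSection (a - 1) M ∧ IsUnit M'.det ∧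
        Eqv M (Matrix.fromBlocks (evenBlock a) B 0 M') := by
  obtain ⟨a, v, hv0, hv1, hv2, hno⟩ := exists_min_section M hM
  have hMN : M * M⁻¹ = 1 := Matrix.mul_nonsing_inv _ hM
  have hNM : M⁻¹ * M = 1 := Matrix.nonsing_inv_mul _ hM
  choose g hg using hv1
  choose h hh using hv2
  have hg0 : g ≠ 0 := by
    rintro rfl
    apply hv0
    ext i
    rw [← hg i]; simp
  have hh0 : h ≠ 0 := by
    rintro rfl
    apply hv0
    have : M.mulVec v = 0 := by
      ext i
      have h0 := hh i
      rw [Pi.zero_apply, map_zero] at h0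
      simpa [tp_ne_zero] using h0.symm
    exact Matrix.eq_zero_of_mulVec_eq_zero hM.ne_zero this
  -- if the section `v` vanished at a point of `D₊(z)`, it could be divided by a linear form there; the
  -- quotient is a section of the preceding twist
  have hgu : Ideal.span (Set.range g) = ⊤ := by
    rcases unimodular_or_divisible g hg0 with hu | ⟨α, β, γ, g', hne, hg'⟩
    · exact hu
    exfalso
    obtain ⟨hl, he⟩ := linForm_dual (α := α) hne
    have hz : (fun i => res1 (g' i)) = 0 := by
      apply hno
      · exact fun i => ⟨g' i, rfl⟩
      · intro i
        apply mem_S2_of_mul hl he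
        have : v = res1 (linForm α β γ) • fun i => res1 (g' i) := by
          ext i
          rw [← hg i, hg' i, map_mul]; rfl
        have h1 := hh i
        rw [this, Matrix.mulVec_smul, Pi.smul_apply, smul_eq_mul] at h1
        refine ⟨h i, ?_⟩
        rw [h1, show tp a = tp (a - 1) * tp 1 by rw [← tp_add]; congr 1; ring]
        ring
    apply hv0
    ext i
    have := congrFun hz i
    simp only [Pi.zero_apply] at this
    rw [← hg i, hg' i, map_mul, this, mul_zero]; rfl
  have hvu : v = tp (-a) • (M⁻¹).mulVec fun i => res2 (h i) := by
    have : (fun i => res2 (h i)) = tp a • M.mulVec v := by ext i; rw [hh i]; rfl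
    rw [this, Matrix.mulVec_smul, Matrix.mulVec_mulVec, hNM, Matrix.one_mulVec, smul_smul,
      tp_neg_mul, one_smul]
  -- the same for a point of `D₊(y)`
  have hhu : Ideal.span (Set.range h) = ⊤ := by
    rcases unimodular_or_divisible h hh0 with hu | ⟨α, β, γ, h', hne, hh'⟩
    · exact hu
    exfalso
    obtain ⟨hl, he⟩ := linForm_dual (α := α) hne
    set w : Fin (n + 1) → R12 := tp (-(a - 1)) • (M⁻¹).mulVec fun i => res2 (h' i) with hw
    have hMw : M.mulVec w = tp (-(a - 1)) • fun i => res2 (h' i) := by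
      rw [hw, Matrix.mulVec_smul, Matrix.mulVec_mulVec, hMN, Matrix.one_mulVec]
    have hz : w = 0 := by
      apply hno
      · intro i
        rw [← swap_mem_S2]
        apply mem_S2_of_mul hl he
        have ht : tp 1 = swap (tp (-1)) := by rw [swap_tp, neg_neg]
        rw [← swap_res2, ht, ← map_mul, ← map_mul, swap_mem_S2]
        refine ⟨g i, ?_⟩
        have e1 : (fun i => res2 (h i)) = res2 (linForm α β γ) • fun i => res2 (h' i) := by
          ext i
          rw [hh' i, map_mul]; rfl
        rw [hg i, hvu, e1, Matrix.mulVec_smul, hw]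
        simp only [Pi.smul_apply, smul_eq_mul]
        rw [show tp (-a) = tp (-(a - 1)) * tp (-1) by rw [← tp_add]; congr 1; ring]
        ring
      · intro i
        rw [hMw, Pi.smul_apply, smul_eq_mul, ← mul_assoc, tp_mul_neg, one_mul]
        exact ⟨h' i, rfl⟩
    apply hh0
    ext i
    have := congrFun hMw i
    rw [hz, Matrix.mulVec_zero, Pi.zero_apply, Pi.smul_apply, smul_eq_mul, eq_comm,
      mul_eq_zero, or_iff_right (tp_ne_zero _)] at this
    rw [hh' i, res2_injective (this.trans (map_zero _).symm), mul_zero]; rfl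
  -- in bases which start with the section, the first column of `M` is a multiple of a unit vector
  obtain ⟨A, A', hA1, hA2, hA3⟩ := exists_completion g hgu
  obtain ⟨C, C', hC1, hC2, hC3⟩ := exists_completion h hhu
  set F := C'.map res2 * M * A.map res1 with hF
  have hmap2 : ∀ {P Q : Matrix (Fin (n + 1)) (Fin (n + 1)) R2}, P * Q = 1 →
      P.map res2 * Q.map res2 = 1 := by
    intro P Q hPQ
    rw [← Matrix.map_mul, hPQ, Matrix.map_one _ (map_zero _) (map_one _)]
  have hmap1 : ∀ {P Q : Matrix (Fin (n + 1)) (Fin (n + 1)) R1}, P * Q = 1 →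
      P.map res1 * Q.map res1 = 1 := by
    intro P Q hPQ
    rw [← Matrix.map_mul, hPQ, Matrix.map_one _ (map_zero _) (map_one _)]
  have hMF : Eqv M F := ⟨C'.map res2, C.map res2, A.map res1, A'.map res1,
    ⟨fun i j => ⟨_, rfl⟩, fun i j => ⟨_, rfl⟩, hmap2 hC2, hmap2 hC1⟩,
    ⟨fun i j => ⟨_, rfl⟩, fun i j => ⟨_, rfl⟩, hmap1 hA1, hmap1 hA2⟩, rfl⟩
  have hcol : ∀ i, F i 0 = if i = 0 then tp (-a) else 0 := by
    intro i
    have e1 : (A.map res1).col 0 = v := by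
      ext j
      rw [← hg j, ← hA3 j]; rfl
    have e2 : (C.map res2).col 0 = fun j => res2 (h j) := by
      ext j
      rw [← hC3 j]; rfl
    have e3 : M.mulVec v = tp (-a) • (C.map res2).col 0 := by
      rw [e2]
      ext j
      rw [Pi.smul_apply, hh j, smul_eq_mul, ← mul_assoc, tp_neg_mul, one_mul]
    have e4 : F.col 0 = tp (-a) • (1 : Matrix (Fin (n + 1)) (Fin (n + 1)) R12).col 0 := by
      rw [← hmap2 hC2]
      rw [← Matrix.mulVec_single_one, ← Matrix.mulVec_single_one, hF, Matrix.mul_assoc,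
        ← Matrix.mulVec_mulVec, ← Matrix.mulVec_mulVec, ← Matrix.mulVec_mulVec,
        Matrix.mulVec_single_one, e1, e3, Matrix.mulVec_single_one, Matrix.mulVec_smul]
    have := congrFun e4 i
    simpa [Matrix.col, Matrix.one_apply, eq_comm] using this
  have hFdet : IsUnit F.det := hMF.isUnit_det hM
  set e : Fin 1 ⊕ Fin n ≃ Fin (n + 1) := finSumFinEquiv.trans (finCongr (add_comm 1 n)) with he
  have hel : ∀ i, e (Sum.inl i) = 0 := by
    intro i; fin_cases i; rfl
  have her : ∀ i, e (Sum.inr i) = i.succ := by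
    intro i
    apply Fin.ext
    simp [he]
  refine ⟨a, fun _ j => F 0 j.succ, fun i j => F i.succ j.succ, hno, ?_, ?_⟩
  · rw [Matrix.det_succ_column_zero, Fin.sum_univ_succ] at hFdet
    simp only [hcol] at hFdet
    simp at hFdet
    have h2 : F.submatrix Fin.succ Fin.succ = fun i j => F i.succ j.succ := rfl
    rw [h2] at hFdet
    exact hFdet.2
  · refine hMF.trans ?_
    have h2 : Matrix.fromBlocks (evenBlock a) (fun _ j => F 0 j.succ) 0
        (fun i j => F i.succ j.succ) = F.submatrix e e := by
      ext (i | i) (j | j)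
      · change evenBlock a i j = F (e _) (e _)
        rw [hel, hel, hcol, if_pos rfl, Subsingleton.elim i 0, Subsingleton.elim j 0]
        rfl
      · change F 0 j.succ = F (e _) (e _)
        rw [hel, her]
      · change 0 = F (e _) (e _)
        rw [hel, her, hcol, if_neg (Fin.succ_ne_zero i)]
      · change F i.succ j.succ = F (e _) (e _)
        rw [her, her]
    rw [h2]
    exact Eqv.of_submatrix F e

theorem twoSections_cons {k i : ℤ} (l : List ℤ) (h : i < 2 * k) : TwoSections k (blockSum (i :: l)) := by
  refine TwoSections.of_eqv (eqv_blockSum_cons i l).symm (TwoSections.inl ?_)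
  obtain ⟨b, rfl | rfl⟩ := even_or_odd_form i
  · exact (twoSections_evenBlock (by omega)).of_eqv (eqv_block_even b).symm
  · exact (twoSections_oddBlock (by omega)).of_eqv (eqv_block_odd b).symm

theorem twoSections_cons_cons (b : ℤ) (l : List ℤ) :
    TwoSections b (blockSum (2 * b :: 2 * b :: l)) := by
  refine TwoSections.of_eqv ((eqv_blockSum_cons _ _).trans (Eqv.diag (eqv_block_even b)
    ((eqv_blockSum_cons _ _).trans ((eqv_block_even b).diag (Eqv.refl _))))).symm ?_
  refine ⟨fun e => if e = 0 then Sum.elim (fun _ => 1) 0 else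
    Sum.elim 0 (Sum.elim (fun _ => 1) 0), ?_, ?_, ?_⟩
  · intro e i
    fin_cases e <;> rcases i with i | i | i <;> simp [S1.one_mem, S1.zero_mem]
  · have h1 : ∀ i, (evenBlock b).mulVec (fun _ => 1) i = tp (-b) := by
      intro i
      fin_cases i
      simp [evenBlock, Matrix.mulVec, dotProduct]
    intro e i
    fin_cases e <;> rcases i with i | i | i <;>
      simp [Matrix.fromBlocks_mulVec, h1, tp_mul_neg, S2.one_mem, S2.zero_mem]
  · intro c d h
    have h0 := congrFun h (Sum.inl 0)
    have h1 := congrFun h (Sum.inr (Sum.inl 0))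
    simp at h0 h1
    exact ⟨h0, h1⟩

/-- The extensions of `evenBlock (a - 1)` by `evenBlock a` are classified by the coefficient of
`x T⁻¹`. All those which do not split are equivalent to the indecomposable bundle of rank two. -/
theorem eqv_oddBlock {a : ℤ} (f : R12)
    (h : NoSection (a - 1) (Matrix.fromBlocks (evenBlock a) !![f] 0 (evenBlock (a - 1)))) :
    Eqv (Matrix.fromBlocks (evenBlock a) !![f] 0 (evenBlock (a - 1))) (oddBlock (a - 1)) := by
  set c := cf (tp (a - 1) * f) 1 (-1) with hc
  obtain ⟨z, hz, y, hy, hzy⟩ := exists_split_neg_one (tp (a - 1) * f - c • (tp (-1) * xy)) (by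
    rw [cf_sub, cf_smul, cf_tp_xy, ← hc]; simp)
  have hf : f = c • (tp (-a) * xy) + (z * tp (-(a - 1)) + tp (-a) * y) := by
    have e1 : tp (-a) = tp (-(a - 1)) * tp (-1) := by rw [← tp_add]; congr 1; ring
    have e2 := tp_mul_neg (a - 1)
    rw [Algebra.smul_def] at hzy ⊢
    rw [e1]
    linear_combination tp (-(a - 1)) * hzy - f * e2
  have h1 : Eqv (Matrix.fromBlocks (evenBlock a) !![f] 0 (evenBlock (a - 1)))
      (Matrix.fromBlocks (evenBlock a) !![c • (tp (-a) * xy)] 0 (evenBlock (a - 1))) := by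
    refine Eqv.clear _ _ _ _ !![z] !![y] ?_ ?_ ?_
    · intro i j; fin_cases i; fin_cases j; exact hz
    · intro i j; fin_cases i; fin_cases j; exact hy
    · ext i j
      fin_cases i; fin_cases j
      simpa [evenBlock] using hf
  -- if `c = 0`, the quotient `evenBlock (a - 1)` is a direct summand, and has a section
  have hc0 : c ≠ 0 := by
    intro h0
    rw [h0, zero_smul] at h1
    have h2 := NoSection.of_eqv h1 h (Sum.elim 0 fun _ => 1) ?_ ?_
    · have := congrFun h2 (Sum.inr 0)
      simp at this
    · rintro (i | i) <;> simp [S1.one_mem, S1.zero_mem]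
    · have h3 : (evenBlock (a - 1)).mulVec (fun _ => 1) 0 = tp (-(a - 1)) := by
        simp [evenBlock, Matrix.mulVec, dotProduct]
      have h4 : (!![0] : Matrix (Fin 1) (Fin 1) R12) = 0 := by
        ext i j; fin_cases i; fin_cases j; rfl
      rintro (i | i)
      · simp [Matrix.fromBlocks_mulVec, h4, S2.zero_mem]
      · rw [Matrix.fromBlocks_mulVec, Subsingleton.elim i 0]
        simp only [Sum.elim_inr, Matrix.zero_mulVec, Sum.elim_comp_inr, zero_add, h3, tp_mul_neg,
          S2.one_mem]
  refine h1.trans ((Eqv.smul_right _ (Sum.elim (fun _ => c) fun _ => 1) ?_).trans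
    ((Eqv.smul_left _ (Sum.elim (fun _ => c⁻¹) fun _ => 1) ?_).trans
      ((Eqv.of_submatrix _ finSumFinEquiv.symm).trans (Eqv.of_eq ?_))))
  · rintro (i | i)
    exacts [hc0, one_ne_zero]
  · rintro (i | i)
    exacts [inv_ne_zero hc0, one_ne_zero]
  · have s0 : (finSumFinEquiv (m := 1) (n := 1)).symm 0 = Sum.inl 0 := rfl
    have s1 : (finSumFinEquiv (m := 1) (n := 1)).symm 1 = Sum.inr 0 := rfl
    have e2 : algebraMap ℝ R12 c⁻¹ * algebraMap ℝ R12 c = 1 := by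
      rw [← map_mul, inv_mul_cancel₀ hc0, map_one]
    ext i j
    rw [Matrix.submatrix_apply, Matrix.diagonal_mul, Matrix.mul_diagonal]
    fin_cases i <;> fin_cases j <;> simp [s0, s1, oddBlock, evenBlock, Algebra.smul_def]
    · linear_combination tp (-a) * e2
    · linear_combination tp (-a) * xy * e2

/-- Every bundle is a direct sum of the bundles with the transition matrices `M_i`. By induction the
quotient by a line subbundle `evenBlock a` of maximal degree is such a sum. By maximality, all its
summands have an index at least `2a - 2`, and at most one of them has this index. The extension
splits over the summands of index at least `2a - 1`; a nontrivial extension of the remaining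
one yields the block of index `2a - 1`. -/
theorem exists_blockSum {n : ℕ} (M : Matrix (Fin n) (Fin n) R12) (hM : IsUnit M.det) :
    ∃ l : List ℤ, Eqv M (blockSum l) := by
  induction n with
  | zero => exact ⟨[], Eqv.of_eq (by ext i; exact i.elim0)⟩
  | succ n ih =>
    obtain ⟨a, B, M', hno, hM', h⟩ := exists_line_subbundle M hM
    obtain ⟨l, hl⟩ := ih M' hM'
    -- by the minimality of `a`, the twist of the quotient has no two independent sections
    have key : ∀ l', Eqv M' (blockSum l') → ¬ TwoSections (a - 1) (blockSum l') := by
      intro l' hl'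
      obtain ⟨B', hB'⟩ := Eqv.triangular (evenBlock a) B hl'
      exact not_twoSections (hno.of_eqv (h.trans hB'))
    have hge : ∀ i ∈ l, 2 * (a - 1) ≤ i := by
      intro i hi
      by_contra hlt
      exact key _ (hl.trans (eqv_of_perm (List.perm_cons_erase hi)))
        (twoSections_cons _ (by omega))
    -- the extension restricted to the summands of index at least `2a - 1` splits, so that only a
    -- summand of index `2a - 2` matters
    by_cases hmem : 2 * (a - 1) ∈ l
    · have hp := List.perm_cons_erase hmem
      set l' := l.erase (2 * (a - 1)) with hl'
      have hl2 := hl.trans (eqv_of_perm hp)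
      have hge' : ∀ i ∈ l', 2 * a - 1 ≤ i := by
        intro i hi
        have h1 := hge i (List.mem_of_mem_erase hi)
        have h2 : i ≠ 2 * (a - 1) := by
          rintro rfl
          refine key _ (hl2.trans (eqv_of_perm ((List.perm_cons_erase hi).cons _))) ?_
          exact twoSections_cons_cons _ _
        omega
      obtain ⟨B', hB'⟩ := Eqv.triangular (evenBlock a) B (hl2.trans ((eqv_blockSum_cons _ _).trans
        ((eqv_block_even _).diag (Eqv.refl _))))
      set B1 : Matrix (Fin 1) (Fin 1) R12 := !![B' 0 (Sum.inl 0)] with hB1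
      set B2 : Matrix (Fin 1) (Fin (totalSize l')) R12 := fun i j => B' i (Sum.inr j) with hB2
      have h1 : Eqv M (Matrix.fromBlocks (Matrix.fromBlocks (evenBlock a) B1 0 (evenBlock (a - 1)))
          (Matrix.fromRows B2 0) 0 (blockSum l')) := by
        refine (h.trans hB').trans ?_
        refine (Eqv.of_submatrix _ (Equiv.sumAssoc _ _ _)).trans (Eqv.of_eq ?_)
        ext ((i | i) | i) ((j | j) | j)
        · rfl
        · rw [Subsingleton.elim i 0, Subsingleton.elim j 0]; rfl
        all_goals rfl
      obtain ⟨X, Y, hX, hY, hXY⟩ := splits_blockSum l' hge' B2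
      have h2 : Eqv M (Matrix.fromBlocks (Matrix.fromBlocks (evenBlock a) B1 0 (evenBlock (a - 1)))
          0 0 (blockSum l')) := by
        refine h1.trans (Eqv.clear _ _ _ _ (Matrix.fromRows X 0) (Matrix.fromRows Y 0) ?_ ?_ ?_)
        · rintro (i | i) j
          exacts [hX i j, S2.zero_mem]
        · rintro (i | i) j
          exacts [hY i j, S1.zero_mem]
        · rw [Matrix.fromRows_mul, Matrix.fromBlocks_mul_fromRows, hXY]
          ext (i | i) j <;> simp
      have hno2 : NoSection (a - 1)
          (Matrix.fromBlocks (evenBlock a) B1 0 (evenBlock (a - 1))) := by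
        intro w hw1 hw2
        have := hno.of_eqv h2 (Sum.elim w 0) ?_ ?_
        · ext i
          exact congrFun this (Sum.inl i)
        · rintro (i | i)
          exacts [hw1 i, S1.zero_mem]
        · rintro (i | i)
          · rw [Matrix.fromBlocks_mulVec]
            simpa using hw2 i
          · rw [Matrix.fromBlocks_mulVec]
            simp
      refine ⟨(2 * (a - 1) + 1) :: l', h2.trans (Eqv.trans ?_ (eqv_blockSum_cons _ _).symm)⟩
      exact Eqv.diag ((eqv_oddBlock _ hno2).trans (eqv_block_odd _).symm) (Eqv.refl _)
    · have hge' : ∀ i ∈ l, 2 * a - 1 ≤ i := by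
        intro i hi
        have h1 := hge i hi
        have h2 : i ≠ 2 * (a - 1) := by rintro rfl; exact hmem hi
        omega
      obtain ⟨B', hB'⟩ := Eqv.triangular (evenBlock a) B hl
      obtain ⟨X, Y, hX, hY, hXY⟩ := splits_blockSum l hge' B'
      refine ⟨2 * a :: l, (h.trans hB').trans
        ((Eqv.clear _ _ 0 _ X Y hX hY (by rw [zero_add]; exact hXY)).trans
          (Eqv.trans ?_ (eqv_blockSum_cons _ _).symm))⟩
      exact Eqv.diag (eqv_block_even _).symm (Eqv.refl _)

/-! ### Global sections of the indecomposable bundles -/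

/-- The elements of `R₁₂` whose coefficients vanish outside of the finite set `s` of exponents. -/
def supp (s : Finset (Fin 2 × ℤ)) : Submodule ℝ R12 where
  carrier := {f | ∀ e k, (e, k) ∉ s → cf f e k = 0}
  add_mem' hf hg e k h := by rw [cf_add, hf e k h, hg e k h, add_zero]
  zero_mem' e k _ := cf_zero e k
  smul_mem' c f hf e k h := by rw [cf_smul, hf e k h, mul_zero]

/-- The monomial `T ^ k` or `T ^ k x`. -/
def mono (e : Fin 2) (k : ℤ) : R12 := if e = 0 then tp k else tp k * xy

theorem cf_mono (e : Fin 2) (k : ℤ) (e' : Fin 2) (k' : ℤ) :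
    cf (mono e k) e' k' = if e' = e ∧ k' = k then 1 else 0 := by
  fin_cases e
  · exact cf_tp k e' k'
  · exact cf_tp_xy k e' k'

/-- The monomials in `s` are a basis of `supp s`. -/
def suppEquiv (s : Finset (Fin 2 × ℤ)) : supp s ≃ₗ[ℝ] (s → ℝ) where
  toFun f i := cf f.1 i.1.1 i.1.2
  map_add' f g := by ext i; exact cf_add _ _ _ _
  map_smul' c f := by ext i; exact cf_smul _ _ _ _
  invFun c := ⟨∑ i : s, c i • mono i.1.1 i.1.2, fun e k h => by
    rw [cf_sum]
    refine Finset.sum_eq_zero fun i _ => ?_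
    rw [cf_smul, cf_mono, if_neg, mul_zero]
    rintro ⟨rfl, rfl⟩
    exact h i.2⟩
  left_inv f := by
    apply Subtype.ext
    apply cf_ext
    intro e k
    simp only [cf_sum, cf_smul, cf_mono]
    by_cases h : (e, k) ∈ s
    · rw [Finset.sum_eq_single ⟨(e, k), h⟩]
      · simp
      · intro i _ hi
        rw [if_neg, mul_zero]
        rintro ⟨h1, h2⟩
        exact hi (Subtype.ext (Prod.ext h1.symm h2.symm))
      · simp
    · rw [f.2 e k h]
      refine Finset.sum_eq_zero fun i _ => ?_
      rw [if_neg, mul_zero]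
      rintro ⟨rfl, rfl⟩
      exact h i.2
  right_inv c := by
    ext i
    simp only [cf_sum, cf_smul, cf_mono]
    rw [Finset.sum_eq_single i]
    · simp
    · intro j _ hj
      rw [if_neg, mul_zero]
      rintro ⟨h1, h2⟩
      exact hj (Subtype.ext (Prod.ext h1.symm h2.symm))
    · simp

theorem rank_supp (s : Finset (Fin 2 × ℤ)) : Module.rank ℝ (supp s) = (s.card : ℕ) := by
  rw [(suppEquiv s).rank_eq, rank_fun', Fintype.card_coe]

/-- The subring `R₁` as a real subspace. -/
def V1 : Submodule ℝ R12 where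
  carrier := S1
  add_mem' := S1.add_mem
  zero_mem' := S1.zero_mem
  smul_mem' c _ h := smul_mem_S1 c h

/-- The elements `f` with `T ^ k f ∈ R₂`, as a real subspace. -/
def V2 (k : ℤ) : Submodule ℝ R12 where
  carrier := {f | tp k * f ∈ S2}
  add_mem' hf hg := by simpa [mul_add] using S2.add_mem hf hg
  zero_mem' := by simp [S2.zero_mem]
  smul_mem' c f h := by simpa [mul_smul_comm] using smul_mem_S2 c h

theorem mem_V1 {f : R12} : f ∈ V1 ↔ f ∈ S1 := Iff.rfl
theorem mem_V2 {k : ℤ} {f : R12} : f ∈ V2 k ↔ tp k * f ∈ S2 := Iff.rfl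

theorem V1_mul {f g : R12} (hf : f ∈ V1) (hg : g ∈ V1) : f * g ∈ V1 := S1.mul_mem hf hg
theorem V2_mul {k : ℤ} {f g : R12} (hf : f ∈ S2) (hg : g ∈ V2 k) : f * g ∈ V2 k := by
  rw [mem_V2, mul_left_comm]; exact S2.mul_mem hf hg
theorem V2_tp {k l : ℤ} {f : R12} : tp l * f ∈ V2 k ↔ f ∈ V2 (k + l) := by
  rw [mem_V2, mem_V2, tp_add, mul_assoc]
theorem V2_mono {k l : ℤ} (h : k ≤ l) : V2 k ≤ V2 l := by
  intro f hf
  have := S2.mul_mem (tp_mem_S2 (k := l - k) (by omega)) hf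
  rw [← mul_assoc, ← tp_add, sub_add_cancel] at this
  exact this

/-- The global sections of the line bundle of degree `2k`. -/
def lineSec (k : ℤ) : Submodule ℝ R12 := V1 ⊓ V2 k

theorem mem_lineSec_iff {k : ℤ} {f : R12} : f ∈ lineSec k ↔
    f ∈ supp (({0} ×ˢ Finset.Icc (-k) 0) ∪ ({1} ×ˢ Finset.Icc (-k) (-1))) := by
  change f ∈ S1 ∧ tp k * f ∈ S2 ↔ ∀ e m, _ → cf f e m = 0
  rw [mem_S1, mem_S2, Fin.forall_fin_two, Fin.forall_fin_two]
  simp only [cf_tp_mul, Finset.mem_union, Finset.mem_product, Finset.mem_singleton, Finset.mem_Icc]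
  constructor
  · rintro ⟨⟨h1, h2⟩, h3, h4⟩
    constructor
    · intro m hm
      rcases lt_or_ge 0 m with h | h
      · exact h1 m h
      · simpa using h3 (m + k) (by simp at hm; omega)
    · intro m hm
      rcases le_or_gt 0 m with h | h
      · exact h2 m h
      · simpa using h4 (m + k) (by simp at hm; omega)
  · rintro ⟨h1, h2⟩
    refine ⟨⟨fun m hm => h1 m ?_, fun m hm => h2 m ?_⟩, fun m hm => h1 _ ?_, fun m hm => h2 _ ?_⟩
    all_goals simp; omega

theorem rank_lineSec (k : ℤ) : Module.rank ℝ (lineSec k) = ((2 * k + 1).toNat : ℕ) := by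
  have : lineSec k = supp (({0} ×ˢ Finset.Icc (-k) 0) ∪ ({1} ×ˢ Finset.Icc (-k) (-1))) := by
    ext f; exact mem_lineSec_iff
  rw [this, rank_supp, Finset.card_union_of_disjoint]
  · simp only [Finset.card_product, Finset.card_singleton, one_mul, Int.card_Icc]
    congr 1; omega
  · rw [Finset.disjoint_left]
    rintro ⟨e, m⟩ h1 h2
    simp only [Finset.mem_product, Finset.mem_singleton] at h1 h2
    rw [h1.1] at h2
    exact absurd h2.1 (by simp)

/-- The global sections of the indecomposable bundle of rank two and of slope `2k + 1`. -/
def planeSec (k : ℤ) : Submodule ℝ (R12 × R12) where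
  carrier := {f | f.1 ∈ V1 ∧ f.2 ∈ V1 ∧ f.1 ∈ V2 (k + 1) ∧ f.2 + xy * f.1 ∈ V2 k}
  add_mem' := by
    rintro f g ⟨h1, h2, h3, h4⟩ ⟨g1, g2, g3, g4⟩
    refine ⟨add_mem h1 g1, add_mem h2 g2, add_mem h3 g3, ?_⟩
    have := add_mem h4 g4
    simp only [Prod.snd_add, Prod.fst_add]
    convert this using 1; ring
  zero_mem' := by simp
  smul_mem' := by
    rintro c f ⟨h1, h2, h3, h4⟩
    refine ⟨V1.smul_mem c h1, V1.smul_mem c h2, (V2 _).smul_mem c h3, ?_⟩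
    have := (V2 k).smul_mem c h4
    simp only [Prod.smul_snd, Prod.smul_fst]
    rwa [mul_smul_comm, ← smul_add]

theorem negPart_add (f g : R12) : negPart (f + g) = negPart f + negPart g := by
  apply cf_ext
  intro e k
  simp only [cf_negPart, cf_add]
  split_ifs <;> simp

theorem negPart_smul (c : ℝ) (f : R12) : negPart (c • f) = c • negPart f := by
  apply cf_ext
  intro e k
  simp only [cf_negPart, cf_smul]
  split_ifs <;> simp

/-- The splitting of `planeSec k` into sections of two line bundles, for `k ≥ 0`. -/
def planeSecEquiv {k : ℤ} (hk : 0 ≤ k) : planeSec k ≃ₗ[ℝ] lineSec (k + 1) × lineSec k where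
  toFun f := (⟨f.1.1, f.2.1, f.2.2.2.1⟩, ⟨f.1.2 + negPart (xy * f.1.1),
    add_mem f.2.2.1 (negPart_mem_S1 _), by
      have h1 := f.2.2.2.2
      have h2 : xy * f.1.1 - negPart (xy * f.1.1) ∈ V2 k :=
        V2_mono hk (by rw [mem_V2, tp_zero, one_mul]; exact sub_negPart_mem_S2 _)
      have := sub_mem h1 h2
      rw [show f.1.2 + xy * f.1.1 - (xy * f.1.1 - negPart (xy * f.1.1)) =
        f.1.2 + negPart (xy * f.1.1) by ring] at this
      exact this⟩)
  map_add' f g := by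
    apply Prod.ext
    · rfl
    · apply Subtype.ext
      simp [mul_add, negPart_add]; ring
  map_smul' c f := by
    apply Prod.ext
    · rfl
    · apply Subtype.ext
      simp [negPart_smul]
  invFun g := ⟨(g.1.1, g.2.1 - negPart (xy * g.1.1)), g.1.2.1,
    sub_mem g.2.2.1 (negPart_mem_S1 _), g.1.2.2, by
      have h1 := g.2.2.2
      have h2 : xy * g.1.1 - negPart (xy * g.1.1) ∈ V2 k :=
        V2_mono hk (by rw [mem_V2, tp_zero, one_mul]; exact sub_negPart_mem_S2 _)
      have := add_mem h1 h2
      convert this using 1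
      ring⟩
  left_inv f := by
    apply Subtype.ext
    apply Prod.ext <;> simp
  right_inv g := by
    apply Prod.ext <;> apply Subtype.ext <;> simp

theorem planeSec_eq_bot {k : ℤ} (hk : k < 0) : planeSec k = ⊥ := by
  rw [eq_bot_iff]
  rintro ⟨q, p⟩ ⟨h1, h2, h3, h4⟩
  simp only at h1 h2 h3 h4
  have hq2 : q ∈ S2 := by
    have := V2_mono (show k + 1 ≤ 0 by omega) h3
    rwa [mem_V2, tp_zero, one_mul] at this
  obtain ⟨c, hc⟩ := real_of_mem hq2 h1
  have h5 : p + xy * q ∈ V2 (-1) := V2_mono (by omega) h4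
  rw [mem_V2, mem_S2] at h5
  rw [mem_V1, mem_S1] at h2
  have e1 : ∀ e m, cf (xy * q) e m = c * if e = 1 ∧ m = 0 then 1 else 0 := by
    intro e m
    rw [hc, mul_comm, ← Algebra.smul_def, cf_smul, ← cf_tp_xy, tp_zero, one_mul]
  have h6 := h5 1 (-1) (by norm_num)
  rw [cf_tp_mul, cf_add, e1] at h6
  simp [h2.2 0 le_rfl] at h6
  have hq : q = 0 := by rw [hc, h6, map_zero]
  have hp : p = 0 := by
    apply cf_ext
    intro e m
    rw [cf_zero]
    rcases lt_or_ge 0 m with hm | hm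
    · fin_cases e
      exacts [h2.1 m hm, h2.2 m hm.le]
    · have := h5 e (m - 1) (by omega)
      rw [cf_tp_mul, hq, mul_zero, add_zero] at this
      simpa using this
  rw [Submodule.mem_bot, hq, hp]; rfl

theorem rank_planeSec (k : ℤ) : Module.rank ℝ (planeSec k) = ((4 * (k + 1)).toNat : ℕ) := by
  rcases lt_or_ge k 0 with hk | hk
  · rw [planeSec_eq_bot hk, rank_bot, show (4 * (k + 1)).toNat = 0 by omega, Nat.cast_zero]
  · rw [(planeSecEquiv hk).rank_eq, rank_prod', rank_lineSec, rank_lineSec, ← Nat.cast_add]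
    congr 1; omega

/-! ### Dimensions of spaces of sections -/

section
variable {κ μ : Type} [Fintype κ] [Fintype μ]

/-- The global sections of twists of the bundle `M`. For `δ = 0, c = 0` these are pairs of
sections of the twist of degree `2a`; for `δ = 1, c = x` they are the sections of the tensor
product with the indecomposable bundle of rank two of slope `2a + 1`. -/
def sec (a δ : ℤ) (c : R12) (M : Matrix κ κ R12) : Submodule ℝ ((κ → R12) × (κ → R12)) where
  carrier := {f | (∀ i, f.1 i ∈ V1) ∧ (∀ i, f.2 i ∈ V1) ∧
    (∀ i, M.mulVec f.1 i ∈ V2 (a + δ)) ∧ ∀ i, M.mulVec (f.2 + c • f.1) i ∈ V2 a}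
  add_mem' := by
    rintro f g ⟨h1, h2, h3, h4⟩ ⟨g1, g2, g3, g4⟩
    refine ⟨fun i => add_mem (h1 i) (g1 i), fun i => add_mem (h2 i) (g2 i), fun i => ?_,
      fun i => ?_⟩
    · rw [Prod.fst_add, Matrix.mulVec_add]; exact add_mem (h3 i) (g3 i)
    · have := add_mem (h4 i) (g4 i)
      rw [← Pi.add_apply, ← Matrix.mulVec_add] at this
      rw [Prod.fst_add, Prod.snd_add, smul_add, add_add_add_comm]
      exact this
  zero_mem' := by simp
  smul_mem' := by
    rintro d f ⟨h1, h2, h3, h4⟩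
    refine ⟨fun i => V1.smul_mem d (h1 i), fun i => V1.smul_mem d (h2 i), fun i => ?_,
      fun i => ?_⟩
    · rw [Prod.smul_fst, Matrix.mulVec_smul]; exact (V2 _).smul_mem d (h3 i)
    · have := (V2 _).smul_mem d (h4 i)
      rw [← Pi.smul_apply, ← Matrix.mulVec_smul] at this
      rw [Prod.smul_fst, Prod.smul_snd, smul_comm c d, ← smul_add]
      exact this

theorem Ent.mulVec_V2 {κ μ : Type} [Fintype μ] {L : Matrix κ μ R12} (hL : Ent S2 L) {k : ℤ}
    {v : μ → R12} (hv : ∀ i, v i ∈ V2 k) (i : κ) : L.mulVec v i ∈ V2 k :=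
  Submodule.sum_mem _ fun j _ => V2_mul (hL i j) (hv j)

theorem map_mem_sec [DecidableEq κ] {a δ : ℤ} {c : R12} {M : Matrix κ κ R12} {L : Matrix μ κ R12}
    {R : Matrix κ μ R12} {R' : Matrix μ κ R12} (hL : Ent S2 L) (hR' : Ent S1 R') (h : R * R' = 1)
    {f : (κ → R12) × (κ → R12)} (hf : f ∈ sec a δ c M) :
    (R'.mulVec f.1, R'.mulVec f.2) ∈ sec a δ c (L * M * R) := by
  have e : ∀ v, (L * M * R).mulVec (R'.mulVec v) = L.mulVec (M.mulVec v) := by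
    intro v
    rw [Matrix.mulVec_mulVec, Matrix.mul_assoc, h, Matrix.mul_one, Matrix.mulVec_mulVec]
  obtain ⟨h1, h2, h3, h4⟩ := hf
  refine ⟨fun i => hR'.mulVec h1 i, fun i => hR'.mulVec h2 i, fun i => ?_, fun i => ?_⟩
  · rw [e]; exact hL.mulVec_V2 h3 i
  · simp only
    rw [← Matrix.mulVec_smul, ← Matrix.mulVec_add, e]; exact hL.mulVec_V2 h4 i

/-- The dimension of the space of sections is an invariant of the bundle. -/
theorem rank_sec_eq [DecidableEq κ] [DecidableEq μ] (a δ : ℤ) (c : R12) {M : Matrix κ κ R12}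
    {D : Matrix μ μ R12} (h : Eqv M D) :
    Module.rank ℝ (sec a δ c M) = Module.rank ℝ (sec a δ c D) := by
  obtain ⟨L, L', R, R', ⟨h1, h2, h3, h4⟩, ⟨h5, h6, h7, h8⟩, rfl⟩ := h
  have hM : L' * (L * M * R) * R' = M := by
    calc L' * (L * M * R) * R' = (L' * L) * M * (R * R') := by simp only [Matrix.mul_assoc]
      _ = M := by rw [h4, h7, Matrix.one_mul, Matrix.mul_one]
  apply LinearEquiv.rank_eq
  refine LinearEquiv.ofLinearMap
    ({ toFun := fun f => ⟨_, map_mem_sec h1 h6 h7 f.2⟩, map_add' := ?_, map_smul' := ?_ } :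
      sec a δ c M →ₗ[ℝ] sec a δ c (L * M * R))
    ({ toFun := fun f => ⟨(R.mulVec f.1.1, R.mulVec f.1.2), ?_⟩,
       map_add' := ?_, map_smul' := ?_ } :
      sec a δ c (L * M * R) →ₗ[ℝ] sec a δ c M) ?_ ?_
  · intro f g
    apply Subtype.ext
    simp [Matrix.mulVec_add]
  · intro d f
    apply Subtype.ext
    simp [Matrix.mulVec_smul]
  · have := map_mem_sec h2 h5 h8 f.2
    rwa [hM] at this
  · intro f g
    apply Subtype.ext
    simp [Matrix.mulVec_add]
  · intro d f
    apply Subtype.ext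
    simp [Matrix.mulVec_smul]
  · ext f <;> simp [h8]
  · ext f <;> simp [h7]

theorem rank_sec_diag (a δ : ℤ) (c : R12) (M : Matrix κ κ R12) (D : Matrix μ μ R12) :
    Module.rank ℝ (sec a δ c (Matrix.fromBlocks M 0 0 D)) =
      Module.rank ℝ (sec a δ c M) + Module.rank ℝ (sec a δ c D) := by
  rw [← rank_prod']
  have e : ∀ (v : κ ⊕ μ → R12), (Matrix.fromBlocks M 0 0 D).mulVec v =
      Sum.elim (M.mulVec (v ∘ Sum.inl)) (D.mulVec (v ∘ Sum.inr)) := by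
    intro v
    rw [Matrix.fromBlocks_mulVec]; simp
  apply LinearEquiv.rank_eq
  exact
  { toFun := fun f => (⟨(f.1.1 ∘ Sum.inl, f.1.2 ∘ Sum.inl), fun i => f.2.1 _, fun i => f.2.2.1 _,
        fun i => by have := f.2.2.2.1 (Sum.inl i); rw [e] at this; exact this,
        fun i => by have := f.2.2.2.2 (Sum.inl i); rw [e] at this; exact this⟩,
      ⟨(f.1.1 ∘ Sum.inr, f.1.2 ∘ Sum.inr), fun i => f.2.1 _, fun i => f.2.2.1 _,
        fun i => by have := f.2.2.2.1 (Sum.inr i); rw [e] at this; exact this,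
        fun i => by have := f.2.2.2.2 (Sum.inr i); rw [e] at this; exact this⟩)
    invFun := fun g => ⟨(Sum.elim g.1.1.1 g.2.1.1, Sum.elim g.1.1.2 g.2.1.2),
      by rintro (i | i); exacts [g.1.2.1 i, g.2.2.1 i],
      by rintro (i | i); exacts [g.1.2.2.1 i, g.2.2.2.1 i],
      by
        intro i
        rw [e]
        rcases i with i | i
        exacts [g.1.2.2.2.1 i, g.2.2.2.2.1 i],
      by
        intro i
        rw [e]
        rcases i with i | i
        exacts [g.1.2.2.2.2 i, g.2.2.2.2.2 i]⟩
    map_add' := fun _ _ => rfl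
    map_smul' := fun _ _ => rfl
    left_inv := fun f => by
      apply Subtype.ext
      apply Prod.ext <;> (ext i; rcases i with i | i <;> rfl)
    right_inv := fun g => rfl }

end

theorem evenBlock_mulVec (b : ℤ) (v : Fin 1 → R12) (i : Fin 1) :
    (evenBlock b).mulVec v i = tp (-b) * v 0 := by
  rw [Subsingleton.elim i 0]
  simp [evenBlock, Matrix.mulVec, dotProduct]

theorem oddBlock_mulVec_zero (b : ℤ) (v : Fin 2 → R12) :
    (oddBlock b).mulVec v 0 = tp (-b - 1) * (v 0 + xy * v 1) := by
  simp [oddBlock, Matrix.mulVec, dotProduct, Fin.sum_univ_two]; ring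

theorem oddBlock_mulVec_one (b : ℤ) (v : Fin 2 → R12) :
    (oddBlock b).mulVec v 1 = tp (-b) * v 1 := by
  simp [oddBlock, Matrix.mulVec, dotProduct, Fin.sum_univ_two]

theorem mem_sec_evenBlock {a δ b : ℤ} {c : R12} {f : (Fin 1 → R12) × (Fin 1 → R12)} :
    f ∈ sec a δ c (evenBlock b) ↔ f.1 0 ∈ V1 ∧ f.2 0 ∈ V1 ∧ f.1 0 ∈ V2 (a - b + δ) ∧
      f.2 0 + c * f.1 0 ∈ V2 (a - b) := by
  change (_ ∧ _ ∧ _ ∧ _) ↔ _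
  simp only [evenBlock_mulVec, V2_tp, Unique.forall_iff, Fin.default_eq_zero, Pi.add_apply,
    Pi.smul_apply, smul_eq_mul]
  rw [show a + δ + -b = a - b + δ by ring, show a + -b = a - b by ring]

theorem mem_sec_oddBlock {a δ b : ℤ} {c : R12} {f : (Fin 2 → R12) × (Fin 2 → R12)} :
    f ∈ sec a δ c (oddBlock b) ↔ (f.1 0 ∈ V1 ∧ f.1 1 ∈ V1) ∧ (f.2 0 ∈ V1 ∧ f.2 1 ∈ V1) ∧
      (f.1 0 + xy * f.1 1 ∈ V2 (a - b - 1 + δ) ∧ f.1 1 ∈ V2 (a - b + δ)) ∧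
      (f.2 0 + c * f.1 0 + xy * (f.2 1 + c * f.1 1) ∈ V2 (a - b - 1) ∧
        f.2 1 + c * f.1 1 ∈ V2 (a - b)) := by
  change (_ ∧ _ ∧ _ ∧ _) ↔ _
  simp only [Fin.forall_fin_two, oddBlock_mulVec_zero, oddBlock_mulVec_one, V2_tp, Pi.add_apply,
    Pi.smul_apply, smul_eq_mul]
  rw [show a + δ + (-b - 1) = a - b - 1 + δ by ring, show a + δ + -b = a - b + δ by ring,
    show a + (-b - 1) = a - b - 1 by ring, show a + -b = a - b by ring]

theorem rank_sec_even_even (a b : ℤ) : Module.rank ℝ (sec a 0 0 (evenBlock b)) =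
    (2 * (2 * (a - b) + 1).toNat : ℕ) := by
  have e : sec a 0 0 (evenBlock b) ≃ₗ[ℝ] lineSec (a - b) × lineSec (a - b) :=
  { toFun := fun f => by
      have h := mem_sec_evenBlock.1 f.2
      exact (⟨f.1.1 0, h.1, by simpa using h.2.2.1⟩, ⟨f.1.2 0, h.2.1, by simpa using h.2.2.2⟩)
    invFun := fun g => ⟨(fun _ => g.1.1, fun _ => g.2.1), mem_sec_evenBlock.2
      ⟨g.1.2.1, g.2.2.1, by simpa using g.1.2.2, by simpa using g.2.2.2⟩⟩
    map_add' := fun _ _ => rfl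
    map_smul' := fun _ _ => rfl
    left_inv := fun f => by
      apply Subtype.ext
      apply Prod.ext <;> (ext i; rw [Subsingleton.elim i 0])
    right_inv := fun _ => rfl }
  rw [e.rank_eq, rank_prod', rank_lineSec, ← Nat.cast_add, two_mul (Int.toNat _)]

theorem rank_sec_odd_even (a b : ℤ) : Module.rank ℝ (sec a 1 xy (evenBlock b)) =
    ((4 * (a - b + 1)).toNat : ℕ) := by
  have e : sec a 1 xy (evenBlock b) ≃ₗ[ℝ] planeSec (a - b) :=
  { toFun := fun f => ⟨(f.1.1 0, f.1.2 0), mem_sec_evenBlock.1 f.2⟩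
    invFun := fun g => ⟨(fun _ => g.1.1, fun _ => g.1.2), mem_sec_evenBlock.2 g.2⟩
    map_add' := fun _ _ => rfl
    map_smul' := fun _ _ => rfl
    left_inv := fun f => by
      apply Subtype.ext
      apply Prod.ext <;> (ext i; rw [Subsingleton.elim i 0])
    right_inv := fun _ => rfl }
  rw [e.rank_eq, rank_planeSec]

theorem rank_sec_even_odd (a b : ℤ) : Module.rank ℝ (sec a 0 0 (oddBlock b)) =
    (2 * (4 * (a - b)).toNat : ℕ) := by
  have e : sec a 0 0 (oddBlock b) ≃ₗ[ℝ] planeSec (a - b - 1) × planeSec (a - b - 1) :=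
  { toFun := fun f => by
      have h := mem_sec_oddBlock.1 f.2
      exact (⟨(f.1.1 1, f.1.1 0), h.1.2, h.1.1, by simpa using h.2.2.1.2,
          by simpa using h.2.2.1.1⟩,
        ⟨(f.1.2 1, f.1.2 0), h.2.1.2, h.2.1.1, by simpa using h.2.2.2.2,
          by simpa using h.2.2.2.1⟩)
    invFun := fun g => ⟨(![g.1.1.2, g.1.1.1], ![g.2.1.2, g.2.1.1]), by
      obtain ⟨⟨g1, h1, h2, h3, h4⟩, ⟨g2, k1, k2, k3, k4⟩⟩ := g
      rw [mem_sec_oddBlock]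
      rw [sub_add_cancel] at h3 k3
      simp only [Matrix.cons_val_zero, Matrix.cons_val_one, zero_mul, add_zero]
      exact ⟨⟨h2, h1⟩, ⟨k2, k1⟩, ⟨h4, h3⟩, ⟨k4, k3⟩⟩⟩
    map_add' := fun _ _ => rfl
    map_smul' := fun _ _ => rfl
    left_inv := fun f => by
      apply Subtype.ext
      apply Prod.ext <;> (ext i; fin_cases i <;> rfl)
    right_inv := fun _ => rfl }
  rw [e.rank_eq, rank_prod', rank_planeSec, ← Nat.cast_add, two_mul (Int.toNat _),
    sub_add_cancel]

theorem V1_tp {k : ℤ} (hk : k ≤ 0) : tp k ∈ V1 := tp_mem_S1 hk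
theorem V1_xz : xy * tp (-1) ∈ V1 := by rw [mul_comm, ← xz_eq]; exact xz_mem_S1

/-- The endomorphisms of the indecomposable bundle of rank two are Hamilton's quaternions: its
tensor square is the sum of four copies of a line bundle. The map `g ↦ (v, w)` is a matrix
which is invertible over `R₁`, and the conditions on `(v, w)` at the other chart correspond to those
on `g` under a matrix that is invertible over `R₂`. -/
def quaternionEquiv (a b : ℤ) : sec a 1 xy (oddBlock b) ≃ₗ[ℝ]
    (lineSec (a - b) × lineSec (a - b)) × (lineSec (a - b) × lineSec (a - b)) := by
  set k := a - b with hk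
  set t := tp (-1) with ht
  set z := xy * t with hz
  have htz : t * t + z * z = -1 := by
    have h1 : tp 2 * (t * t) = 1 := by
      rw [ht, ← tp_add, ← tp_add]; exact tp_zero
    rw [hz]
    linear_combination (t * t) * xy_mul_xy - h1
  have htT : tp 1 * t = 1 := tp_mul_neg 1
  have hx : xy * xy = -(tp 1 * tp 1 + 1) := by rw [xy_mul_xy, ← tp_add]; rfl
  have ht1 : t ∈ V1 := V1_tp (by norm_num)
  have hz1 : z ∈ V1 := V1_xz
  set h2 : R12 := algebraMap ℝ R12 (1 / 2) with hh2
  have h22 : 2 * h2 = 1 := by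
    rw [hh2, ← map_ofNat (algebraMap ℝ R12) 2, ← map_mul]; norm_num
  have halfm : ∀ {S : Submodule ℝ R12} {f : R12}, f ∈ S → h2 * f ∈ S := by
    intro S f hf
    rw [hh2, ← Algebra.smul_def]; exact S.smul_mem _ hf
  have hxm : ∀ {m : ℤ} {f : R12}, f ∈ V2 m → xy * f ∈ V2 m := fun h => V2_mul xy_mem_S2 h
  have hTm : ∀ {m : ℤ} {f : R12}, f ∈ V2 m → tp 1 * f ∈ V2 m :=
    fun h => V2_mul (tp_mem_S2 (by norm_num)) h
  have hodd : ∀ f : (Fin 2 → R12) × (Fin 2 → R12), f ∈ sec a 1 xy (oddBlock b) ↔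
      (f.1 0 ∈ V1 ∧ f.1 1 ∈ V1) ∧ (f.2 0 ∈ V1 ∧ f.2 1 ∈ V1) ∧
      (f.1 0 + xy * f.1 1 ∈ V2 k ∧ tp 1 * f.1 1 ∈ V2 k) ∧
      (t * (f.2 0 + xy * f.1 0 + xy * (f.2 1 + xy * f.1 1)) ∈ V2 k ∧
        f.2 1 + xy * f.1 1 ∈ V2 k) := by
    intro f
    rw [mem_sec_oddBlock, ht, V2_tp, V2_tp, sub_add_cancel, ← hk, ← sub_eq_add_neg]
  have hinv : ∀ g : (lineSec k × lineSec k) × (lineSec k × lineSec k),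
      ((![(g.1.1 : R12) - z * g.1.2 + t * g.2.2, t * g.1.2 + g.2.1 + z * g.2.2],
        ![-(t * g.1.2) + g.2.1 - z * g.2.2, -g.1.1 - z * g.1.2 + t * g.2.2]) :
          (Fin 2 → R12) × (Fin 2 → R12)) ∈ sec a 1 xy (oddBlock b) := by
    rintro ⟨⟨⟨g1, p1, q1⟩, ⟨g2, p2, q2⟩⟩, ⟨⟨g3, p3, q3⟩, ⟨g4, p4, q4⟩⟩⟩
    rw [hodd]
    dsimp only
    refine ⟨⟨?_, ?_⟩, ⟨?_, ?_⟩, ⟨?_, ?_⟩, ⟨?_, ?_⟩⟩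
    · exact add_mem (sub_mem p1 (V1_mul hz1 p2)) (V1_mul ht1 p4)
    · exact add_mem (add_mem (V1_mul ht1 p2) p3) (V1_mul hz1 p4)
    · exact sub_mem (add_mem (neg_mem (V1_mul ht1 p2)) p3) (V1_mul hz1 p4)
    · exact add_mem (sub_mem (neg_mem p1) (V1_mul hz1 p2)) (V1_mul ht1 p4)
    · convert sub_mem (add_mem q1 (hxm q3)) (hTm q4) using 1
      simp only [Matrix.cons_val_zero, Matrix.cons_val_one]
      linear_combination g4 * t * hx - g4 * tp 1 * htT
    · convert add_mem (add_mem q2 (hTm q3)) (hxm q4) using 1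
      simp only [Matrix.cons_val_zero, Matrix.cons_val_one]
      linear_combination (g2 + xy * g4) * htT
    · convert sub_mem (sub_mem q2 (hTm q3)) (hxm q4) using 1
      simp only [Matrix.cons_val_zero, Matrix.cons_val_one]
      linear_combination t * (-t * g2 + g3 + xy * t * g4) * hx +
        ((t * tp 1 + 1) * (g2 - xy * g4) - tp 1 * g3) * htT
    · convert sub_mem (add_mem (neg_mem q1) (hxm q3)) (hTm q4) using 1
      simp only [Matrix.cons_val_zero, Matrix.cons_val_one]
      linear_combination g4 * t * hx - g4 * tp 1 * htT
  refine
  { toFun := fun f =>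
      ((⟨h2 * (f.1.1 0 - f.1.2 1), ?_, ?_⟩,
        ⟨h2 * (z * (f.1.1 0 + f.1.2 1) - t * (f.1.1 1 - f.1.2 0)), ?_, ?_⟩),
       (⟨h2 * (f.1.1 1 + f.1.2 0), ?_, ?_⟩,
        ⟨-(h2 * (t * (f.1.1 0 + f.1.2 1) + z * (f.1.1 1 - f.1.2 0))), ?_, ?_⟩))
    invFun := fun g => ⟨_, hinv g⟩
    map_add' := ?_
    map_smul' := ?_
    left_inv := ?_
    right_inv := ?_ }
  rotate_left 8
  · rintro ⟨⟨v, w⟩, hf⟩ ⟨⟨v', w'⟩, hf'⟩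
    refine Prod.ext (Prod.ext (Subtype.ext ?_) (Subtype.ext ?_))
      (Prod.ext (Subtype.ext ?_) (Subtype.ext ?_))
    · change h2 * (v 0 + v' 0 - (w 1 + w' 1)) = h2 * (v 0 - w 1) + h2 * (v' 0 - w' 1)
      ring
    · change h2 * (z * (v 0 + v' 0 + (w 1 + w' 1)) - t * (v 1 + v' 1 - (w 0 + w' 0))) =
        h2 * (z * (v 0 + w 1) - t * (v 1 - w 0)) + h2 * (z * (v' 0 + w' 1) - t * (v' 1 - w' 0))
      ring
    · change h2 * (v 1 + v' 1 + (w 0 + w' 0)) = h2 * (v 1 + w 0) + h2 * (v' 1 + w' 0)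
      ring
    · change -(h2 * (t * (v 0 + v' 0 + (w 1 + w' 1)) + z * (v 1 + v' 1 - (w 0 + w' 0)))) =
        -(h2 * (t * (v 0 + w 1) + z * (v 1 - w 0))) +
          -(h2 * (t * (v' 0 + w' 1) + z * (v' 1 - w' 0)))
      ring
  · rintro r ⟨⟨v, w⟩, hf⟩
    refine Prod.ext (Prod.ext (Subtype.ext ?_) (Subtype.ext ?_))
      (Prod.ext (Subtype.ext ?_) (Subtype.ext ?_))
    · change h2 * (r • v 0 - r • w 1) = r • (h2 * (v 0 - w 1))
      simp only [Algebra.smul_def]; ring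
    · change h2 * (z * (r • v 0 + r • w 1) - t * (r • v 1 - r • w 0)) =
        r • (h2 * (z * (v 0 + w 1) - t * (v 1 - w 0)))
      simp only [Algebra.smul_def]; ring
    · change h2 * (r • v 1 + r • w 0) = r • (h2 * (v 1 + w 0))
      simp only [Algebra.smul_def]; ring
    · change -(h2 * (t * (r • v 0 + r • w 1) + z * (r • v 1 - r • w 0))) =
        r • -(h2 * (t * (v 0 + w 1) + z * (v 1 - w 0)))
      simp only [Algebra.smul_def]; ring
  · rintro ⟨⟨v, w⟩, hf⟩
    apply Subtype.ext
    apply Prod.ext <;> (ext i; fin_cases i)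
    · change h2 * (v 0 - w 1) - z * (h2 * (z * (v 0 + w 1) - t * (v 1 - w 0))) +
        t * -(h2 * (t * (v 0 + w 1) + z * (v 1 - w 0))) = v 0
      linear_combination -h2 * (v 0 + w 1) * htz + v 0 * h22
    · change t * (h2 * (z * (v 0 + w 1) - t * (v 1 - w 0))) + h2 * (v 1 + w 0) +
        z * -(h2 * (t * (v 0 + w 1) + z * (v 1 - w 0))) = v 1
      linear_combination -h2 * (v 1 - w 0) * htz + v 1 * h22
    · change -(t * (h2 * (z * (v 0 + w 1) - t * (v 1 - w 0)))) + h2 * (v 1 + w 0) -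
        z * -(h2 * (t * (v 0 + w 1) + z * (v 1 - w 0))) = w 0
      linear_combination h2 * (v 1 - w 0) * htz + w 0 * h22
    · change -(h2 * (v 0 - w 1)) - z * (h2 * (z * (v 0 + w 1) - t * (v 1 - w 0))) +
        t * -(h2 * (t * (v 0 + w 1) + z * (v 1 - w 0))) = w 1
      linear_combination -h2 * (v 0 + w 1) * htz + w 1 * h22
  · rintro ⟨⟨⟨g1, p1⟩, ⟨g2, p2⟩⟩, ⟨⟨g3, p3⟩, ⟨g4, p4⟩⟩⟩
    refine Prod.ext (Prod.ext (Subtype.ext ?_) (Subtype.ext ?_))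
      (Prod.ext (Subtype.ext ?_) (Subtype.ext ?_))
    · simp only [Matrix.cons_val_zero, Matrix.cons_val_one]
      linear_combination g1 * h22
    · simp only [Matrix.cons_val_zero, Matrix.cons_val_one]
      linear_combination -2 * h2 * g2 * htz + g2 * h22
    · simp only [Matrix.cons_val_zero, Matrix.cons_val_one]
      linear_combination g3 * h22
    · simp only [Matrix.cons_val_zero, Matrix.cons_val_one]
      linear_combination -2 * h2 * g4 * htz + g4 * h22
  all_goals
    obtain ⟨⟨v, w⟩, hf⟩ := f
    rw [hodd] at hf
    obtain ⟨⟨a1, a2⟩, ⟨a3, a4⟩, ⟨A1, A2⟩, ⟨A3, A4⟩⟩ := hf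
    dsimp only at a1 a2 a3 a4 A1 A2 A3 A4 ⊢
  · exact halfm (sub_mem a1 a4)
  · rw [SetLike.mem_coe]
    convert halfm (sub_mem A1 A4) using 1
    ring
  · exact halfm (sub_mem (V1_mul hz1 (add_mem a1 a4)) (V1_mul ht1 (sub_mem a2 a3)))
  · rw [SetLike.mem_coe]
    convert halfm (add_mem A2 A3) using 1
    linear_combination -h2 * t * v 1 * hx + h2 * tp 1 * v 1 * htT
  · exact halfm (add_mem a2 a3)
  · rw [SetLike.mem_coe]
    convert neg_mem (add_mem (hxm (halfm (add_mem A1 A4))) (hTm (halfm (sub_mem A2 A3)))) using 1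
    linear_combination h2 * v 1 * hx -
      h2 * (w 0 + xy * v 0 + xy * (w 1 + xy * v 1)) * htT
  · exact neg_mem (halfm (add_mem (V1_mul ht1 (add_mem a1 a4)) (V1_mul hz1 (sub_mem a2 a3))))
  · rw [SetLike.mem_coe]
    convert sub_mem (hTm (halfm (add_mem A1 A4))) (hxm (halfm (sub_mem A2 A3))) using 1
    linear_combination -h2 * (v 0 + w 1 + xy * v 1) * t * hx +
      h2 * (v 0 + w 1 + xy * v 1) * tp 1 * htT

theorem rank_sec_odd_odd (a b : ℤ) : Module.rank ℝ (sec a 1 xy (oddBlock b)) =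
    (4 * (2 * (a - b) + 1).toNat : ℕ) := by
  rw [(quaternionEquiv a b).rank_eq, rank_prod', rank_prod', rank_lineSec, ← Nat.cast_add,
    ← Nat.cast_add]
  congr 1; ring

/-! ### Multiplicities of the blocks -/

/-- The dimension of `sec` of the block of index `i`, in the twist of index `j`. -/
def blockDim (j i : ℤ) : ℕ := 2 * blockSize i * (j - i + 1).toNat

theorem rank_sec_block_even (a i : ℤ) :
    Module.rank ℝ (sec a 0 0 (block i)) = (blockDim (2 * a) i : ℕ) := by
  obtain ⟨b, rfl | rfl⟩ := even_or_odd_form i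
  · rw [rank_sec_eq a 0 0 (eqv_block_even b), rank_sec_even_even, blockDim, blockSize_even]
    congr 1
    rw [show 2 * a - 2 * b + 1 = 2 * (a - b) + 1 by ring]
  · rw [rank_sec_eq a 0 0 (eqv_block_odd b), rank_sec_even_odd, blockDim, blockSize_odd]
    congr 1; omega

theorem rank_sec_block_odd (a i : ℤ) :
    Module.rank ℝ (sec a 1 xy (block i)) = (blockDim (2 * a + 1) i : ℕ) := by
  obtain ⟨b, rfl | rfl⟩ := even_or_odd_form i
  · rw [rank_sec_eq a 1 xy (eqv_block_even b), rank_sec_odd_even, blockDim, blockSize_even]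
    congr 1; omega
  · rw [rank_sec_eq a 1 xy (eqv_block_odd b), rank_sec_odd_odd, blockDim, blockSize_odd]
    congr 1; omega

/-- The dimension of `sec` of a block sum, in the twist of index `j`. -/
def sumDim (l : List ℤ) (j : ℤ) : ℕ := (l.map (blockDim j)).sum

theorem rank_sec_nil (a δ : ℤ) (c : R12) : Module.rank ℝ (sec a δ c (blockSum [])) = 0 := by
  have : Subsingleton (sec a δ c (blockSum [])) := ⟨fun f g => by
    apply Subtype.ext
    apply Prod.ext <;> (ext i; exact i.elim0)⟩
  exact rank_subsingleton' _ _

theorem rank_sec_blockSum_even (l : List ℤ) (a : ℤ) :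
    Module.rank ℝ (sec a 0 0 (blockSum l)) = (sumDim l (2 * a) : ℕ) := by
  induction l with
  | nil => rw [rank_sec_nil]; simp [sumDim]
  | cons i l ih =>
    rw [rank_sec_eq a 0 0 (eqv_blockSum_cons i l), rank_sec_diag, ih, rank_sec_block_even]
    simp [sumDim]

theorem rank_sec_blockSum_odd (l : List ℤ) (a : ℤ) :
    Module.rank ℝ (sec a 1 xy (blockSum l)) = (sumDim l (2 * a + 1) : ℕ) := by
  induction l with
  | nil => rw [rank_sec_nil]; simp [sumDim]
  | cons i l ih =>
    rw [rank_sec_eq a 1 xy (eqv_blockSum_cons i l), rank_sec_diag, ih, rank_sec_block_odd]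
    simp [sumDim]

/-- The multiplicities are the second differences of the dimensions. -/
theorem sumDim_second_difference (l : List ℤ) (j : ℤ) :
    (sumDim l j : ℤ) - 2 * sumDim l (j - 1) + sumDim l (j - 2) =
      2 * blockSize j * (l.count j : ℕ) := by
  induction l with
  | nil => simp [sumDim]
  | cons i l ih =>
    have h : ∀ j, (sumDim (i :: l) j : ℤ) = blockDim j i + sumDim l j := by
      intro j; simp [sumDim]
    have hb : (blockDim j i : ℤ) - 2 * blockDim (j - 1) i + blockDim (j - 2) i =
        2 * blockSize j * if i = j then 1 else 0 := by
      simp only [blockDim]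
      push_cast
      have e : ((j - i + 1).toNat : ℤ) - 2 * ((j - 1 - i + 1).toNat : ℤ) +
          ((j - 2 - i + 1).toNat : ℤ) = if i = j then 1 else 0 := by
        split_ifs <;> omega
      split_ifs with hij
      · subst hij
        rw [if_pos rfl] at e
        linear_combination (2 * (blockSize i : ℤ)) * e
      · rw [if_neg hij] at e
        linear_combination (2 * (blockSize i : ℤ)) * e
    rw [h, h, h, List.count_cons]
    push_cast
    simp only [beq_iff_eq]
    linear_combination ih + hb

/-- The blocks are determined by the bundle, since the dimensions of the spaces of sections of its
twists are. -/
theorem perm_of_eqv {l l' : List ℤ} (h : Eqv (blockSum l) (blockSum l')) : l.Perm l' := by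
  have hd : ∀ j, sumDim l j = sumDim l' j := by
    intro j
    obtain ⟨a, rfl | rfl⟩ := even_or_odd_form j
    · have := rank_sec_eq a 0 0 h
      rw [rank_sec_blockSum_even, rank_sec_blockSum_even] at this
      exact_mod_cast this
    · have := rank_sec_eq a 1 xy h
      rw [rank_sec_blockSum_odd, rank_sec_blockSum_odd] at this
      exact_mod_cast this
  rw [List.perm_iff_count]
  intro j
  have h1 := sumDim_second_difference l j
  have h2 := sumDim_second_difference l' j
  rw [hd, hd, hd, h2] at h1
  have hs : (2 * (blockSize j : ℤ)) ≠ 0 := by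
    rw [blockSize]; split_ifs <;> norm_num
  exact_mod_cast (mul_left_cancel₀ hs h1).symm

/-! ### Existence and uniqueness of the canonical form -/

theorem Reduces.eqv {n : ℕ} {M D : Matrix (Fin n) (Fin n) R12} (h : Reduces M D) : Eqv M D := by
  obtain ⟨L, R, rfl⟩ := h
  refine ⟨(L : Matrix (Fin n) (Fin n) R2).map res2,
    ((L⁻¹ : GL (Fin n) R2) : Matrix (Fin n) (Fin n) R2).map res2,
    (R : Matrix (Fin n) (Fin n) R1).map res1,
    ((R⁻¹ : GL (Fin n) R1) : Matrix (Fin n) (Fin n) R1).map res1,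
    ⟨fun i j => ⟨_, rfl⟩, fun i j => ⟨_, rfl⟩, ?_, ?_⟩,
    ⟨fun i j => ⟨_, rfl⟩, fun i j => ⟨_, rfl⟩, ?_, ?_⟩, rfl⟩
  · rw [← Matrix.map_mul, Units.mul_inv, Matrix.map_one _ (map_zero _) (map_one _)]
  · rw [← Matrix.map_mul, Units.inv_mul, Matrix.map_one _ (map_zero _) (map_one _)]
  · rw [← Matrix.map_mul, Units.mul_inv, Matrix.map_one _ (map_zero _) (map_one _)]
  · rw [← Matrix.map_mul, Units.inv_mul, Matrix.map_one _ (map_zero _) (map_one _)]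

/-- A matrix with entries in the image of an injective ring map whose inverse also has its entries
there comes from an invertible matrix. -/
theorem exists_GL_of_range {A : Type} [CommRing A] {n : ℕ} (ρ : A →+* R12)
    (hρ : Function.Injective ρ) {L L' : Matrix (Fin n) (Fin n) R12} (hL : Ent ρ.range L)
    (hL' : Ent ρ.range L') (h : L * L' = 1) (h' : L' * L = 1) :
    ∃ G : GL (Fin n) A, (G : Matrix (Fin n) (Fin n) A).map ρ = L := by
  choose G hG using hL
  choose G' hG' using hL'
  have e : (Matrix.of G).map ρ = L := by ext i j; exact hG i j
  have e' : (Matrix.of G').map ρ = L' := by ext i j; exact hG' i j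
  have inj : Function.Injective fun B : Matrix (Fin n) (Fin n) A => B.map ρ :=
    Matrix.map_injective hρ
  refine ⟨⟨Matrix.of G, Matrix.of G', inj ?_, inj ?_⟩, e⟩
  · change (Matrix.of G * Matrix.of G').map ρ = (1 : Matrix (Fin n) (Fin n) A).map ρ
    rw [Matrix.map_mul, e, e', h, Matrix.map_one _ (map_zero _) (map_one _)]
  · change (Matrix.of G' * Matrix.of G).map ρ = (1 : Matrix (Fin n) (Fin n) A).map ρ
    rw [Matrix.map_mul, e, e', h', Matrix.map_one _ (map_zero _) (map_one _)]

theorem Eqv.reduces {n : ℕ} {M D : Matrix (Fin n) (Fin n) R12} (h : Eqv M D) : Reduces M D := by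
  obtain ⟨L, L', R, R', ⟨h1, h2, h3, h4⟩, ⟨h5, h6, h7, h8⟩, rfl⟩ := h
  obtain ⟨G, rfl⟩ := exists_GL_of_range res2 res2_injective h1 h2 h3 h4
  obtain ⟨H, rfl⟩ := exists_GL_of_range res1 res1_injective h5 h6 h7 h8
  exact ⟨G, H, rfl⟩

theorem eqv_reindex {n : ℕ} {l : List ℤ} (h : totalSize l = n) :
    Eqv (blockSum l) ((blockSum l).reindex (finCongr h) (finCongr h)) :=
  Eqv.of_submatrix _ (finCongr h).symm

theorem exists_canonical {n : ℕ} (M : GL (Fin n) R12) :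
    ∃ l : List ℤ, l.SortedLE ∧ ∃ h : totalSize l = n,
      Reduces (M : Matrix (Fin n) (Fin n) R12) ((blockSum l).reindex (finCongr h) (finCongr h)) := by
  obtain ⟨l, hl⟩ := exists_blockSum (M : Matrix (Fin n) (Fin n) R12)
    ((Matrix.isUnit_iff_isUnit_det _).1 M.isUnit)
  have hs := hl.trans (eqv_of_perm (List.mergeSort_perm l (· ≤ ·)).symm)
  have h : totalSize (l.mergeSort (· ≤ ·)) = n := by
    have := hs.card_eq
    rw [Fintype.card_fin, Fintype.card_fin] at this
    exact this.symm
  exact ⟨_, List.sortedLE_mergeSort, h, (hs.trans (eqv_reindex h)).reduces⟩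

theorem canonical_unique {n : ℕ} {M D D' : Matrix (Fin n) (Fin n) R12} (hD : IsCanonical D)
    (hD' : IsCanonical D') (h : Reduces M D) (h' : Reduces M D') : D' = D := by
  obtain ⟨l, hl, hn, rfl⟩ := hD
  obtain ⟨l', hl', hn', rfl⟩ := hD'
  have e : Eqv (blockSum l) (blockSum l') :=
    ((h.eqv.trans (eqv_reindex hn).symm).symm.trans h'.eqv).trans (eqv_reindex hn').symm
  obtain rfl := (perm_of_eqv e).eq_of_sortedLE hl hl'
  rfl

/-! ### Bounds for the indices of the blocks -/

section bounds
variable {n : ℕ} {M N : Matrix (Fin n) (Fin n) R12} {w : ℕ}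

theorem le_width {n : ℕ} {M : Matrix (Fin n) (Fin n) R12} {i j : Fin n} {e : Fin 2} {k : ℤ}
    (h : cf (M i j) e k ≠ 0) : k.natAbs ≤ width M := by
  have h1 : k ∈ (coord (M i j) e).coeff.support := Finsupp.mem_support_iff.2 h
  refine le_trans ?_ (Finset.le_sup (f := fun i => Finset.univ.sup fun j =>
    Finset.univ.sup fun e => (coord (M i j) e).coeff.support.sup Int.natAbs) (Finset.mem_univ i))
  refine le_trans ?_ (Finset.le_sup (f := fun j =>
    Finset.univ.sup fun e => (coord (M i j) e).coeff.support.sup Int.natAbs) (Finset.mem_univ j))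
  refine le_trans ?_ (Finset.le_sup (f := fun e =>
    (coord (M i j) e).coeff.support.sup Int.natAbs) (Finset.mem_univ e))
  exact Finset.le_sup (f := Int.natAbs) h1

theorem width_le {n : ℕ} {M : Matrix (Fin n) (Fin n) R12} {b : ℕ}
    (h : ∀ i j e k, cf (M i j) e k ≠ 0 → k.natAbs ≤ b) : width M ≤ b :=
  Finset.sup_le fun i _ => Finset.sup_le fun j _ => Finset.sup_le fun e _ =>
    Finset.sup_le fun k hk => h i j e k (Finsupp.mem_support_iff.1 hk)

theorem InT_S2_width (M : Matrix (Fin n) (Fin n) R12) (i j : Fin n) :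
    InT S2 (-(width M : ℤ)) (M i j) := by
  rw [InT, mem_S2]
  intro e k hk
  rw [cf_tp_mul]
  by_contra h
  have := le_width h
  omega

theorem InT_S1_width (M : Matrix (Fin n) (Fin n) R12) (i j : Fin n) :
    InT S1 ((width M : ℤ) + 1) (M i j) := by
  rw [InT, mem_S1]
  constructor <;>
  · intro k hk
    rw [cf_tp_mul]
    by_contra h
    have := le_width h
    omega

theorem mem_V2_iff_InT {k : ℤ} {f : R12} : f ∈ V2 k ↔ InT S2 (-k) f := by
  rw [mem_V2, InT, neg_neg]

/-- There are no sections in very negative twists. -/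
theorem sec_eq_bot (hNM : N * M = 1) (h1 : ∀ i j, InT S1 (w + 1) (M i j)) {a : ℤ}
    (ha : a < -w - 1) : sec a 0 0 M = ⊥ := by
  have key : ∀ v : Fin n → R12, (∀ i, v i ∈ V1) → (∀ i, M.mulVec v i ∈ V2 a) → v = 0 := by
    intro v hv hMv
    have h0 : M.mulVec v = 0 := by
      ext i
      by_contra hne
      have := le_of_mem hne (mem_V2_iff_InT.1 (hMv i))
        (InT.mulVec h1 (fun j => InT_zero.2 (hv j)) i)
      omega
    have : N.mulVec (M.mulVec v) = v := by rw [Matrix.mulVec_mulVec, hNM, Matrix.one_mulVec]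
    rw [← this, h0, Matrix.mulVec_zero]
  rw [eq_bot_iff]
  rintro ⟨v, u⟩ ⟨q1, q2, q3, q4⟩
  rw [add_zero] at q3
  rw [zero_smul, add_zero] at q4
  rw [Submodule.mem_bot]
  exact Prod.ext (key v q1 q3) (key u q2 q4)

/-- A block of small index would have sections in a twist where `M` has none. -/
theorem le_of_mem_list (hNM : N * M = 1) (h1 : ∀ i j, InT S1 (w + 1) (M i j)) {l : List ℤ}
    (hl : Eqv M (blockSum l)) {i : ℤ} (hi : i ∈ l) : -(2 * w + 3 : ℤ) ≤ i := by
  by_contra hlt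
  have h := rank_sec_eq (-w - 2) 0 0 hl
  rw [sec_eq_bot hNM h1 (by omega), rank_bot, rank_sec_blockSum_even] at h
  have h0 : sumDim l (2 * (-w - 2)) = 0 := by exact_mod_cast h.symm
  have h2 : blockDim (2 * (-w - 2)) i = 0 :=
    (List.sum_eq_zero_iff.1 h0) _ (List.mem_map.2 ⟨i, hi, rfl⟩)
  rw [blockDim] at h2
  have hs : 0 < blockSize i := by rw [blockSize]; split_ifs <;> norm_num
  rcases Nat.mul_eq_zero.1 h2 with h3 | h3 <;> omega

/-- The index of a block is bounded in terms of the exponents of the inverse matrix: since the lowest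
row of the block is a multiple of a unit vector, a row of `L` is a power of `T` times a row of `R⁻¹ M⁻¹`,
and it would have only negative exponents if the index were large. -/
theorem mem_list_le (hMN : M * N = 1) {C : ℕ} (hN : ∀ i j, InT S1 C (N i j)) {l : List ℤ}
    (hl : Eqv M (blockSum l)) {i : ℤ} (hi : i ∈ l) : i ≤ 2 * C + 1 := by
  have e1 : Eqv M (Matrix.fromBlocks (block i) 0 0 (blockSum (l.erase i))) :=
    (hl.trans (eqv_of_perm (List.perm_cons_erase hi))).trans (eqv_blockSum_cons _ _)
  obtain ⟨b, hb⟩ := even_or_odd_form i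
  -- the last row of the block is a multiple of a unit vector
  have key : ∀ {κ : Type} [Fintype κ] [DecidableEq κ] (D : Matrix κ κ R12) (r : κ), Eqv M D →
      (∀ c, D r c = if r = c then tp (-b) else 0) → b ≤ C := by
    intro κ _ _ D r hD hrow
    obtain ⟨L, L', R, R', ⟨g1, g2, g3, g4⟩, ⟨g5, g6, g7, g8⟩, h⟩ := hD
    have hL : ∀ j, L r j = ∑ k, (tp (-b) * R' r k) * N k j := by
      intro j
      have h2 : L = D * R' * N := by
        rw [← h, Matrix.mul_assoc _ R, g7, Matrix.mul_one, Matrix.mul_assoc, hMN, Matrix.mul_one]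
      have h3 : ∀ k, (D * R') r k = tp (-b) * R' r k := by
        intro k
        rw [Matrix.mul_apply, Finset.sum_eq_single r]
        · rw [hrow, if_pos rfl]
        · intro c _ hc; rw [hrow, if_neg hc.symm, zero_mul]
        · simp
      rw [h2, Matrix.mul_apply]
      simp only [h3]
    obtain ⟨j, hj⟩ : ∃ j, L r j ≠ 0 := by
      by_contra! hz
      have h1 := congrFun (congrFun g3 r) r
      rw [Matrix.mul_apply, Matrix.one_apply_eq] at h1
      simp [hz] at h1
    have hS1 : InT S1 (-b + C) (L r j) := by
      rw [hL]
      refine InT.sum _ fun k _ => InT.mul ?_ (hN k j)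
      have := (InT_tp S1 (-b)).mul (InT_zero.2 (g6 r k))
      rwa [add_zero] at this
    have := le_of_mem hj (InT_zero.2 (g1 r j)) hS1
    omega
  have : b ≤ C := by
    rcases hb with rfl | rfl
    · refine key _ (Sum.inl 0) (e1.trans ((eqv_block_even b).diag (Eqv.refl _))) ?_
      rintro (c | c)
      · rw [Subsingleton.elim c 0, if_pos rfl]; rfl
      · rw [if_neg (by simp)]; rfl
    · refine key _ (Sum.inl 1) (e1.trans ((eqv_block_odd b).diag (Eqv.refl _))) ?_
      rintro (c | c)
      · revert c
        rw [Fin.forall_fin_two, if_neg (by simp), if_pos rfl]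
        exact ⟨rfl, rfl⟩
      · rw [if_neg (by simp)]; rfl
  omega

/-- Sections in bounded twists have bounded exponents. -/
theorem sec_bound (hNM : N * M = 1) {C : ℕ} (hN : ∀ i j, InT S2 (-(C : ℤ)) (N i j)) {a δ A : ℤ}
    {c : R12} (hc : c ∈ S2) (hδ : δ ≤ 1) (ha : a ≤ A) {f : (Fin n → R12) × (Fin n → R12)}
    (hf : f ∈ sec a δ c M) (i : Fin n) : f.1 i ∈ V2 (A + C + 1) ∧ f.2 i ∈ V2 (A + C + 1) := by
  have key : ∀ (v : Fin n → R12) (m : ℤ), m ≤ A + 1 → (∀ i, M.mulVec v i ∈ V2 m) → ∀ i,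
      v i ∈ V2 (A + C + 1) := by
    intro v m hm hv i
    have h1 : N.mulVec (M.mulVec v) = v := by rw [Matrix.mulVec_mulVec, hNM, Matrix.one_mulVec]
    rw [mem_V2_iff_InT, ← h1]
    exact InT.mono2 (by omega) (InT.mulVec hN (fun j => mem_V2_iff_InT.1 (hv j)) i)
  obtain ⟨-, -, h3, h4⟩ := hf
  have h5 := key _ _ (by omega) h3
  have h6 := key _ _ (by omega) h4
  refine ⟨h5 i, ?_⟩
  have := sub_mem (h6 i) (V2_mul hc (h5 i))
  simpa using this

end bounds

/-! ### Exponents and the degree in `w` -/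

/-- The rational function `r` is regular at `c`, with value `z`. -/
def ValAt (c : ℂ) (r : RatFunc ℂ) (z : ℂ) : Prop :=
  ∃ P Q : ℂ[X], Q.eval c ≠ 0 ∧ r * algebraMap ℂ[X] (RatFunc ℂ) Q = algebraMap _ _ P ∧
    P.eval c = z * Q.eval c

theorem ValAt.add {c : ℂ} {r s : RatFunc ℂ} {y z : ℂ} (hr : ValAt c r y) (hs : ValAt c s z) :
    ValAt c (r + s) (y + z) := by
  obtain ⟨P, Q, h1, h2, h3⟩ := hr
  obtain ⟨P', Q', g1, g2, g3⟩ := hs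
  refine ⟨P * Q' + P' * Q, Q * Q', by rw [eval_mul]; exact mul_ne_zero h1 g1, ?_, ?_⟩
  · rw [map_add, map_mul, map_mul, map_mul, ← h2, ← g2]; ring
  · simp only [eval_add, eval_mul, h3, g3]; ring

theorem ValAt.mul {c : ℂ} {r s : RatFunc ℂ} {y z : ℂ} (hr : ValAt c r y) (hs : ValAt c s z) :
    ValAt c (r * s) (y * z) := by
  obtain ⟨P, Q, h1, h2, h3⟩ := hr
  obtain ⟨P', Q', g1, g2, g3⟩ := hs
  refine ⟨P * P', Q * Q', by rw [eval_mul]; exact mul_ne_zero h1 g1, ?_, ?_⟩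
  · rw [map_mul, map_mul, ← h2, ← g2]; ring
  · simp only [eval_mul, h3, g3]; ring

theorem ValAt.const (c z : ℂ) : ValAt c (RatFunc.C z) z :=
  ⟨C z, 1, by simp, by rw [map_one, mul_one, RatFunc.algebraMap_C], by simp⟩

/-- If `r` times the `m`-th power of a function that vanishes at `c` is regular and nonzero at `c`,
the denominator of `r` vanishes to order `m` at `c`. -/
theorem le_ratDegree {c z : ℂ} {r t : RatFunc ℂ} {m : ℕ} (ht : ValAt c t 0) (hz : z ≠ 0)
    (h : ValAt c (r * t ^ m) z) : m ≤ ratDegree r := by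
  obtain ⟨P, Q, h1, h2, h3⟩ := ht
  obtain ⟨P', Q', g1, g2, g3⟩ := h
  rw [zero_mul] at h3
  have hd0 : r.denom ≠ 0 := RatFunc.denom_ne_zero r
  have hr : r * algebraMap ℂ[X] (RatFunc ℂ) r.denom = algebraMap _ _ r.num :=
    ((div_eq_iff (RatFunc.algebraMap_ne_zero hd0)).1 (RatFunc.num_div_denom r)).symm
  have e : r.num * P ^ m * Q' = P' * Q ^ m * r.denom := by
    apply RatFunc.algebraMap_injective ℂ
    simp only [map_mul, map_pow]
    rw [← hr, ← h2, ← g2]; ring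
  have hdvd : (X - C c) ^ m ∣ P' * Q ^ m * r.denom := by
    rw [← e]
    exact ((pow_dvd_pow_of_dvd (dvd_iff_isRoot.2 h3) m).mul_left _).mul_right _
  have hcop : ∀ {p : ℂ[X]}, p.eval c ≠ 0 → IsCoprime (X - C c) p := fun hp =>
    (irreducible_X_sub_C c).coprime_iff_not_dvd.2 fun hd => hp (dvd_iff_isRoot.1 hd)
  have hc : IsCoprime ((X - C c) ^ m) (P' * Q ^ m) := by
    apply IsCoprime.pow_left
    apply hcop
    rw [eval_mul, eval_pow, g3]
    exact mul_ne_zero (mul_ne_zero hz g1) (pow_ne_zero _ h1)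
  have h5 := natDegree_le_of_dvd (hc.dvd_of_dvd_mul_left hdvd) hd0
  rw [natDegree_pow, natDegree_X_sub_C, mul_one] at h5
  exact h5.trans (le_max_right _ _)

/-- A regular function on a chart that does not vanish at the closed point `T = 0` takes a nonzero
value at a parameter that is mapped to this point. -/
theorem valAt_hom {ψ : R2 →+* RatFunc ℂ}
    (hC : ∀ r : ℝ, ψ (AdjoinRoot.of _ (C r)) = RatFunc.C (r : ℂ)) {c z : ℂ}
    (hX : ValAt c (ψ (AdjoinRoot.of _ X)) 0) (hz : ValAt c (ψ (AdjoinRoot.root _)) z)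
    (hzI : z = Complex.I ∨ z = -Complex.I) {h : R2} (hh : evR2 h ≠ 0) :
    ∃ u, u ≠ 0 ∧ ValAt c (ψ h) u := by
  have hpoly : ∀ a : ℝ[X], ValAt c (ψ (AdjoinRoot.of _ a)) ((a.eval 0 : ℝ) : ℂ) := by
    intro a
    induction a using Polynomial.induction_on with
    | C r => rw [hC, eval_C]; exact ValAt.const _ _
    | add p q hp hq =>
      rw [map_add, map_add, eval_add, Complex.ofReal_add]; exact hp.add hq
    | monomial n r ih =>
      have e : (C r * X ^ (n + 1) : ℝ[X]) = C r * X ^ n * X := by rw [pow_succ, mul_assoc]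
      rw [e, map_mul, map_mul, eval_mul, eval_X, Complex.ofReal_mul, Complex.ofReal_zero]
      exact ih.mul hX
  obtain ⟨a, b, rfl⟩ := exists_of_add_of_mul_root _ h
  refine ⟨(a.eval 0 : ℝ) + (b.eval 0 : ℝ) * z, fun h0 => hh ?_, ?_⟩
  · have h1 : a.eval 0 = 0 := by
      have := congrArg Complex.re h0
      rcases hzI with rfl | rfl <;> simpa using this
    have h2 : b.eval 0 = 0 := by
      have := congrArg Complex.im h0
      rcases hzI with rfl | rfl <;> simpa using this
    rw [map_add, map_mul]
    simp only [evR2, AdjoinRoot.lift_of, AdjoinRoot.lift_root, coe_eval₂RingHom]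
    rw [← Complex.ofReal_zero]
    change aeval (algebraMap ℝ ℂ 0) a + aeval (algebraMap ℝ ℂ 0) b * _ = algebraMap ℝ ℂ 0
    rw [aeval_algebraMap_apply, aeval_algebraMap_apply, coe_aeval_eq_eval, h1, h2]
    simp
  · rw [map_add, map_mul]
    exact (hpoly a).add ((hpoly b).mul hz)

theorem phiInv_tp_one : phiInv (tp 1) = phiZY := by
  rw [← lau_T]
  change AdjoinRoot.lift _ _ _ (AdjoinRoot.of _ _) = _
  rw [AdjoinRoot.lift_of, LaurentPolynomial.eval₂_T]
  simp

theorem phiInv_xy : phiInv xy = phiXY := AdjoinRoot.lift_root _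

theorem phiInv_algebraMap (r : ℝ) : phiInv (algebraMap ℝ R12 r) = RatFunc.C (r : ℂ) := by
  rw [← lau_C]
  change AdjoinRoot.lift _ _ _ (AdjoinRoot.of _ _) = _
  rw [AdjoinRoot.lift_of, LaurentPolynomial.eval₂_C]
  rfl

theorem phiInv_tp_neg_one : phiInv (tp (-1)) = phiZY⁻¹ := by
  rw [← phiInv_tp_one]
  apply eq_inv_of_mul_eq_one_left
  rw [← map_mul, tp_neg_mul, map_one]

theorem phiInv_tp_pow (k : ℤ) (m : ℕ) : phiInv (tp (m * k)) = phiInv (tp k) ^ m := by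
  rw [← map_pow]
  congr 1
  induction m with
  | zero => simp [tp_zero]
  | succ m ih => rw [pow_succ, ← ih, ← tp_add]; congr 1; push_cast; ring

theorem w_identities : (algebraMap ℂ[X] (RatFunc ℂ) (X ^ 2 - C 2 * X) = RatFunc.X ^ 2 - 2 * RatFunc.X)
    ∧ (algebraMap ℂ[X] (RatFunc ℂ) (C 2 * (X - 1)) = 2 * (RatFunc.X - 1)) ∧
    (algebraMap ℂ[X] (RatFunc ℂ) (X ^ 2 - C 2 * X + C 2) = RatFunc.X ^ 2 - 2 * RatFunc.X + 2) := by
  simp [map_ofNat]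

theorem valAt_zy : ValAt 0 (phiInv (tp 1)) 0 := by
  obtain ⟨e1, e2, -⟩ := w_identities
  refine ⟨-(X ^ 2 - C 2 * X), C 2 * (X - 1), by simp, ?_, by simp⟩
  rw [phiInv_tp_one, phiZY, e2, map_neg, e1, neg_mul,
    div_mul_cancel₀ _ (mul_ne_zero two_ne_zero w_sub_one_ne_zero)]

theorem valAt_xy : ValAt 0 (phiInv xy) (-Complex.I) := by
  obtain ⟨-, e2, e3⟩ := w_identities
  refine ⟨C Complex.I * (X ^ 2 - C 2 * X + C 2), C 2 * (X - 1), by simp, ?_, by simp⟩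
  rw [phiInv_xy, phiXY, e2, map_mul, e3, RatFunc.algebraMap_C,
    div_mul_cancel₀ _ (mul_ne_zero two_ne_zero w_sub_one_ne_zero)]

theorem valAt_yz : ValAt 1 (phiInv (tp (-1))) 0 := by
  obtain ⟨e1, e2, -⟩ := w_identities
  refine ⟨-(C 2 * (X - 1)), X ^ 2 - C 2 * X, by norm_num, ?_, by simp⟩
  rw [phiInv_tp_neg_one, phiZY, e1, map_neg, e2]
  have h1 := RatFunc.X_ne_zero (K := ℂ)
  have h3 := w_sub_two_ne_zero
  have h2 := w_sub_one_ne_zero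
  field_simp

theorem valAt_xz : ValAt 1 (phiInv xz) Complex.I := by
  obtain ⟨e1, -, e3⟩ := w_identities
  refine ⟨-(C Complex.I * (X ^ 2 - C 2 * X + C 2)), X ^ 2 - C 2 * X, by norm_num, ?_, ?_⟩
  · rw [xz_eq, map_mul, phiInv_tp_neg_one, phiInv_xy, phiZY, phiXY, e1, map_neg, map_mul, e3,
      RatFunc.algebraMap_C]
    have h1 := RatFunc.X_ne_zero (K := ℂ)
    have h3 := w_sub_two_ne_zero
    have h2 := w_sub_one_ne_zero
    field_simp
  · simp only [eval_neg, eval_mul, eval_add, eval_sub, eval_pow, eval_X, eval_C]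
    ring

/-- An exponent `k < 0` in `f` gives a pole at `w = 0`, where `z/y` vanishes, and an exponent `k > 0` one
at `w = 1`, where `y/z` vanishes. -/
theorem natAbs_le_ratDegree {f : R12} {e : Fin 2} {k : ℤ} (h : cf f e k ≠ 0) :
    k.natAbs ≤ ratDegree (phiInv f) := by
  rcases le_or_gt 0 k with hk | hk
  · have hf : swap f ≠ 0 := by
      intro h0
      apply h
      rw [← swap_swap f, h0, map_zero, cf_zero]
    obtain ⟨p, g, hp, hg, hge⟩ := exists_ord hf
    have hkp : k ≤ -p := by
      rw [mem_S2] at hg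
      by_contra hlt
      apply h
      rw [← swap_swap f]
      fin_cases e
      · change cf (swap (swap f)) 0 k = 0
        rw [cf_swap_zero, hp, cf_tp_mul, hg _ _ (by omega)]
      · change cf (swap (swap f)) 1 k = 0
        rw [cf_swap_one, hp, cf_tp_mul, hg _ _ (by omega)]
    rcases le_or_gt 0 p with hp0 | hp0
    · omega
    obtain ⟨g, rfl⟩ := hg
    rw [ev_res2] at hge
    obtain ⟨u, hu, hv⟩ := valAt_hom (ψ := phiInv.comp res1) (c := 1)
      (by
        intro r
        rw [RingHom.comp_apply, ← phiInv_algebraMap, ← swap_res2, res2_of,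
          Polynomial.toLaurent_C, lau_C, swap_algebraMap])
      (by
        rw [RingHom.comp_apply, ← swap_res2, res2_of, Polynomial.toLaurent_X, lau_T, swap_tp]
        exact valAt_yz)
      (by
        rw [RingHom.comp_apply, ← swap_res2, res2_root, swap_xy]
        exact valAt_xz) (Or.inl rfl) hge
    have hm : phiInv f * phiInv (tp (-1)) ^ (-p).toNat = (phiInv.comp res1) g := by
      rw [← phiInv_tp_pow, ← map_mul, RingHom.comp_apply, ← swap_res2]
      congr 1
      rw [← swap_swap f, hp, map_mul, swap_tp, mul_right_comm, ← tp_add,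
        show -p + ((-p).toNat : ℤ) * -1 = 0 by omega, tp_zero, one_mul]
    have := le_ratDegree valAt_yz hu (hm ▸ hv)
    omega
  · have hf : f ≠ 0 := by
      rintro rfl
      exact h (cf_zero _ _)
    obtain ⟨p, g, hp, hg, hge⟩ := exists_ord hf
    have hkp : p ≤ k := by
      rw [mem_S2] at hg
      by_contra hlt
      apply h
      rw [hp, cf_tp_mul, hg _ _ (by omega)]
    obtain ⟨g, rfl⟩ := hg
    rw [ev_res2] at hge
    obtain ⟨u, hu, hv⟩ := valAt_hom (ψ := phiInv.comp res2) (c := 0)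
      (by
        intro r
        rw [RingHom.comp_apply, ← phiInv_algebraMap, res2_of, Polynomial.toLaurent_C, lau_C])
      (by
        rw [RingHom.comp_apply, res2_of, Polynomial.toLaurent_X, lau_T]
        exact valAt_zy)
      (by
        rw [RingHom.comp_apply, res2_root]
        exact valAt_xy) (Or.inr rfl) hge
    have hm : phiInv f * phiInv (tp 1) ^ (-p).toNat = (phiInv.comp res2) g := by
      rw [← phiInv_tp_pow, ← map_mul, RingHom.comp_apply]
      congr 1
      rw [hp, mul_right_comm, ← tp_add, show p + ((-p).toNat : ℤ) * 1 = 0 by omega, tp_zero,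
        one_mul]
    have := le_ratDegree valAt_zy hu (hm ▸ hv)
    omega

/-- The exponents of the entries are bounded by the degree: a power of `y/z` or of `z/y` in an
entry gives a pole of at least this order at `w = 0` or at `w = 1`. -/
theorem width_le_dw {n : ℕ} (M : Matrix (Fin n) (Fin n) R12) : width M ≤ dw (M.map phiInv) := by
  refine width_le fun i j e k h => (natAbs_le_ratDegree h).trans ?_
  refine le_trans ?_ (Finset.le_sup (f := fun i => Finset.univ.sup fun j =>
    ratDegree (M.map phiInv i j)) (Finset.mem_univ i))
  exact Finset.le_sup (f := fun j => ratDegree (M.map phiInv i j)) (Finset.mem_univ j)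

end Conic

namespace AlgRAM

variable {K : Type}

/-! ### Loops and invariants -/

/-- The variables that an integer expression reads. -/
def IExpr.vars : IExpr → List ℕ
  | .const _ => []
  | .var v => [v]
  | .add a b => a.vars ++ b.vars
  | .sub a b => a.vars ++ b.vars

/-- The integer variables that a program may write. -/
def Prog.ints : Prog → List ℕ
  | .skip => []
  | .setInt v _ => [v]
  | .setField _ _ _ => []
  | .seq p q => p.ints ++ q.ints
  | .ite _ p q => p.ints ++ q.ints
  | .while _ p => p.ints

/-- The arrays that a program may write. -/
def Prog.arrs : Prog → List ℕ
  | .skip => []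
  | .setInt _ _ => []
  | .setField a _ _ => [a]
  | .seq p q => p.arrs ++ q.arrs
  | .ite _ p q => p.arrs ++ q.arrs
  | .while _ p => p.arrs

/-- The states `σ` and `τ` differ at most in the integer variables `V` and the arrays `W`. -/
structure Agree (V W : List ℕ) (σ τ : State K) : Prop where
  int : ∀ v ∉ V, τ.int v = σ.int v
  mem : ∀ a ∉ W, τ.mem a = σ.mem a

theorem Agree.refl (V W : List ℕ) (σ : State K) : Agree V W σ σ := ⟨fun _ _ => rfl, fun _ _ => rfl⟩

theorem Agree.trans {V W : List ℕ} {σ τ ρ : State K} (h : Agree V W σ τ) (g : Agree V W τ ρ) :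
    Agree V W σ ρ :=
  ⟨fun v hv => (g.int v hv).trans (h.int v hv), fun a ha => (g.mem a ha).trans (h.mem a ha)⟩

theorem Agree.mono {V W V' W' : List ℕ} {σ τ : State K} (h : Agree V W σ τ) (hV : V ⊆ V')
    (hW : W ⊆ W') : Agree V' W' σ τ :=
  ⟨fun v hv => h.int v fun h' => hv (hV h'), fun a ha => h.mem a fun h' => ha (hW h')⟩

theorem Agree.setInt (σ : State K) (v : ℕ) (c : ℤ) : Agree [v] [] σ (σ.setInt v c) :=
  ⟨fun u hu => Function.update_of_ne (by simpa using hu) _ _, fun _ _ => rfl⟩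

theorem Agree.setMem (σ : State K) (a : ℕ) (idx : List ℤ) (c : K) :
    Agree [] [a] σ (σ.setMem a idx c) :=
  ⟨fun _ _ => rfl, fun u hu => Function.update_of_ne (by simpa using hu) _ _⟩

theorem IExpr.eval_congr {σ τ : State K} (a : IExpr) (h : ∀ v ∈ a.vars, τ.int v = σ.int v) :
    a.eval τ = a.eval σ := by
  induction a with
  | const c => rfl
  | var v => exact h v (by simp [IExpr.vars])
  | add a b iha ihb =>
    simp only [IExpr.vars, List.mem_append] at h
    simp only [IExpr.eval, iha fun v hv => h v (Or.inl hv), ihb fun v hv => h v (Or.inr hv)]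
  | sub a b iha ihb =>
    simp only [IExpr.vars, List.mem_append] at h
    simp only [IExpr.eval, iha fun v hv => h v (Or.inl hv), ihb fun v hv => h v (Or.inr hv)]

/-- In the state `σ`, the bounds of the loops have the values `bs`; there are at most `B` steps. -/
def Bounds (σ : State K) (B : ℕ) (L : List (ℕ × IExpr × IExpr)) (bs : List (ℤ × ℤ)) : Prop :=
  List.Forall₂ (fun (x : ℕ × IExpr × IExpr) (b : ℤ × ℤ) => x.2.1.eval σ = b.1 ∧ x.2.2.eval σ = b.2 ∧ b.1 ≤ b.2 ∧ b.2 - b.1 ≤ B) L bs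

theorem Bounds.congr {σ τ : State K} {B : ℕ} {L : List (ℕ × IExpr × IExpr)} {bs : List (ℤ × ℤ)}
    (h : Bounds σ B L bs)
    (hag : ∀ v ∈ L.flatMap fun x => x.2.1.vars ++ x.2.2.vars, τ.int v = σ.int v) :
    Bounds τ B L bs := by
  induction h with
  | nil => exact .nil
  | cons hx _ ih =>
    rw [List.flatMap_cons] at hag
    refine .cons ⟨?_, ?_, hx.2.2⟩ (ih fun v hv => hag v (by simp only [List.mem_append]; tauto))
    · rw [← hx.1]
      exact IExpr.eval_congr _ fun v hv => hag v (by simp only [List.mem_append]; tauto)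
    · rw [← hx.2.1]
      exact IExpr.eval_congr _ fun v hv => hag v (by simp only [List.mem_append]; tauto)

section
variable [Field K]

/-- Started in `σ`, the program `P` halts in `τ`, at cost at most `c`. -/
def Runs (P : Prog) (σ τ : State K) (c : ℕ) : Prop := ∃ s ≤ c, Run P σ s τ

theorem Run.agree {P : Prog} {σ τ : State K} {s : ℕ} (h : Run P σ s τ) :
    Agree P.ints P.arrs σ τ := by
  induction h with
  | skip σ => exact Agree.refl _ _ _
  | setInt v a σ => exact Agree.setInt _ _ _
  | setField a idx x σ => exact Agree.setMem _ _ _ _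
  | seq _ _ h1 h2 =>
    exact (h1.mono (List.subset_append_left _ _) (List.subset_append_left _ _)).trans
      (h2.mono (List.subset_append_right _ _) (List.subset_append_right _ _))
  | ite_true _ _ h => exact h.mono (List.subset_append_left _ _) (List.subset_append_left _ _)
  | ite_false _ _ h => exact h.mono (List.subset_append_right _ _) (List.subset_append_right _ _)
  | while_true _ _ _ h1 h2 => exact h1.trans h2
  | while_false _ => exact Agree.refl _ _ _

theorem Runs.agree {P : Prog} {σ τ : State K} {c : ℕ} (h : Runs P σ τ c) :
    Agree P.ints P.arrs σ τ := h.choose_spec.2.agree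

theorem Runs.mono {P : Prog} {σ τ : State K} {c d : ℕ} (h : Runs P σ τ c) (hcd : c ≤ d) :
    Runs P σ τ d := by
  obtain ⟨s, hs, hr⟩ := h
  exact ⟨s, hs.trans hcd, hr⟩

theorem Runs.seq {P Q : Prog} {σ τ ρ : State K} {c d : ℕ} (h : Runs P σ τ c) (g : Runs Q τ ρ d) :
    Runs (.seq P Q) σ ρ (c + d) := by
  obtain ⟨s, hs, hr⟩ := h
  obtain ⟨t, ht, hq⟩ := g
  exact ⟨s + t, by omega, .seq hr hq⟩

theorem Runs.setInt (v : ℕ) (a : IExpr) (σ : State K) :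
    Runs (.setInt v a) σ (σ.setInt v (a.eval σ)) (a.cost + 1) := ⟨_, le_rfl, .setInt v a σ⟩

theorem Runs.setField (a : ℕ) (idx : List IExpr) (x : FExpr) (σ : State K) :
    Runs (.setField a idx x) σ (σ.setMem a (idx.map (IExpr.eval σ)) (x.eval σ))
      ((idx.map IExpr.cost).sum + x.cost + 1) := ⟨_, le_rfl, .setField a idx x σ⟩

theorem Runs.ite_true {b : Test} {P Q : Prog} {σ τ : State K} {c : ℕ} (hb : b.eval σ)
    (h : Runs P σ τ c) : Runs (.ite b P Q) σ τ (b.cost + 1 + c) := by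
  obtain ⟨s, hs, hr⟩ := h
  exact ⟨_, by omega, .ite_true hb hr⟩

theorem Runs.ite_false {b : Test} {P Q : Prog} {σ τ : State K} {c : ℕ} (hb : ¬ b.eval σ)
    (h : Runs Q σ τ c) : Runs (.ite b P Q) σ τ (b.cost + 1 + c) := by
  obtain ⟨s, hs, hr⟩ := h
  exact ⟨_, by omega, .ite_false hb hr⟩

/-- `for v = lo, …, hi - 1 do P`. -/
def forLoop (v : ℕ) (lo hi : IExpr) (P : Prog) : Prog :=
  .seq (.setInt v lo)
    (.while (.le (.add (.var v) (.const 1)) hi) (.seq P (.setInt v (.add (.var v) (.const 1)))))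

/-- Invariant rule for loops: if `I i` is preserved by the `i`-th step, of cost at most `c`, and does not
depend on the loop variable, it holds with `i = h` at the end. A step may use that the state differs
from the initial one only in what the loop writes. -/
theorem forLoop_rule {v : ℕ} {lo hi : IExpr} {P : Prog} {l h : ℤ} {σ₀ : State K} {c B : ℕ}
    (I : ℤ → State K → Prop) (hl : lo.eval σ₀ = l) (hh : hi.eval σ₀ = h) (hlh : l ≤ h)
    (hB : h - l ≤ B) (hv : v ∉ P.ints) (hd : ∀ u ∈ hi.vars, u ≠ v ∧ u ∉ P.ints)
    (hI : ∀ i σ x, I i σ → I i (σ.setInt v x)) (h0 : I l σ₀)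
    (step : ∀ i σ, l ≤ i → i < h → Agree (v :: P.ints) P.arrs σ₀ σ → σ.int v = i → I i σ →
      ∃ τ, Runs P σ τ c ∧ I (i + 1) τ) :
    ∃ τ, Runs (forLoop v lo hi P) σ₀ τ (lo.cost + hi.cost + 10 + B * (c + hi.cost + 10)) ∧
      I h τ := by
  have key : ∀ (m : ℕ) (i : ℤ) (σ : State K), h - i = m → l ≤ i →
      Agree (v :: P.ints) P.arrs σ₀ σ → σ.int v = i → I i σ →
      ∃ τ, Runs (.while (.le (.add (.var v) (.const 1)) hi)
        (.seq P (.setInt v (.add (.var v) (.const 1))))) σ τ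
          (hi.cost + 5 + m * (c + hi.cost + 10)) ∧ I h τ := by
    intro m
    induction m with
    | zero =>
      intro i σ hm hi' hag hvi hIi
      have e : hi.eval σ = h := by
        rw [← hh]
        exact hi.eval_congr fun u hu => hag.int u (by simp [hd u hu])
      refine ⟨σ, ⟨_, ?_, .while_false ?_⟩, ?_⟩
      · simp only [Test.cost, IExpr.cost]; omega
      · simp only [Test.eval, IExpr.eval, e, hvi]; omega
      · have : i = h := by omega
        exact this ▸ hIi
    | succ m ih =>
      intro i σ hm hi' hag hvi hIi
      have e : hi.eval σ = h := by
        rw [← hh]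
        exact hi.eval_congr fun u hu => hag.int u (by simp [hd u hu])
      obtain ⟨τ, ⟨s, hs, hr⟩, hIτ⟩ := step i σ hi' (by omega) hag hvi hIi
      have hag2 := hr.agree
      have hvτ : τ.int v = i := by rw [hag2.int v hv, hvi]
      obtain ⟨ρ, ⟨t, ht, hr2⟩, hIρ⟩ := ih (i + 1) (τ.setInt v (i + 1)) (by omega) (by omega)
        ((hag.trans (hag2.mono (List.subset_cons_self _ _) (List.Subset.refl _))).trans
          ((Agree.setInt τ v (i + 1)).mono (by simp) (by simp)))
        (Function.update_self _ _ _) (hI _ _ _ hIτ)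
      have hset : Run (.setInt v (.add (.var v) (.const 1))) τ 4 (τ.setInt v (i + 1)) := by
        have := Run.setInt v (.add (.var v) (.const 1)) τ
        simp only [IExpr.eval, hvτ] at this
        exact this
      refine ⟨ρ, ⟨_, ?_, .while_true ?_ (.seq hr hset) hr2⟩, hIρ⟩
      · simp only [Test.cost, IExpr.cost]
        rw [Nat.succ_mul]; omega
      · simp only [Test.eval, IExpr.eval, e, hvi]; omega
  obtain ⟨τ, ⟨s, hs, hr⟩, hIτ⟩ := key (h - l).toNat l (σ₀.setInt v l) (by omega) le_rfl
    ((Agree.setInt σ₀ v l).mono (by simp) (by simp)) (Function.update_self _ _ _) (hI _ _ _ h0)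
  refine ⟨τ, ⟨_, ?_, .seq (.setInt v lo σ₀) (hl.symm ▸ hr)⟩, hIτ⟩
  have : (h - l).toNat * (c + hi.cost + 10) ≤ B * (c + hi.cost + 10) :=
    Nat.mul_le_mul_right _ (by omega)
  omega

/-- Nested loops, for a list of triples (variable, lower bound, upper bound). -/
def nest : List (ℕ × IExpr × IExpr) → Prog → Prog
  | [], P => P
  | x :: L, P => forLoop x.1 x.2.1 x.2.2 (nest L P)

/-- The tuples of integers in a product of half-open intervals. -/
def box : List (ℤ × ℤ) → Finset (List ℤ)
  | [] => {[]}
  | b :: bs => (Finset.Ico b.1 b.2 ×ˢ box bs).image fun x => x.1 :: x.2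

theorem nil_mem_box : [] ∈ box [] := by simp [box]

theorem cons_mem_box {b : ℤ × ℤ} {bs : List (ℤ × ℤ)} {i : ℤ} {t : List ℤ} :
    i :: t ∈ box (b :: bs) ↔ (b.1 ≤ i ∧ i < b.2) ∧ t ∈ box bs := by
  simp [box]

theorem mem_box_cons {b : ℤ × ℤ} {bs : List (ℤ × ℤ)} {t : List ℤ} :
    t ∈ box (b :: bs) ↔ ∃ i s, t = i :: s ∧ (b.1 ≤ i ∧ i < b.2) ∧ s ∈ box bs := by
  constructor
  · intro h
    have : ∃ i s, t = i :: s := by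
      simp only [box, Finset.mem_image] at h
      obtain ⟨x, -, rfl⟩ := h
      exact ⟨_, _, rfl⟩
    obtain ⟨i, s, rfl⟩ := this
    exact ⟨i, s, rfl, cons_mem_box.1 h⟩
  · rintro ⟨i, s, rfl, h⟩
    exact cons_mem_box.2 h

/-- The list of the loop variables. -/
abbrev loopVars (L : List (ℕ × IExpr × IExpr)) : List ℕ := L.map Prod.fst

theorem nest_ints (L : List (ℕ × IExpr × IExpr)) (P : Prog) :
    ∀ v, v ∈ (nest L P).ints ↔ v ∈ loopVars L ++ P.ints := by
  intro v
  induction L with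
  | nil => simp [nest]
  | cons x L ih =>
    simp only [nest, forLoop, Prog.ints, List.mem_append, List.mem_cons] at ih ⊢
    rw [ih]
    simp only [loopVars, List.map_cons, List.mem_cons, List.not_mem_nil, or_false]
    tauto

theorem nest_arrs (L : List (ℕ × IExpr × IExpr)) (P : Prog) : (nest L P).arrs = P.arrs := by
  induction L with
  | nil => rfl
  | cons x L ih => simp [nest, forLoop, Prog.arrs, ih]

/-- The loop variables are distinct, the program `P` does not write them, and the bounds do not
depend on anything which is written. -/
def NestOK (L : List (ℕ × IExpr × IExpr)) (V : List ℕ) : Prop :=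
  (∀ v ∈ loopVars L ++ V, v ∉ L.flatMap fun x => x.2.1.vars ++ x.2.2.vars) ∧ (loopVars L).Nodup ∧
    ∀ v ∈ loopVars L, v ∉ V

instance (L : List (ℕ × IExpr × IExpr)) (V : List ℕ) : Decidable (NestOK L V) := by
  unfold NestOK; infer_instance

/-- A bound for the cost of nested loops with at most `X` steps each, if `p` bounds the cost of the
body. -/
def nestCost : List (ℕ × IExpr × IExpr) → ℕ[X] → ℕ[X]
  | [], p => p
  | x :: L, p => C (x.2.1.cost + x.2.2.cost + 10) + X * (nestCost L p + C (x.2.2.cost + 10))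

/-- The invariant `I D` refers to the set `D` of the tuples which have been treated. -/
theorem nest_rule {P : Prog} {p : ℕ[X]} {B : ℕ} {L : List (ℕ × IExpr × IExpr)}
    {bs : List (ℤ × ℤ)} {σ₀ : State K} (hok : NestOK L P.ints) (hbs : Bounds σ₀ B L bs)
    (I : Finset (List ℤ) → State K → Prop)
    (hI : ∀ D σ, ∀ v ∈ loopVars L, ∀ x, I D σ → I D (σ.setInt v x)) (h0 : I ∅ σ₀)
    (step : ∀ D σ t, t ∈ box bs → t ∉ D → Agree (loopVars L ++ P.ints) P.arrs σ₀ σ →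
      (loopVars L).map σ.int = t → I D σ → ∃ τ, Runs P σ τ (p.eval B) ∧ I (insert t D) τ) :
    ∃ τ, Runs (nest L P) σ₀ τ ((nestCost L p).eval B) ∧ I (box bs) τ := by
  induction L generalizing bs σ₀ I with
  | nil =>
    cases hbs
    obtain ⟨τ, h1, h2⟩ := step ∅ σ₀ [] nil_mem_box (by simp) (Agree.refl _ _ _) rfl h0
    exact ⟨τ, h1, by simpa [box] using h2⟩
  | cons x L ih =>
    cases hbs with
    | cons hx hL =>
    rename_i b bs
    obtain ⟨ok1, ok2, ok3⟩ := hok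
    replace ok1 : ∀ {v}, _ → _ := @ok1
    replace ok3 : ∀ {v}, _ → _ := @ok3
    simp only [loopVars, List.map_cons, List.nodup_cons, List.mem_cons, List.mem_append,
      List.flatMap_cons] at ok1 ok2 ok3
    have hvs : x.1 ∉ (nest L P).ints := by
      rw [nest_ints, List.mem_append, not_or]
      exact ⟨ok2.1, ok3 (Or.inl rfl)⟩
    let done : ℤ → Finset (List ℤ) := fun i => box ((b.1, i) :: bs)
    obtain ⟨τ, hτ, hIτ⟩ := forLoop_rule (v := x.1) (lo := x.2.1) (hi := x.2.2) (P := nest L P)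
      (B := B) (c := (nestCost L p).eval B) (fun i σ => I (done i) σ) hx.1 hx.2.1 hx.2.2.1
      hx.2.2.2 hvs
      (by
        intro u hu
        constructor
        · rintro rfl
          exact ok1 (Or.inl (Or.inl rfl)) (Or.inl (Or.inr hu))
        · rw [nest_ints, List.mem_append]
          rintro (h | h)
          · exact ok1 (Or.inl (Or.inr h)) (Or.inl (Or.inr hu))
          · exact ok1 (Or.inr h) (Or.inl (Or.inr hu)))
      (fun i σ y h => hI _ _ _ (by simp) _ h)
      (by
        have : done b.1 = ∅ := by
          ext t
          simp only [done, mem_box_cons, Finset.notMem_empty, iff_false]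
          rintro ⟨i, s, -, h, -⟩
          omega
        rw [this]; exact h0)
      (by
        intro i σ hi1 hi2 hag hvi hIσ
        have hag' : Agree (loopVars (x :: L) ++ P.ints) P.arrs σ₀ σ := by
          rw [nest_arrs] at hag
          refine hag.mono ?_ (List.Subset.refl _)
          intro u hu
          rw [List.mem_cons, nest_ints] at hu
          simpa [loopVars] using hu
        obtain ⟨τ, hτ, hIτ⟩ := ih (bs := bs) (σ₀ := σ)
          ⟨by
            intro u hu1 hu2
            rw [List.mem_append] at hu1
            rcases hu1 with hu1 | hu1
            · exact ok1 (Or.inl (Or.inr hu1)) (Or.inr hu2)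
            · exact ok1 (Or.inr hu1) (Or.inr hu2), ok2.2,
            fun u hu => ok3 (Or.inr hu)⟩
          (Bounds.congr hL fun u hu => hag'.int u fun hu1 => by
            simp only [loopVars, List.map_cons, List.mem_append, List.mem_cons] at hu1
            exact ok1 hu1 (Or.inr hu))
          (fun D σ => I (done i ∪ D.image (i :: ·)) σ)
          (fun D σ u hu y h => hI _ _ _ (List.mem_cons_of_mem _ hu) _ h)
          (by simpa using hIσ)
          (by
            intro D σ' t ht htD hag2 hvars hI'
            have hag3 : Agree (loopVars (x :: L) ++ P.ints) P.arrs σ σ' :=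
              hag2.mono (by simp [loopVars]) (List.Subset.refl _)
            have hx1 : σ'.int x.1 = i := by
              rw [hag2.int, hvi]
              rw [List.mem_append, not_or]
              exact ⟨ok2.1, ok3 (Or.inl rfl)⟩
            obtain ⟨τ, h1, h2⟩ := step _ σ' (i :: t)
              (cons_mem_box.2 ⟨⟨hi1, hi2⟩, ht⟩)
              (by
                rw [Finset.mem_union, not_or]
                constructor
                · rw [cons_mem_box]; rintro ⟨⟨-, h⟩, -⟩; exact absurd h (lt_irrefl i)
                · simpa using htD)
              (hag'.trans hag3) (by simp [loopVars, hx1, ← hvars]) hI'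
            refine ⟨τ, h1, ?_⟩
            have e : insert (i :: t) (done i ∪ D.image (i :: ·)) =
                done i ∪ (insert t D).image (i :: ·) := by
              rw [Finset.image_insert, Finset.union_insert]
            rw [← e]; exact h2)
        refine ⟨τ, hτ, ?_⟩
        have e : done i ∪ (box bs).image (i :: ·) = done (i + 1) := by
          ext t
          simp only [done, Finset.mem_union, Finset.mem_image, mem_box_cons]
          constructor
          · rintro (⟨j, s, rfl, h1, h2⟩ | ⟨s, h, rfl⟩)
            · exact ⟨j, s, rfl, by omega, h2⟩
            · exact ⟨i, s, rfl, by omega, h⟩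
          · rintro ⟨j, s, rfl, h1, h2⟩
            rcases eq_or_ne j i with rfl | hj
            · exact Or.inr ⟨s, h2, rfl⟩
            · exact Or.inl ⟨j, s, rfl, by omega, h2⟩
        rw [← e]; exact hIτ)
    refine ⟨τ, ?_, hIτ⟩
    simp only [nest, nestCost, eval_add, eval_mul, eval_C, eval_X]
    exact hτ.mono (by rw [add_assoc ((nestCost L p).eval B)])

/-- Nested loops which assign to each cell of a box a value that does not depend on the other
cells of the same array. -/
theorem nest_assign {a : ℕ} {x : FExpr} {B : ℕ} {L : List (ℕ × IExpr × IExpr)}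
    {bs : List (ℤ × ℤ)} {σ₀ : State K} (hok : NestOK L []) (hbs : Bounds σ₀ B L bs)
    (val : List ℤ → K)
    (hx : ∀ σ t, t ∈ box bs → Agree (loopVars L) [a] σ₀ σ → (loopVars L).map σ.int = t →
      σ.mem a t = σ₀.mem a t → x.eval σ = val t) :
    ∃ τ, Runs (nest L (.setField a ((loopVars L).map .var) x)) σ₀ τ
        ((nestCost L (C (L.length + x.cost + 1))).eval B) ∧
      τ.mem a = fun t => if t ∈ box bs then val t else σ₀.mem a t := by
  refine nest_rule hok hbs
    (fun D σ => σ.mem a = fun t => if t ∈ D then val t else σ₀.mem a t)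
    (fun D σ v _ y h => h) (by simp) ?_
  intro D σ t ht htD hag hvars hI
  have e : x.eval σ = val t := by
    refine hx σ t ht ?_ hvars ?_
    · simpa [Prog.ints, Prog.arrs] using hag
    · rw [hI]; simp [htD]
  have hidx : (((loopVars L).map .var).map (IExpr.eval σ)) = t := by
    rw [List.map_map]; exact hvars
  have := Runs.setField a ((loopVars L).map .var) x σ
  rw [hidx, e] at this
  refine ⟨_, this.mono ?_, ?_⟩
  · have : (((loopVars L).map IExpr.var).map IExpr.cost).sum = L.length := by
      rw [List.map_map]
      simp [IExpr.cost, Function.comp_def]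
    rw [this, eval_C]
  · funext s
    change Function.update σ.mem a _ a s = _
    rw [Function.update_self, hI, Function.update_apply]
    by_cases hs : s = t
    · simp [hs]
    · simp [hs]

end

/-! ### Gaussian elimination -/

section nullity
variable [Field K] {ι κ : Type} [Fintype κ]

/-- The dimension of the kernel of a matrix. -/
def nullity (A : Matrix ι κ K) : ℕ := Module.finrank K (LinearMap.ker A.mulVecLin)

theorem nullity_zero : nullity (0 : Matrix ι κ K) = Fintype.card κ := by
  rw [nullity, Matrix.mulVecLin_zero, LinearMap.ker_zero, finrank_top, Module.finrank_fintype_fun_eq_card]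

/-- Wedderburn's rank reduction: the kernel of `A - (A e_c)(e_r A) / A_rc` is the direct sum of the
kernel of `A` and the line spanned by `e_c`. -/
theorem nullity_pivot [DecidableEq κ] (A : Matrix ι κ K) {r : ι} {c : κ} (h : A r c ≠ 0) :
    nullity (Matrix.of fun r' c' => A r' c' - A r' c * (A r c' / A r c)) = nullity A + 1 := by
  set A' : Matrix ι κ K := Matrix.of fun r' c' => A r' c' - A r' c * (A r c' / A r c) with hA'
  have hmul : ∀ v, A'.mulVec v = A.mulVec (v - Pi.single c (A.mulVec v r / A r c)) := by
    intro v
    funext i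
    rw [Matrix.mulVec_sub, Pi.sub_apply, Matrix.mulVec_single]
    simp only [Matrix.mulVec, dotProduct, hA', Matrix.of_apply, sub_mul, Finset.sum_sub_distrib,
      Pi.smul_apply, Matrix.col_apply, MulOpposite.smul_eq_mul_unop, MulOpposite.unop_op]
    congr 1
    rw [Finset.sum_div, Finset.mul_sum]
    exact Finset.sum_congr rfl fun j _ => by ring
  have hker : LinearMap.ker A'.mulVecLin = LinearMap.ker A.mulVecLin ⊔ K ∙ (Pi.single c 1 : κ → K) := by
    apply le_antisymm
    · intro v hv
      rw [LinearMap.mem_ker, Matrix.mulVecLin_apply, hmul] at hv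
      rw [Submodule.mem_sup]
      refine ⟨_, hv, Pi.single c (A.mulVec v r / A r c), ?_, sub_add_cancel _ _⟩
      rw [Submodule.mem_span_singleton]
      refine ⟨A.mulVec v r / A r c, ?_⟩
      rw [← Pi.single_smul, smul_eq_mul, mul_one]
    · rw [sup_le_iff, Submodule.span_singleton_le_iff_mem]
      constructor
      · intro v hv
        rw [LinearMap.mem_ker, Matrix.mulVecLin_apply] at hv ⊢
        rw [hmul, hv]
        simp [hv]
      · rw [LinearMap.mem_ker, Matrix.mulVecLin_apply, hmul]
        have : A.mulVec (Pi.single c 1) r / A r c = 1 := by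
          rw [Matrix.mulVec_single_one, Matrix.col_apply, div_self h]
        rw [this, sub_self, Matrix.mulVec_zero]
  have hinf : LinearMap.ker A.mulVecLin ⊓ K ∙ (Pi.single c 1 : κ → K) = ⊥ := by
    rw [eq_bot_iff]
    rintro v ⟨h1, h2⟩
    obtain ⟨x, rfl⟩ := Submodule.mem_span_singleton.1 h2
    have h3 : A.mulVec (x • Pi.single c 1) r = 0 := congrFun h1 r
    rw [Matrix.mulVec_smul, Matrix.mulVec_single_one, Pi.smul_apply, Matrix.col_apply,
      smul_eq_mul, mul_eq_zero] at h3
    rw [h3.resolve_right h, zero_smul]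
    exact Submodule.zero_mem _
  have hne : (Pi.single c 1 : κ → K) ≠ 0 := by
    intro h0
    have := congrFun h0 c
    simp at this
  have := Submodule.finrank_sup_add_finrank_inf_eq (LinearMap.ker A.mulVecLin)
    (K ∙ (Pi.single c 1 : κ → K))
  rw [hinf, finrank_bot, ← hker, finrank_span_singleton hne, add_zero] at this
  exact this

end nullity

theorem append_mem_box {bs cs : List (ℤ × ℤ)} {r c : List ℤ} (hr : r ∈ box bs) (hc : c ∈ box cs) :
    r ++ c ∈ box (bs ++ cs) := by
  induction bs generalizing r with
  | nil =>
    rw [box, Finset.mem_singleton] at hr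
    subst hr
    exact hc
  | cons b bs ih =>
    obtain ⟨i, s, rfl, h, hs⟩ := mem_box_cons.1 hr
    exact cons_mem_box.2 ⟨h, ih hs⟩

theorem length_of_mem_box {bs : List (ℤ × ℤ)} {r : List ℤ} (hr : r ∈ box bs) :
    r.length = bs.length := by
  induction bs generalizing r with
  | nil =>
    rw [box, Finset.mem_singleton] at hr
    rw [hr]; rfl
  | cons b bs ih =>
    obtain ⟨i, s, rfl, -, hs⟩ := mem_box_cons.1 hr
    simp [ih hs]

theorem Bounds.append {σ : State K} {B : ℕ} {L L' : List (ℕ × IExpr × IExpr)}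
    {bs bs' : List (ℤ × ℤ)} (h : Bounds σ B L bs) (h' : Bounds σ B L' bs') :
    Bounds σ B (L ++ L') (bs ++ bs') := by
  induction h with
  | nil => exact h'
  | cons hx _ ih => exact .cons hx ih

/-- Loops over the rows `[c, p, e, l]`, with `c, e ∈ {0, 1}`, `0 ≤ p < n` and `-L ≤ l < 0`. -/
abbrev rowLoops (v : ℕ) : List (ℕ × IExpr × IExpr) :=
  [(v, .const 0, .const 2), (v + 1, .const 0, .var 0), (v + 2, .const 0, .const 2),
    (v + 3, .sub (.const 0) (.var 5), .const 0)]

/-- Loops over the columns `[d, q, t, k]`, with `d, t ∈ {0, 1}`, `0 ≤ q < n` and `0 ≤ k < K`. -/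
abbrev colLoops (v : ℕ) : List (ℕ × IExpr × IExpr) :=
  [(v, .const 0, .const 2), (v + 1, .const 0, .var 0), (v + 2, .const 0, .const 2),
    (v + 3, .const 0, .var 4)]

/-- The range of the rows. -/
abbrev rowBox (n L : ℕ) : List (ℤ × ℤ) := [(0, 2), (0, n), (0, 2), (-L, 0)]

/-- The range of the columns. -/
abbrev colBox (n N : ℕ) : List (ℤ × ℤ) := [(0, 2), (0, n), (0, 2), (0, N)]

/-- The values of the variables on which the bounds of the loops depend: the size `n` of the input,
the range `A` of the twists, and the numbers `N` and `L` of exponents. -/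
structure Par (n A N L : ℕ) (σ : State K) : Prop where
  n : σ.int 0 = n
  A : σ.int 3 = A
  N : σ.int 4 = N
  L : σ.int 5 = L

theorem Par.congr {n A N L : ℕ} {σ τ : State K} (h : Par n A N L σ) {V W : List ℕ}
    (hag : Agree V W σ τ) (h0 : 0 ∉ V := by decide) (h3 : 3 ∉ V := by decide)
    (h4 : 4 ∉ V := by decide) (h5 : 5 ∉ V := by decide) : Par n A N L τ :=
  ⟨by rw [hag.int _ h0, h.n], by rw [hag.int _ h3, h.A], by rw [hag.int _ h4, h.N],
    by rw [hag.int _ h5, h.L]⟩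

theorem Par.rows {n A N L B : ℕ} {σ : State K} (h : Par n A N L σ) (h2 : 2 ≤ B) (hn : n ≤ B)
    (hL : L ≤ B) (v : ℕ) : Bounds σ B (rowLoops v) (rowBox n L) := by
  refine .cons ⟨rfl, rfl, by norm_num, ?_⟩ (.cons ⟨rfl, h.n, ?_, ?_⟩
    (.cons ⟨rfl, rfl, by norm_num, ?_⟩ (.cons ⟨?_, rfl, ?_, ?_⟩ .nil)))
  rotate_left 4
  · simp [IExpr.eval, h.L]
  all_goals simp only; omega

theorem Par.cols {n A N L B : ℕ} {σ : State K} (h : Par n A N L σ) (h2 : 2 ≤ B) (hn : n ≤ B)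
    (hN : N ≤ B) (v : ℕ) : Bounds σ B (colLoops v) (colBox n N) := by
  refine .cons ⟨rfl, rfl, by norm_num, ?_⟩ (.cons ⟨rfl, h.n, ?_, ?_⟩
    (.cons ⟨rfl, rfl, by norm_num, ?_⟩ (.cons ⟨rfl, h.N, ?_, ?_⟩ .nil)))
  all_goals simp only; omega

/-- The list of the `m` variables starting with `v`. -/
abbrev vars (v m : ℕ) : List IExpr := (List.range' v m).map .var

/-- Array `4` receives the pivot row, divided by the pivot. -/
def copyRow : Prog := nest (colLoops 34) (.setField 4 ((loopVars (colLoops 34)).map .var)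
  (.div (.get 2 (vars 20 4 ++ vars 34 4)) (.get 2 (vars 20 8))))

/-- Array `5` receives the pivot column. -/
def copyCol : Prog := nest (rowLoops 30) (.setField 5 ((loopVars (rowLoops 30)).map .var)
  (.get 2 (vars 30 4 ++ vars 24 4)))

/-- Subtraction of the product of the pivot column and the pivot row. -/
def update : Prog := nest (rowLoops 30 ++ colLoops 34)
  (.setField 2 ((loopVars (rowLoops 30 ++ colLoops 34)).map .var)
    (.sub (.get 2 (vars 30 8)) (.mul (.get 5 (vars 30 4)) (.get 4 (vars 34 4)))))

/-- One elimination step, with the cell in the variables `20, …, 27` as pivot. -/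
def pivot : Prog := .seq copyRow (.seq copyCol (.seq update (.setInt 7 (.add (.var 7) (.const 1)))))

/-- The elimination of the matrix in array `2`; the rank is computed in variable `7`. -/
def eliminate : Prog := .seq (.setInt 7 (.const 0)) (nest (rowLoops 20) (nest (colLoops 24)
  (.ite (.isZero (.get 2 (vars 20 8))) .skip pivot)))

/-- A bound for the cost of `pivot` in terms of a bound for the sizes of the loops. -/
def pivotCost : ℕ[X] :=
  nestCost (colLoops 34) (C ((colLoops 34).length +
    (FExpr.div (.get 2 (vars 20 4 ++ vars 34 4)) (.get 2 (vars 20 8))).cost + 1)) +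
  (nestCost (rowLoops 30) (C ((rowLoops 30).length +
    (FExpr.get 2 (vars 30 4 ++ vars 24 4)).cost + 1)) +
  (nestCost (rowLoops 30 ++ colLoops 34) (C ((rowLoops 30 ++ colLoops 34).length +
    (FExpr.sub (.get 2 (vars 30 8)) (.mul (.get 5 (vars 30 4)) (.get 4 (vars 34 4)))).cost + 1)) +
  C 4))

/-- A bound for the cost of `eliminate`. -/
def eliminateCost : ℕ[X] :=
  C 2 + nestCost (rowLoops 20) (nestCost (colLoops 24)
    (C ((Test.isZero (.get 2 (vars 20 8))).cost + 2) + pivotCost))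

variable [Field K]

/-- One step replaces the matrix `A` by `A - (A e_c)(e_r A) / A_rc`. -/
theorem pivot_spec {n A N L B : ℕ} {σ : State K} (h : Par n A N L σ) (h2 : 2 ≤ B) (hn : n ≤ B)
    (hN : N ≤ B) (hL : L ≤ B) {r c : List ℤ} (hr : [20, 21, 22, 23].map σ.int = r)
    (hc : [24, 25, 26, 27].map σ.int = c) :
    ∃ τ, Runs pivot σ τ (pivotCost.eval B) ∧ τ.int 7 = σ.int 7 + 1 ∧
      ∀ r' ∈ box (rowBox n L), ∀ c' ∈ box (colBox n N), τ.mem 2 (r' ++ c') =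
        σ.mem 2 (r' ++ c') - σ.mem 2 (r' ++ c) * (σ.mem 2 (r ++ c') / σ.mem 2 (r ++ c)) := by
  have hrc : (vars 20 8).map (IExpr.eval σ) = r ++ c := by rw [← hr, ← hc]; rfl
  obtain ⟨σ₁, run₁, m₁⟩ := nest_assign (L := colLoops 34) (a := 4)
    (x := .div (.get 2 (vars 20 4 ++ vars 34 4)) (.get 2 (vars 20 8))) (by decide)
    (h.cols h2 hn hN 34) (fun c' => σ.mem 2 (r ++ c') / σ.mem 2 (r ++ c)) (by
      intro ρ t _ hag hvars _
      have e1 : (vars 20 4 ++ vars 34 4).map (IExpr.eval ρ) = r ++ t := by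
        rw [← hvars, ← hr]
        simp [List.range', IExpr.eval, hag.int]
      have e2 : (vars 20 8).map (IExpr.eval ρ) = r ++ c := by
        rw [← hr, ← hc]
        simp [List.range', IExpr.eval, hag.int]
      simp only [FExpr.eval, e1, e2, hag.mem 2 (by decide)])
  have ag₁ : Agree [34, 35, 36, 37] [4] σ σ₁ := run₁.agree.mono (by decide) (by decide)
  have h₁ : Par n A N L σ₁ := h.congr ag₁
  obtain ⟨σ₂, run₂, m₂⟩ := nest_assign (L := rowLoops 30) (a := 5)
    (x := .get 2 (vars 30 4 ++ vars 24 4)) (by decide)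
    (h₁.rows h2 hn hL 30) (fun r' => σ₁.mem 2 (r' ++ c)) (by
      intro ρ t _ hag hvars _
      have e1 : (vars 30 4 ++ vars 24 4).map (IExpr.eval ρ) = t ++ c := by
        rw [← hvars, ← hc]
        simp [List.range', IExpr.eval, hag.int, ag₁.int]
      simp only [FExpr.eval, e1, hag.mem 2 (by decide)])
  have ag₂ : Agree [30, 31, 32, 33] [5] σ₁ σ₂ := run₂.agree.mono (by decide) (by decide)
  have h₂ : Par n A N L σ₂ := h₁.congr ag₂
  obtain ⟨σ₃, run₃, m₃⟩ := nest_assign (L := rowLoops 30 ++ colLoops 34) (a := 2)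
    (x := .sub (.get 2 (vars 30 8)) (.mul (.get 5 (vars 30 4)) (.get 4 (vars 34 4)))) (by decide)
    ((h₂.rows h2 hn hL 30).append (h₂.cols h2 hn hN 34))
    (fun t => σ₂.mem 2 t - σ₂.mem 5 (t.take 4) * σ₂.mem 4 (t.drop 4)) (by
      intro ρ t _ hag hvars hmem
      have e1 : (vars 30 8).map (IExpr.eval ρ) = t := by rw [← hvars]; rfl
      have e2 : (vars 30 4).map (IExpr.eval ρ) = t.take 4 := by rw [← hvars]; rfl
      have e3 : (vars 34 4).map (IExpr.eval ρ) = t.drop 4 := by rw [← hvars]; rfl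
      simp only [FExpr.eval, e1, e2, e3, hmem, hag.mem 4 (by decide), hag.mem 5 (by decide)])
  have ag₃ : Agree [30, 31, 32, 33, 34, 35, 36, 37] [2] σ₂ σ₃ :=
    run₃.agree.mono (by decide) (by decide)
  refine ⟨_, (run₁.seq (run₂.seq (run₃.seq (Runs.setInt 7 _ σ₃)))).mono ?_, ?_, ?_⟩
  · simp only [pivotCost, eval_add, eval_C]
    exact le_rfl
  · change Function.update σ₃.int 7 (σ₃.int 7 + 1) 7 = _
    rw [Function.update_self, ag₃.int 7 (by decide), ag₂.int 7 (by decide), ag₁.int 7 (by decide)]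
  · intro r' hr' c' hc'
    change σ₃.mem 2 (r' ++ c') = _
    have hl := length_of_mem_box hr'
    have t1 : (r' ++ c').take 4 = r' := List.take_left' hl
    have t2 : (r' ++ c').drop 4 = c' := List.drop_left' hl
    rw [m₃]
    simp only [if_pos (append_mem_box hr' hc'), t1, t2]
    rw [m₂, ag₂.mem 4 (by decide), m₁, ag₂.mem 2 (by decide), ag₁.mem 2 (by decide)]
    simp only [if_pos hr', if_pos hc']

/-- The matrix in array `2`. -/
def mat (n N L : ℕ) (σ : State K) :
    Matrix {r // r ∈ box (rowBox n L)} {c // c ∈ box (colBox n N)} K :=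
  Matrix.of fun r c => σ.mem 2 (r.1 ++ c.1)

/-- The rank computed by `eliminate` is the number of columns minus the nullity. Every step raises the
nullity and the counter in variable `7` by one, and in the end the matrix is zero. -/
theorem eliminate_spec {n A N L B : ℕ} {σ : State K} (h : Par n A N L σ) (h2 : 2 ≤ B) (hn : n ≤ B)
    (hN : N ≤ B) (hL : L ≤ B) : ∃ τ, Runs eliminate σ τ (eliminateCost.eval B) ∧
      (τ.int 7 : ℤ) + nullity (mat n N L σ) = (box (colBox n N)).card := by
  set σ₀ := σ.setInt 7 0 with hσ₀
  have ag₀ : Agree [7] [] σ σ₀ := Agree.setInt _ _ _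
  have h₀ : Par n A N L σ₀ := h.congr ag₀
  -- the rank of the matrix and the number of the pivots have a constant sum
  let J : State K → Prop := fun τ => τ.int 7 + nullity (mat n N L σ) = nullity (mat n N L τ)
  let Z : Finset (List ℤ) → State K → Prop := fun D τ =>
    ∀ r ∈ D, r ∈ box (rowBox n L) → ∀ c ∈ box (colBox n N), τ.mem 2 (r ++ c) = 0
  obtain ⟨τ, run, hJ, hZ⟩ := nest_rule (p := nestCost (colLoops 24)
      (C ((Test.isZero (.get 2 (vars 20 8))).cost + 2) + pivotCost)) (σ₀ := σ₀)
    (L := rowLoops 20) (P := nest (colLoops 24)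
      (.ite (.isZero (.get 2 (vars 20 8))) .skip pivot)) (by decide) (h₀.rows h2 hn hL 20)
    (fun D τ => J τ ∧ Z D τ) (by
      intro D τ v hv x ⟨hJ, hZ⟩
      refine ⟨?_, hZ⟩
      have : (τ.setInt v x).int 7 = τ.int 7 :=
        (Agree.setInt τ v x).int 7 (by revert hv; simp; omega)
      change (τ.setInt v x).int 7 + _ = _
      rw [this]; exact hJ) (by
      refine ⟨?_, by simp [Z]⟩
      change σ₀.int 7 + _ = _
      simp [hσ₀, State.setInt, mat]) (by
      intro D σ₁ r hr hrD ag₁ hvr ⟨hJ₁, hZ₁⟩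
      have h₁ : Par n A N L σ₁ := h₀.congr ag₁
      obtain ⟨τ, run, hJ, hZ, hz⟩ := nest_rule
        (p := C ((Test.isZero (.get 2 (vars 20 8))).cost + 2) + pivotCost) (σ₀ := σ₁)
        (L := colLoops 24) (P := .ite (.isZero (.get 2 (vars 20 8))) .skip pivot) (by decide)
        (h₁.cols h2 hn hN 24)
        (fun E τ => J τ ∧ Z D τ ∧ ∀ c ∈ E, c ∈ box (colBox n N) → τ.mem 2 (r ++ c) = 0) (by
          intro E τ v hv x ⟨hJ, hZ⟩
          refine ⟨?_, hZ⟩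
          have : (τ.setInt v x).int 7 = τ.int 7 :=
            (Agree.setInt τ v x).int 7 (by revert hv; simp; omega)
          change (τ.setInt v x).int 7 + _ = _
          rw [this]; exact hJ) ⟨hJ₁, hZ₁, by simp⟩ (by
          intro E σ₂ c hc hcE ag₂ hvc ⟨hJ₂, hZ₂, hz₂⟩
          have h₂ : Par n A N L σ₂ := h₁.congr ag₂
          have hvr₂ : [20, 21, 22, 23].map σ₂.int = r := by
            rw [← hvr]
            simp only [List.map_cons, List.map_nil]
            rw [ag₂.int 20 (by decide), ag₂.int 21 (by decide), ag₂.int 22 (by decide),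
              ag₂.int 23 (by decide)]
          have hrc : (vars 20 8).map (IExpr.eval σ₂) = r ++ c := by
            rw [← hvr₂, ← hvc]; rfl
          by_cases h0 : σ₂.mem 2 (r ++ c) = 0
          · refine ⟨σ₂, (Runs.ite_true (c := 1) ?_ ⟨1, le_rfl, .skip σ₂⟩).mono ?_, hJ₂, hZ₂, ?_⟩
            · simp only [Test.eval, FExpr.eval, hrc, h0]
            · simp only [eval_add, eval_C]; omega
            · intro c' hc' hcb
              rcases Finset.mem_insert.1 hc' with rfl | hc'
              · exact h0
              · exact hz₂ c' hc' hcb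
          · obtain ⟨τ, run, e7, em⟩ := pivot_spec h₂ h2 hn hN hL hvr₂ hvc
            refine ⟨τ, (Runs.ite_false ?_ run).mono ?_, ?_, ?_, ?_⟩
            · simp only [Test.eval, FExpr.eval, hrc, h0, not_false_eq_true]
            · simp only [eval_add, eval_C]; omega
            · have e : mat n N L τ = Matrix.of fun r' c' => mat n N L σ₂ r' c' -
                  mat n N L σ₂ r' ⟨c, hc⟩ * (mat n N L σ₂ ⟨r, hr⟩ c' /
                    mat n N L σ₂ ⟨r, hr⟩ ⟨c, hc⟩) := by
                ext r' c'
                exact em r'.1 r'.2 c'.1 c'.2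
              change τ.int 7 + _ = _
              rw [e, nullity_pivot (mat n N L σ₂) (r := ⟨r, hr⟩) (c := ⟨c, hc⟩) h0, e7]
              have : σ₂.int 7 + nullity (mat n N L σ) = nullity (mat n N L σ₂) := hJ₂
              push_cast
              rw [← this]; ring
            · intro r' hr' hrb c' hc'
              rw [em r' hrb c' hc', hZ₂ r' hr' hrb c' hc', hZ₂ r' hr' hrb c hc]
              simp
            · intro c' _ hcb
              rw [em r hr c' hcb]
              field_simp
              simp)
      refine ⟨τ, run, hJ, ?_⟩
      intro r' hr' hrb c hc
      rcases Finset.mem_insert.1 hr' with rfl | hr'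
      · exact hz c hc hc
      · exact hZ r' hr' hrb c hc)
  refine ⟨τ, ((Runs.setInt 7 (.const 0) σ).seq run).mono ?_, ?_⟩
  · simp only [eliminateCost, eval_add, eval_C]
    exact le_rfl
  · have e0 : mat n N L τ = 0 := by
      ext r c
      exact hZ r.1 r.2 r.2 c.1 c.2
    have : τ.int 7 + nullity (mat n N L σ) = nullity (mat n N L τ) := hJ
    rw [this, e0, nullity_zero, Fintype.card_coe]

end AlgRAM

namespace Conic
open AlgRAM

/-! ### The program that sets up the linear equations -/

/-- The coefficient `cf f e k`, for an integer `e`. -/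
def cfInt (f : R12) (e k : ℤ) : ℝ := if e = 0 then cf f 0 k else cf f 1 k

/-- The entries of a matrix, indexed by integers. -/
def entry {n : ℕ} (M : Matrix (Fin n) (Fin n) R12) (p q : ℤ) : R12 :=
  if h : (0 ≤ p ∧ p < n) ∧ 0 ≤ q ∧ q < n then M ⟨p.toNat, by omega⟩ ⟨q.toNat, by omega⟩ else 0

theorem entry_coe {n : ℕ} (M : Matrix (Fin n) (Fin n) R12) (p q : Fin n) :
    entry M ((p : ℕ) : ℤ) ((q : ℕ) : ℤ) = M p q := by
  rw [entry, dif_pos (by omega)]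
  simp

theorem cfInt_coe (f : R12) (e : Fin 2) (k : ℤ) : cfInt f ((e : ℕ) : ℤ) k = cf f e k := by
  fin_cases e <;> simp [cfInt]

theorem input_mem {n : ℕ} (M : Matrix (Fin n) (Fin n) R12) {p q e : ℤ} (k : ℤ) (he : e = 0 ∨ e = 1)
    (hp : 0 ≤ p ∧ p < n) (hq : 0 ≤ q ∧ q < n) :
    (inputState M).mem 0 [p, q, e, k] = cfInt (entry M p q) e k := by
  have h : (0 ≤ p ∧ p < n) ∧ (0 ≤ q ∧ q < n) ∧ 0 ≤ e ∧ e < 2 := ⟨hp, hq, by omega, by omega⟩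
  rw [entry, dif_pos ⟨hp, hq⟩]
  change (if h : (0 ≤ p ∧ p < n) ∧ (0 ≤ q ∧ q < n) ∧ 0 ≤ e ∧ e < 2 then
    (coord (M ⟨p.toNat, by omega⟩ ⟨q.toNat, by omega⟩) ⟨e.toNat, by omega⟩).coeff k else 0) = _
  rw [dif_pos h]
  rcases he with rfl | rfl <;> rfl

/-- The coefficient `cf (x ^ s * f) e m` for the entry `f` of array `0` whose indices are in the
variables `31` and `35`. -/
def coefExpr : ℕ → ℕ → IExpr → FExpr
  | 0, e, m => .get 0 [.var 31, .var 35, .const e, m]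
  | s + 1, 0, m => .sub .zero (.add (coefExpr s 1 (.sub m (.const 2))) (coefExpr s 1 m))
  | s + 1, _ + 1, m => coefExpr s 0 m

theorem coefExpr_eval {n : ℕ} {M : Matrix (Fin n) (Fin n) R12} {σ : State ℝ}
    (hM : σ.mem 0 = (inputState M).mem 0) {p q : ℤ} (hp : 0 ≤ p ∧ p < n) (hq : 0 ≤ q ∧ q < n)
    (h31 : σ.int 31 = p) (h35 : σ.int 35 = q) (s e : ℕ) (he : e = 0 ∨ e = 1) (m : IExpr) :
    (coefExpr s e m).eval σ = cfInt (xy ^ s * entry M p q) e (m.eval σ) := by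
  induction s generalizing e m with
  | zero =>
    simp only [coefExpr, FExpr.eval, List.map_cons, List.map_nil, IExpr.eval, h31, h35, hM,
      pow_zero, one_mul]
    exact input_mem M _ (by omega) hp hq
  | succ s ih =>
    have hx : xy ^ (s + 1) * entry M p q = xy * (xy ^ s * entry M p q) := by ring
    rcases he with rfl | rfl
    · simp only [coefExpr, FExpr.eval, ih 1 (Or.inr rfl), hx, cfInt, IExpr.eval]
      simp [cf_xy_mul_zero]
    · simp only [coefExpr, ih 0 (Or.inl rfl), hx, cfInt]
      simp [cf_xy_mul_one]

/-- The shift by `1` in the second component for odd twists. -/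
def shift (ε : Bool) (c : ℤ) : ℤ := if ε = true ∧ c = 0 then 1 else 0

/-- The matrix `[1, 0; 0, 1]` for even twists and `[1, 0; x, 1]` for odd twists. -/
def twist (ε : Bool) (c d : ℤ) : R12 :=
  if c = d then 1 else if ε = true ∧ c = 1 ∧ d = 0 then xy else 0

/-- The entries of the matrix that describes `sec` by real linear equations. -/
def cell (ε : Bool) (a : ℤ) {n : ℕ} (M : Matrix (Fin n) (Fin n) R12) : List ℤ → ℝ
  | [c, p, e, l, d, q, t, k] =>
    cfInt (twist ε c d * xy ^ t.toNat * entry M p q) e (l - a + (k + (t - shift ε c)))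
  | _ => 0

/-- The expression for the entries with given `c, d, t, e`. -/
def cellExpr (ε : Bool) (c d t e : ℕ) : FExpr :=
  let m : IExpr := .add (.sub (.var 33) (.var 6)) (.add (.var 37) (.const (t - shift ε c)))
  if c = d then coefExpr t e m
  else if ε = true ∧ c = 1 ∧ d = 0 then coefExpr (t + 1) e m else .zero

/-- The loops over the cells with given `c, d, t, e`. -/
abbrev cellLoops (c d t e : ℕ) : List (ℕ × IExpr × IExpr) :=
  [(30, .const c, .const (c + 1)), (31, .const 0, .var 0), (32, .const e, .const (e + 1)),
    (33, .sub (.const 0) (.var 5), .const 0), (34, .const d, .const (d + 1)),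
    (35, .const 0, .var 0), (36, .const t, .const (t + 1)), (37, .const 0, .var 4)]

/-- The range of the loops over the cells with given `c, d, t, e`. -/
abbrev cellBox (n N L : ℕ) (c d t e : ℕ) : List (ℤ × ℤ) :=
  [((c : ℤ), (c : ℤ) + 1), (0, n), ((e : ℤ), (e : ℤ) + 1), (-L, 0), ((d : ℤ), (d : ℤ) + 1), (0, n),
    ((t : ℤ), (t : ℤ) + 1), (0, N)]

theorem cellLoops_bounds {n A N L B : ℕ} {σ : State ℝ} (h : Par n A N L σ) (h2 : 2 ≤ B)
    (hn : n ≤ B) (hN : N ≤ B) (hL : L ≤ B) (c d t e : ℕ) :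
    Bounds σ B (cellLoops c d t e) (cellBox n N L c d t e) := by
  refine .cons ⟨rfl, rfl, ?_, ?_⟩ (.cons ⟨rfl, h.n, ?_, ?_⟩
    (.cons ⟨rfl, rfl, ?_, ?_⟩ (.cons ⟨?_, rfl, ?_, ?_⟩ (.cons ⟨rfl, rfl, ?_, ?_⟩
    (.cons ⟨rfl, h.n, ?_, ?_⟩ (.cons ⟨rfl, rfl, ?_, ?_⟩ (.cons ⟨rfl, h.N, ?_, ?_⟩ .nil)))))))
  rotate_left 6
  · simp [IExpr.eval, h.L]
  all_goals simp only; omega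

/-- The part of the program `fill` for the given list of quadruples `(c, d, t, e)`. -/
def fillList (ε : Bool) : List (ℕ × ℕ × ℕ × ℕ) → Prog
  | [] => .skip
  | x :: S => .seq (nest (cellLoops x.1 x.2.1 x.2.2.1 x.2.2.2) (.setField 2
      ((loopVars (cellLoops x.1 x.2.1 x.2.2.1 x.2.2.2)).map .var)
      (cellExpr ε x.1 x.2.1 x.2.2.1 x.2.2.2))) (fillList ε S)

/-- A bound for the cost of `fillList`. -/
def fillListCost (ε : Bool) : List (ℕ × ℕ × ℕ × ℕ) → ℕ[X]
  | [] => 1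
  | x :: S => nestCost (cellLoops x.1 x.2.1 x.2.2.1 x.2.2.2)
      (C ((cellLoops x.1 x.2.1 x.2.2.1 x.2.2.2).length +
        (cellExpr ε x.1 x.2.1 x.2.2.1 x.2.2.2).cost + 1)) + fillListCost ε S

theorem fillList_ints (ε : Bool) (S : List (ℕ × ℕ × ℕ × ℕ)) :
    (fillList ε S).ints ⊆ [30, 31, 32, 33, 34, 35, 36, 37] := by
  induction S with
  | nil => simp [fillList, Prog.ints]
  | cons x S ih =>
    intro v hv
    simp only [fillList, Prog.ints, List.mem_append] at hv
    rcases hv with hv | hv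
    · rw [nest_ints] at hv
      simpa [Prog.ints] using hv
    · exact ih hv

theorem fillList_arrs (ε : Bool) (S : List (ℕ × ℕ × ℕ × ℕ)) : (fillList ε S).arrs ⊆ [2] := by
  induction S with
  | nil => simp [fillList, Prog.arrs]
  | cons x S ih =>
    intro v hv
    simp only [fillList, Prog.arrs, List.mem_append, nest_arrs] at hv
    rcases hv with hv | hv
    · exact hv
    · exact ih hv

/-- The loops for the quadruples in `S` write the correct values into their cells, and do not spoil the
cells that are correct already. -/
theorem fillList_spec {n A N L B : ℕ} {M : Matrix (Fin n) (Fin n) R12} {a : ℤ} (ε : Bool)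
    (h2 : 2 ≤ B) (hn : n ≤ B) (hN : N ≤ B) (hL : L ≤ B) (S : List (ℕ × ℕ × ℕ × ℕ))
    (hS : ∀ x ∈ S, x.2.2.2 = 0 ∨ x.2.2.2 = 1) {σ : State ℝ} (h : Par n A N L σ)
    (hM : σ.mem 0 = (inputState M).mem 0) (ha : σ.int 6 = a) :
    ∃ τ, Runs (fillList ε S) σ τ ((fillListCost ε S).eval B) ∧
      ∀ s, (σ.mem 2 s = cell ε a M s ∨
        ∃ x ∈ S, s ∈ box (cellBox n N L x.1 x.2.1 x.2.2.1 x.2.2.2)) →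
        τ.mem 2 s = cell ε a M s := by
  induction S generalizing σ with
  | nil =>
    refine ⟨σ, ⟨1, by simp [fillListCost], .skip σ⟩, ?_⟩
    rintro s (hs | ⟨x, hx, -⟩)
    · exact hs
    · simp at hx
  | cons x S ih =>
    obtain ⟨c, d, t, e⟩ := x
    have he : e = 0 ∨ e = 1 := hS (c, d, t, e) List.mem_cons_self
    obtain ⟨σ₁, run₁, m₁⟩ := nest_assign (L := cellLoops c d t e) (a := 2)
      (x := cellExpr ε c d t e) (by simp [NestOK, IExpr.vars]) (cellLoops_bounds h h2 hn hN hL c d t e)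
      (cell ε a M) (by
        intro ρ s hs hag hvars _
        obtain ⟨c', s1, rfl, hc, hs1⟩ := mem_box_cons.1 hs
        obtain ⟨p, s2, rfl, hp, hs2⟩ := mem_box_cons.1 hs1
        obtain ⟨e', s3, rfl, he', hs3⟩ := mem_box_cons.1 hs2
        obtain ⟨l, s4, rfl, hl, hs4⟩ := mem_box_cons.1 hs3
        obtain ⟨d', s5, rfl, hd, hs5⟩ := mem_box_cons.1 hs4
        obtain ⟨q, s6, rfl, hq, hs6⟩ := mem_box_cons.1 hs5
        obtain ⟨t', s7, rfl, ht, hs7⟩ := mem_box_cons.1 hs6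
        obtain ⟨k, s8, rfl, hk, hs8⟩ := mem_box_cons.1 hs7
        rw [box, Finset.mem_singleton] at hs8
        subst hs8
        simp only at hc hp he' hl hd hq ht hk
        obtain rfl : c' = c := by omega
        obtain rfl : d' = d := by omega
        obtain rfl : e' = e := by omega
        obtain rfl : t' = t := by omega
        simp only [loopVars, List.map_cons, List.map_nil, List.cons.injEq, and_true] at hvars
        obtain ⟨v0, v1, v2, v3, v4, v5, v6, v7⟩ := hvars
        have hM' : ρ.mem 0 = (inputState M).mem 0 := by rw [hag.mem 0 (by simp), hM]
        have ha' : ρ.int 6 = a := by rw [hag.int 6 (by simp), ha]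
        have hcf := fun s => coefExpr_eval hM' hp hq v1 v5 s e he
        simp only [cell, cellExpr, twist, Int.toNat_natCast, Nat.cast_inj]
        have hm : ∀ z, IExpr.eval ρ (.add (.sub (.var 33) (.var 6))
            (.add (.var 37) (.const z))) = l - a + (k + z) := by
          intro z
          simp only [IExpr.eval, v3, v7, ha']
        by_cases hcd : c = d
        · rw [if_pos hcd, if_pos hcd, hcf, hm, one_mul]
        · rw [if_neg hcd, if_neg hcd]
          by_cases h3 : ε = true ∧ c = 1 ∧ d = 0
          · rw [if_pos h3, if_pos (by simpa using h3), hcf, hm, pow_succ']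
          · rw [if_neg h3, if_neg (by simpa using h3)]
            simp [FExpr.eval, cfInt, cf_zero])
    have ag₁ : Agree [30, 31, 32, 33, 34, 35, 36, 37] [2] σ σ₁ := by
      refine run₁.agree.mono ?_ ?_
      · intro v hv
        rw [nest_ints] at hv
        simpa [Prog.ints] using hv
      · rw [nest_arrs]; exact List.Subset.refl _
    obtain ⟨τ, run₂, hτ⟩ := ih (fun x hx => hS x (List.mem_cons_of_mem _ hx)) (h.congr ag₁)
      (by rw [ag₁.mem 0 (by decide), hM]) (by rw [ag₁.int 6 (by decide), ha])
    refine ⟨τ, (run₁.seq run₂).mono (by rw [fillListCost, eval_add]), ?_⟩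
    intro s hs
    apply hτ
    rw [m₁]
    simp only [List.mem_cons] at hs
    by_cases hbox : s ∈ box (cellBox n N L c d t e)
    · left; simp only [if_pos hbox]
    · simp only [if_neg hbox]
      rcases hs with hs | ⟨x, rfl | hx, hs⟩
      · exact Or.inl hs
      · exact absurd hs hbox
      · exact Or.inr ⟨x, hx, hs⟩

/-- All quadruples `(c, d, t, e)`. -/
def quads : List (ℕ × ℕ × ℕ × ℕ) :=
  [(0, 0, 0, 0), (0, 0, 0, 1), (0, 0, 1, 0), (0, 0, 1, 1), (0, 1, 0, 0), (0, 1, 0, 1),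
    (0, 1, 1, 0), (0, 1, 1, 1), (1, 0, 0, 0), (1, 0, 0, 1), (1, 0, 1, 0), (1, 0, 1, 1),
    (1, 1, 0, 0), (1, 1, 0, 1), (1, 1, 1, 0), (1, 1, 1, 1)]

/-- Array `2` receives the matrix of the linear equations. -/
def fill (ε : Bool) : Prog := fillList ε quads

theorem fill_spec {n A N L B : ℕ} {M : Matrix (Fin n) (Fin n) R12} {a : ℤ} (ε : Bool)
    (h2 : 2 ≤ B) (hn : n ≤ B) (hN : N ≤ B) (hL : L ≤ B) {σ : State ℝ} (h : Par n A N L σ)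
    (hM : σ.mem 0 = (inputState M).mem 0) (ha : σ.int 6 = a) :
    ∃ τ, Runs (fill ε) σ τ ((fillListCost ε quads).eval B) ∧
      ∀ r ∈ box (rowBox n L), ∀ c ∈ box (colBox n N), τ.mem 2 (r ++ c) = cell ε a M (r ++ c) := by
  obtain ⟨τ, run, hτ⟩ := fillList_spec (M := M) ε h2 hn hN hL quads (by decide) h hM ha
  refine ⟨τ, run, ?_⟩
  intro r hr s hs
  apply hτ
  right
  obtain ⟨c, r1, rfl, hc, hr1⟩ := mem_box_cons.1 hr
  obtain ⟨p, r2, rfl, hp, hr2⟩ := mem_box_cons.1 hr1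
  obtain ⟨e, r3, rfl, he, hr3⟩ := mem_box_cons.1 hr2
  obtain ⟨l, r4, rfl, hl, hr4⟩ := mem_box_cons.1 hr3
  obtain ⟨d, s1, rfl, hd, hs1⟩ := mem_box_cons.1 hs
  obtain ⟨q, s2, rfl, hq, hs2⟩ := mem_box_cons.1 hs1
  obtain ⟨t, s3, rfl, ht, hs3⟩ := mem_box_cons.1 hs2
  obtain ⟨k, s4, rfl, hk, hs4⟩ := mem_box_cons.1 hs3
  rw [box, Finset.mem_singleton] at hr4 hs4
  subst hr4 hs4
  simp only at hc hp he hl hd hq ht hk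
  refine ⟨(c.toNat, d.toNat, t.toNat, e.toNat), ?_, ?_⟩
  · have h1 : c = 0 ∨ c = 1 := by omega
    have h2 : d = 0 ∨ d = 1 := by omega
    have h3 : t = 0 ∨ t = 1 := by omega
    have h4 : e = 0 ∨ e = 1 := by omega
    rcases h1 with rfl | rfl <;> rcases h2 with rfl | rfl <;> rcases h3 with rfl | rfl <;>
      rcases h4 with rfl | rfl <;> simp [quads]
  · simp only [List.cons_append, List.nil_append, cons_mem_box]
    refine ⟨by omega, by omega, by omega, by omega, by omega, by omega, by omega, by omega, ?_⟩
    exact nil_mem_box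

open AlgRAM

/-! ### Sections as solutions of linear equations -/

/-- The element of `R₁` with the given coefficients at `x ^ t T ^ (-k - t)`. -/
def comb {N : ℕ} (u : Fin 2 → Fin N → ℝ) : R12 :=
  ∑ t : Fin 2, ∑ k : Fin N, u t k • (xy ^ (t : ℕ) * tp (-(k : ℤ) - (t : ℕ)))

theorem cf_mul_comb {N : ℕ} (u : Fin 2 → Fin N → ℝ) (g : R12) (e : Fin 2) (m : ℤ) :
    cf (g * comb u) e m =
      ∑ t : Fin 2, ∑ k : Fin N, cf (xy ^ (t : ℕ) * g) e (m + (k + (t : ℕ))) * u t k := by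
  simp only [comb, Finset.mul_sum, cf_sum]
  refine Finset.sum_congr rfl fun t _ => Finset.sum_congr rfl fun k _ => ?_
  rw [mul_smul_comm, cf_smul, show g * (xy ^ (t : ℕ) * tp (-(k : ℤ) - (t : ℕ))) =
    tp (-(k : ℤ) - (t : ℕ)) * (xy ^ (t : ℕ) * g) by ring, cf_tp_mul, mul_comm]
  congr 2; ring

theorem comb_mem_V1 {N : ℕ} (u : Fin 2 → Fin N → ℝ) : comb u ∈ V1 := by
  refine Submodule.sum_mem _ fun t _ => Submodule.sum_mem _ fun k _ => Submodule.smul_mem _ _ ?_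
  have h : xy ^ (t : ℕ) * tp (-(k : ℤ) - (t : ℕ)) = xz ^ (t : ℕ) * tp (-(k : ℤ)) := by
    fin_cases t
    · simp
    · simp only [xz_eq, pow_one]
      rw [mul_comm (tp (-1)), mul_assoc, ← tp_add]
      simp [sub_eq_add_neg, add_comm]
  rw [h]
  exact S1.mul_mem (S1.pow_mem xz_mem_S1 _) (tp_mem_S1 (by omega))

theorem cf_comb {N : ℕ} (u : Fin 2 → Fin N → ℝ) (e : Fin 2) (m : ℤ) :
    cf (comb u) e m = ∑ k : Fin N, if m + (k + (e : ℕ)) = 0 then u e k else 0 := by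
  rw [← one_mul (comb u), cf_mul_comb, Fin.sum_univ_two]
  have h0 : ∀ m, cf (xy ^ ((0 : Fin 2) : ℕ) * 1) e m = if e = 0 ∧ m = 0 then 1 else 0 := by
    intro m
    rw [Fin.val_zero, pow_zero, one_mul]
    fin_cases e
    · simp [cf_one_zero]
    · simp [cf_one_one]
  have h1 : ∀ m, cf (xy ^ ((1 : Fin 2) : ℕ) * 1) e m = if e = 1 ∧ m = 0 then 1 else 0 := by
    intro m
    rw [Fin.val_one, pow_one]
    fin_cases e
    · change cf (xy * 1) 0 m = _
      rw [cf_xy_mul_zero, cf_one_one, cf_one_one]; simp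
    · change cf (xy * 1) 1 m = _
      rw [cf_xy_mul_one, cf_one_zero]; simp
  simp only [h0, h1]
  fin_cases e <;> simp

theorem cf_comb_self {N : ℕ} (u : Fin 2 → Fin N → ℝ) (e : Fin 2) (k : Fin N) :
    cf (comb u) e (-((k : ℤ) + (e : ℕ))) = u e k := by
  rw [cf_comb, Finset.sum_eq_single k]
  · simp
  · intro j _ hj
    rw [if_neg]
    intro h
    apply hj
    ext
    omega
  · simp

theorem comb_coeff {N : ℕ} {f : R12} (h1 : f ∈ V1) (h2 : f ∈ V2 (N - 1)) :
    comb (fun (e : Fin 2) (k : Fin N) => cf f e (-((k : ℤ) + (e : ℕ)))) = f := by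
  apply cf_ext
  intro e m
  rw [cf_comb]
  rw [mem_V1, mem_S1] at h1
  rw [mem_V2, mem_S2] at h2
  by_cases hm : 0 ≤ -m - (e : ℕ) ∧ -m - (e : ℕ) < N
  · have hk : (-m - (e : ℕ)).toNat < N := by omega
    rw [Finset.sum_eq_single (⟨_, hk⟩ : Fin N)]
    · rw [if_pos (by simp only; omega)]
      congr 1
      simp only
      omega
    · intro j _ hj
      rw [if_neg]
      intro h
      apply hj
      ext
      simp only
      omega
    · simp
  · rw [Finset.sum_eq_zero]
    · symm
      by_cases h : 0 ≤ -m - (e : ℕ)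
      · have := h2 e (m + (N - 1)) (by omega)
        rw [cf_tp_mul] at this
        rw [← this]; congr 1; ring
      · revert h hm
        fin_cases e
        · intro _ h
          exact h1.1 _ (by simp at h; omega)
        · intro _ h
          exact h1.2 _ (by simp at h; omega)
    · intro k _
      rw [if_neg]
      intro h
      apply hm
      omega

theorem comb_mem_V2 {N : ℕ} (u : Fin 2 → Fin N → ℝ) : comb u ∈ V2 N := by
  rw [mem_V2, mem_S2]
  intro e k hk
  rw [cf_tp_mul, cf_comb]
  refine Finset.sum_eq_zero fun j _ => ?_
  rw [if_neg]
  have := j.2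
  have := e.2
  omega

theorem twist_mem_S2 (ε : Bool) (c d : ℤ) : twist ε c d ∈ S2 := by
  rw [twist]
  split_ifs
  exacts [S2.one_mem, xy_mem_S2, S2.zero_mem]

theorem shift_one (ε : Bool) : shift ε 1 = 0 := by simp [shift]

theorem mem_sec_iff {n : ℕ} (ε : Bool) (a : ℤ) (M : Matrix (Fin n) (Fin n) R12)
    (f : (Fin n → R12) × (Fin n → R12)) :
    f ∈ sec a (shift ε 0) (twist ε 1 0) M ↔ ((∀ i, f.1 i ∈ V1) ∧ ∀ i, f.2 i ∈ V1) ∧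
      ∀ (c : Fin 2) p e, ∀ l < 0, cf (∑ d : Fin 2, ∑ q,
        twist ε (c : ℕ) (d : ℕ) * M p q * ![f.1, f.2] d q) e (l - a - shift ε (c : ℕ)) = 0 := by
  have h0 : ∀ p, ∑ d : Fin 2, ∑ q, twist ε ((0 : Fin 2) : ℕ) (d : ℕ) * M p q * ![f.1, f.2] d q =
      M.mulVec f.1 p := by
    intro p
    simp [Fin.sum_univ_two, twist, Matrix.mulVec, dotProduct]
  have h1 : ∀ p, ∑ d : Fin 2, ∑ q, twist ε ((1 : Fin 2) : ℕ) (d : ℕ) * M p q * ![f.1, f.2] d q =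
      M.mulVec (f.2 + twist ε 1 0 • f.1) p := by
    intro p
    rw [Fin.sum_univ_two, ← Finset.sum_add_distrib]
    simp only [Matrix.mulVec, dotProduct]
    refine Finset.sum_congr rfl fun q _ => ?_
    cases ε
    · simp [twist]
    · simp [twist]; ring
  rw [Fin.forall_fin_two]
  simp only [h0, h1]
  change (_ ∧ _ ∧ _ ∧ _) ↔ _
  rw [← and_assoc]
  refine and_congr_right fun _ => and_congr ?_ ?_
  · refine forall_congr' fun p => ?_
    rw [mem_V2, mem_S2]
    refine forall_congr' fun e => forall_congr' fun l => forall_congr' fun _ => ?_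
    rw [cf_tp_mul, sub_sub]; rfl
  · refine forall_congr' fun p => ?_
    rw [mem_V2, mem_S2]
    refine forall_congr' fun e => forall_congr' fun l => forall_congr' fun _ => ?_
    rw [cf_tp_mul, Fin.val_one, Nat.cast_one, shift_one, sub_zero]

/-- The pair of vectors over `R₁` with the given coefficients. -/
def combPair (n N : ℕ) :
    (Fin 2 × Fin n × Fin 2 × Fin N → ℝ) →ₗ[ℝ] (Fin n → R12) × (Fin n → R12) where
  toFun v := (fun q => comb fun t k => v (0, q, t, k), fun q => comb fun t k => v (1, q, t, k))
  map_add' v w := by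
    ext q <;> simp [comb, add_smul, Finset.sum_add_distrib]
  map_smul' r v := by
    ext q <;> simp [comb, mul_smul, Finset.smul_sum]

theorem combPair_apply {n N : ℕ} (v : Fin 2 × Fin n × Fin 2 × Fin N → ℝ) (d : Fin 2) (q : Fin n) :
    ![(combPair n N v).1, (combPair n N v).2] d q = comb fun t k => v (d, q, t, k) := by
  fin_cases d <;> rfl

theorem combPair_injective (n N : ℕ) : Function.Injective (combPair n N) := by
  intro v w h
  funext x
  obtain ⟨d, q, t, k⟩ := x
  have h1 := combPair_apply v d q
  rw [h, combPair_apply] at h1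
  rw [← cf_comb_self (fun t k => v (d, q, t, k)) t k, ← h1,
    cf_comb_self (fun t k => w (d, q, t, k)) t k]

/-- The linear equations for the coefficients of the elements of `sec`. The unknown with the index
`(d, q, t, k)` is the coefficient of `x ^ t T ^ (-k - t)` in the entry `q` of the `d`-th vector, and
the equation `(c, p, e, l)` says that the `c`-th condition of `sec` holds for the entry `p` in the
coordinate `e` at the exponent `l - L < 0`. -/
def secMat (ε : Bool) (a : ℤ) {n : ℕ} (N L : ℕ) (M : Matrix (Fin n) (Fin n) R12) :
    Matrix (Fin 2 × Fin n × Fin 2 × Fin L) (Fin 2 × Fin n × Fin 2 × Fin N) ℝ :=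
  Matrix.of fun r x => cf (twist ε (r.1 : ℕ) (x.1 : ℕ) * xy ^ (x.2.2.1 : ℕ) * M r.2.1 x.2.1) r.2.2.1
    (((r.2.2.2 : ℕ) : ℤ) - L - a + ((x.2.2.2 : ℕ) + ((x.2.2.1 : ℕ) - shift ε (r.1 : ℕ))))

theorem secMat_mulVec (ε : Bool) (a : ℤ) {n : ℕ} (N L : ℕ) (M : Matrix (Fin n) (Fin n) R12)
    (v : Fin 2 × Fin n × Fin 2 × Fin N → ℝ) (c : Fin 2) (p : Fin n) (e : Fin 2) (l : Fin L) :
    (secMat ε a N L M).mulVec v (c, p, e, l) = cf (∑ d : Fin 2, ∑ q,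
      twist ε (c : ℕ) (d : ℕ) * M p q * ![(combPair n N v).1, (combPair n N v).2] d q) e
        (((l : ℕ) : ℤ) - L - a - shift ε (c : ℕ)) := by
  simp only [Matrix.mulVec, dotProduct, Fintype.sum_prod_type, combPair_apply, cf_sum, cf_mul_comb]
  refine Finset.sum_congr rfl fun d _ => Finset.sum_congr rfl fun q _ =>
    Finset.sum_congr rfl fun t _ => Finset.sum_congr rfl fun k _ => ?_
  simp only [secMat, Matrix.of_apply]
  congr 2
  · ring
  · ring

/-- The bounds `N` and `L` suffice: a section of the twist has at most `N` exponents, and the conditions at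
exponents less than `-L` are void. -/
theorem map_ker_secMat {n : ℕ} {M M' : Matrix (Fin n) (Fin n) R12} (hM' : M' * M = 1) {W D : ℕ}
    (hM : ∀ i j, InT S2 (-(W : ℤ)) (M i j)) (hD : ∀ i j, InT S2 (-(D : ℤ)) (M' i j)) (ε : Bool)
    {a : ℤ} {A N L : ℕ} (hN : N = A + D + 2) (hL : L = A + N + W + 1) (ha : -(A + 1 : ℤ) ≤ a)
    (ha' : a ≤ A) : (LinearMap.ker (secMat ε a N L M).mulVecLin).map (combPair n N) =
      sec a (shift ε 0) (twist ε 1 0) M := by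
  ext f
  rw [Submodule.mem_map]
  constructor
  · rintro ⟨v, hv, rfl⟩
    rw [mem_sec_iff]
    refine ⟨⟨fun i => comb_mem_V1 fun t k => v (0, i, t, k),
      fun i => comb_mem_V1 fun t k => v (1, i, t, k)⟩, ?_⟩
    intro c p e l hl
    by_cases hlL : -(L : ℤ) ≤ l
    · rw [LinearMap.mem_ker, Matrix.mulVecLin_apply] at hv
      have := congrFun hv (c, p, e, ⟨(l + L).toNat, by omega⟩)
      rw [secMat_mulVec] at this
      rw [show ((((l + L).toNat : ℕ) : ℤ)) = l + L by omega, add_sub_cancel_right] at this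
      exact this
    · -- the equations for very negative exponents hold automatically
      have hs : InT S2 (-(W : ℤ) - N) (∑ d : Fin 2, ∑ q, twist ε (c : ℕ) (d : ℕ) * M p q *
          ![(combPair n N v).1, (combPair n N v).2] d q) := by
        refine InT.sum _ fun d _ => InT.sum _ fun q _ => ?_
        rw [combPair_apply]
        have h1 := ((InT_zero.2 (twist_mem_S2 ε (c : ℕ) (d : ℕ))).mul (hM p q)).mul
          (mem_V2_iff_InT.1 (comb_mem_V2 (fun t k => v (d, q, t, k))))
        exact h1.mono2 (by omega)
      rw [InT, mem_S2] at hs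
      have hsh : 0 ≤ shift ε (c : ℕ) := by rw [shift]; split_ifs <;> norm_num
      have := hs e (l - a - shift ε (c : ℕ) - (-W - N)) (by omega)
      rw [cf_tp_mul] at this
      rw [← this]; congr 1; ring
  · intro hf
    have hsh : shift ε 0 ≤ 1 := by rw [shift]; split_ifs <;> norm_num
    have hb := sec_bound hM' hD (twist_mem_S2 ε 1 0) hsh ha' hf
    have hb' : ∀ d i, ![f.1, f.2] d i ∈ V2 (N - 1) := by
      intro d i
      have e : (N : ℤ) - 1 = A + D + 1 := by rw [hN]; push_cast; ring
      rw [e]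
      fin_cases d
      exacts [(hb i).1, (hb i).2]
    have hv1 : ∀ d i, ![f.1, f.2] d i ∈ V1 := by
      intro d i
      fin_cases d
      exacts [hf.1 i, hf.2.1 i]
    obtain ⟨v, hv⟩ : ∃ v : Fin 2 × Fin n × Fin 2 × Fin N → ℝ, ∀ d q,
        (fun (t : Fin 2) (k : Fin N) => v (d, q, t, k)) =
          fun t (k : Fin N) => cf (![f.1, f.2] d q) t (-(((k : ℕ) : ℤ) + (t : ℕ))) :=
      ⟨fun x => cf (![f.1, f.2] x.1 x.2.1) x.2.2.1 (-(((x.2.2.2 : ℕ) : ℤ) + (x.2.2.1 : ℕ))),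
        fun _ _ => rfl⟩
    have hvf : combPair n N v = f := by
      have h : ∀ d q, ![(combPair n N v).1, (combPair n N v).2] d q = ![f.1, f.2] d q := by
        intro d q
        rw [combPair_apply, hv, comb_coeff (hv1 d q) (hb' d q)]
      exact Prod.ext (funext fun q => h 0 q) (funext fun q => h 1 q)
    refine ⟨v, ?_, hvf⟩
    rw [LinearMap.mem_ker, Matrix.mulVecLin_apply]
    funext r
    obtain ⟨c, p, e, l⟩ := r
    rw [secMat_mulVec, hvf]
    exact ((mem_sec_iff ε a M f).1 hf).2 c p e _ (by omega)

/-- The nullity of the linear equations is the dimension of the space of sections of the twist. -/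
theorem nullity_secMat {n : ℕ} {M M' : Matrix (Fin n) (Fin n) R12} (hM' : M' * M = 1) {W D : ℕ}
    (hM : ∀ i j, InT S2 (-(W : ℤ)) (M i j)) (hD : ∀ i j, InT S2 (-(D : ℤ)) (M' i j)) (ε : Bool)
    {a : ℤ} {A N L : ℕ} (hN : N = A + D + 2) (hL : L = A + N + W + 1) (ha : -(A + 1 : ℤ) ≤ a)
    (ha' : a ≤ A) {l : List ℤ} (hl : Eqv M (blockSum l)) :
    nullity (secMat ε a N L M) = sumDim l (2 * a + shift ε 0) := by
  rw [nullity, (Submodule.equivMapOfInjective _ (combPair_injective n N) _).finrank_eq,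
    map_ker_secMat hM' hM hD ε hN hL ha ha']
  apply Module.finrank_eq_of_rank_eq
  rw [rank_sec_eq _ _ _ hl]
  cases ε
  · have h1 : shift false 0 = 0 := by simp [shift]
    have h2 : twist false 1 0 = 0 := by simp [twist]
    rw [h1, h2, add_zero]
    exact rank_sec_blockSum_even l a
  · have h1 : shift true 0 = 1 := by simp [shift]
    have h2 : twist true 1 0 = xy := by simp [twist]
    rw [h1, h2]
    exact rank_sec_blockSum_odd l a

theorem nullity_reindex {ι κ ι' κ' : Type} [Fintype ι] [Fintype κ] [Fintype ι'] [Fintype κ']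
    [DecidableEq κ] [DecidableEq κ'] (A : Matrix ι κ ℝ) (e : ι' ≃ ι) (g : κ' ≃ κ) :
    nullity (A.submatrix e g) = nullity A := by
  have h : ∀ {ι κ : Type} [Fintype ι] [Fintype κ] [DecidableEq κ] (A : Matrix ι κ ℝ),
      A.rank + nullity A = Fintype.card κ := by
    intro ι κ _ _ _ A
    have := A.mulVecLin.finrank_range_add_finrank_ker
    rw [Module.finrank_fintype_fun_eq_card] at this
    exact this
  have h1 := h A
  have h2 := h (A.submatrix e g)
  rw [Matrix.rank_submatrix, Fintype.card_congr g] at h2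
  omega

/-- The parametrization of a box by products of `Fin`s. -/
def boxEquiv (n N : ℕ) (s : ℤ) : Fin 2 × Fin n × Fin 2 × Fin N ≃
    {c // c ∈ box [(0, 2), (0, (n : ℤ)), (0, 2), (-s, N - s)]} :=
  Equiv.ofBijective (fun x => ⟨[((x.1 : ℕ) : ℤ), ((x.2.1 : ℕ) : ℤ), ((x.2.2.1 : ℕ) : ℤ),
      ((x.2.2.2 : ℕ) : ℤ) - s], by
        simp only [cons_mem_box]
        exact ⟨by omega, by omega, by omega, by omega, nil_mem_box⟩⟩) (by
    constructor
    · rintro ⟨x1, x2, x3, x4⟩ ⟨y1, y2, y3, y4⟩ h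
      simp only [Subtype.mk.injEq, List.cons.injEq, Nat.cast_inj, and_true, sub_left_inj] at h
      obtain ⟨h1, h2, h3, h4⟩ := h
      simp only [Prod.mk.injEq]
      exact ⟨Fin.ext h1, Fin.ext h2, Fin.ext h3, Fin.ext h4⟩
    · rintro ⟨c, hc⟩
      obtain ⟨d, s1, rfl, hd, hs1⟩ := mem_box_cons.1 hc
      obtain ⟨q, s2, rfl, hq, hs2⟩ := mem_box_cons.1 hs1
      obtain ⟨t, s3, rfl, ht, hs3⟩ := mem_box_cons.1 hs2
      obtain ⟨k, s4, rfl, hk, hs4⟩ := mem_box_cons.1 hs3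
      rw [box, Finset.mem_singleton] at hs4
      subst hs4
      simp only at hd hq ht hk
      refine ⟨(⟨d.toNat, by omega⟩, ⟨q.toNat, by omega⟩, ⟨t.toNat, by omega⟩,
        ⟨(k + s).toNat, by omega⟩), ?_⟩
      apply Subtype.ext
      simp only [List.cons.injEq, and_true]
      omega)

theorem nullity_cell {n : ℕ} {M : Matrix (Fin n) (Fin n) R12} (ε : Bool) {a : ℤ} {N L : ℕ}
    (A : Matrix {r // r ∈ box (rowBox n L)} {c // c ∈ box (colBox n N)} ℝ)
    (hA : ∀ r c, A r c = cell ε a M (r.1 ++ c.1)) :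
    nullity A = nullity (secMat ε a N L M) := by
  have hr : [(0, 2), (0, (n : ℤ)), (0, 2), (-(L : ℤ), (L : ℤ) - L)] = rowBox n L := by
    simp
  have hc : [(0, 2), (0, (n : ℤ)), (0, 2), (-(0 : ℤ), (N : ℤ) - 0)] = colBox n N := by
    simp
  rw [← nullity_reindex A ((boxEquiv n L L).trans (Equiv.subtypeEquivRight fun x => by rw [hr]))
    ((boxEquiv n N 0).trans (Equiv.subtypeEquivRight fun x => by rw [hc]))]
  congr 1
  ext r c
  rw [Matrix.submatrix_apply, hA]
  change cell ε a M ([((r.1 : ℕ) : ℤ), ((r.2.1 : ℕ) : ℤ), ((r.2.2.1 : ℕ) : ℤ),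
    ((r.2.2.2 : ℕ) : ℤ) - L] ++ [((c.1 : ℕ) : ℤ), ((c.2.1 : ℕ) : ℤ), ((c.2.2.1 : ℕ) : ℤ),
    ((c.2.2.2 : ℕ) : ℤ) - 0]) = _
  simp only [List.cons_append, List.nil_append, cell, entry_coe, cfInt_coe, Int.toNat_natCast,
    secMat, Matrix.of_apply, sub_zero]

theorem card_colBox (n N : ℕ) : (box (colBox n N)).card = 4 * n * N := by
  have hc : [(0, 2), (0, (n : ℤ)), (0, 2), (-(0 : ℤ), (N : ℤ) - 0)] = colBox n N := by
    simp
  rw [← hc, ← Fintype.card_coe, ← Fintype.card_congr (boxEquiv n N 0)]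
  simp only [Fintype.card_prod, Fintype.card_fin]
  ring

open AlgRAM

/-! ### Output of the canonical form -/

theorem entry_of_not {n : ℕ} (M : Matrix (Fin n) (Fin n) R12) {p q : ℤ}
    (h : ¬((0 ≤ p ∧ p < n) ∧ 0 ≤ q ∧ q < n)) : entry M p q = 0 := dif_neg h

theorem entry_fromBlocks {a b : ℕ} (A : Matrix (Fin a) (Fin a) R12) (D : Matrix (Fin b) (Fin b) R12)
    (r c : ℤ) : entry ((Matrix.fromBlocks A 0 0 D).reindex finSumFinEquiv finSumFinEquiv) r c =
      entry A r c + entry D (r - a) (c - a) := by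
  by_cases h : (0 ≤ r ∧ r < (a + b : ℕ)) ∧ 0 ≤ c ∧ c < (a + b : ℕ)
  · obtain ⟨i, rfl⟩ : ∃ i : Fin (a + b), ((i : ℕ) : ℤ) = r := ⟨⟨r.toNat, by omega⟩, by simp; omega⟩
    obtain ⟨j, rfl⟩ : ∃ j : Fin (a + b), ((j : ℕ) : ℤ) = c := ⟨⟨c.toNat, by omega⟩, by simp; omega⟩
    rw [entry_coe, Matrix.reindex_apply, Matrix.submatrix_apply]
    obtain ⟨i, rfl⟩ := finSumFinEquiv.surjective i
    obtain ⟨j, rfl⟩ := finSumFinEquiv.surjective j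
    rw [Equiv.symm_apply_apply, Equiv.symm_apply_apply]
    rcases i with i | i <;> rcases j with j | j <;>
      simp only [finSumFinEquiv_apply_left, finSumFinEquiv_apply_right, Fin.val_castAdd,
        Fin.val_natAdd, Matrix.fromBlocks_apply₁₁, Matrix.fromBlocks_apply₁₂,
        Matrix.fromBlocks_apply₂₁, Matrix.fromBlocks_apply₂₂, Matrix.zero_apply]
    · rw [entry_coe, entry_of_not D (by omega), add_zero]
    · rw [entry_of_not A (by push_cast; omega), entry_of_not D (by omega), add_zero]
    · rw [entry_of_not A (by push_cast; omega), entry_of_not D (by omega), add_zero]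
    · rw [entry_of_not A (by push_cast; omega), zero_add]
      push_cast
      rw [add_sub_cancel_left, add_sub_cancel_left, entry_coe]
  · push_cast at h
    rw [entry_of_not _ (by push_cast; exact h), entry_of_not A (by omega),
      entry_of_not D (by omega), add_zero]

theorem entry_blockSum_append (l l' : List ℤ) (r c : ℤ) : entry (blockSum (l ++ l')) r c =
    entry (blockSum l) r c + entry (blockSum l') (r - totalSize l) (c - totalSize l) := by
  induction l generalizing r c with
  | nil =>
    rw [entry_of_not (blockSum []) (by simp only [totalSize]; omega)]
    simp [totalSize]
  | cons i l ih =>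
    have h1 := entry_fromBlocks (block i) (blockSum (l ++ l')) r c
    have h2 := entry_fromBlocks (block i) (blockSum l) r c
    change entry (blockSum (i :: (l ++ l'))) r c = _ at h1
    change entry (blockSum (i :: l)) r c = _ at h2
    rw [List.cons_append, h1, h2, ih, add_assoc, totalSize]
    push_cast
    rw [sub_sub, sub_sub]

theorem totalSize_append (l l' : List ℤ) : totalSize (l ++ l') = totalSize l + totalSize l' := by
  induction l with
  | nil => simp [totalSize]
  | cons i l ih => rw [List.cons_append, totalSize, totalSize, ih, add_assoc]

theorem entry_blockSum_singleton (i r c : ℤ) :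
    entry (blockSum [i]) r c = entry (block i) r c := by
  have h1 := entry_fromBlocks (block i) (blockSum []) r c
  change entry (blockSum [i]) r c = _ at h1
  rw [h1, entry_of_not (blockSum []) (by simp only [totalSize]; omega), add_zero]

theorem entry_block_even (b r c : ℤ) : entry (block (2 * b)) r c =
    if r = 0 ∧ c = 0 then (-1 : ℝ) ^ b • tp (-b) else 0 := by
  have hs := blockSize_even b
  split_ifs with h
  · obtain ⟨rfl, rfl⟩ := h
    rw [entry, dif_pos (by rw [hs]; norm_num), block_even_apply]
  · rw [entry_of_not]
    rw [hs]; omega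

theorem entry_block_odd (b r c : ℤ) : entry (block (2 * b + 1)) r c =
    if r = 0 ∧ c = 0 then (-1 : ℝ) ^ (b + 1) • tp (-b - 1)
    else if r = 0 ∧ c = 1 then (-1 : ℝ) ^ b • (xy * tp (-b - 1))
    else if r = 1 ∧ c = 1 then (-1 : ℝ) ^ b • tp (-b) else 0 := by
  have hs := blockSize_odd b
  by_cases h : (0 ≤ r ∧ r < (blockSize (2 * b + 1) : ℕ)) ∧ 0 ≤ c ∧ c < (blockSize (2 * b + 1) : ℕ)
  · rw [entry, dif_pos h]
    rw [hs] at h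
    obtain ⟨⟨hr, hr'⟩, hc, hc'⟩ := h
    have hr2 : r = 0 ∨ r = 1 := by push_cast at hr'; omega
    have hc2 : c = 0 ∨ c = 1 := by push_cast at hc'; omega
    rw [block_odd_apply]
    rcases hr2 with rfl | rfl <;> rcases hc2 with rfl | rfl <;> simp
  · rw [entry_of_not _ h]
    rw [hs] at h
    push_cast at h
    rw [if_neg (by omega), if_neg (by omega), if_neg (by omega)]

/-- Array `1` holds the block sum of `l`, and variable `10` its size. -/
structure Written (l : List ℤ) (σ : State ℝ) : Prop where
  pos : σ.int 10 = totalSize l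
  mem : ∀ r c (e : Fin 2) k, σ.mem 1 [r, c, ((e : ℕ) : ℤ), k] = cf (entry (blockSum l) r c) e k

theorem Written.congr {l : List ℤ} {σ τ : State ℝ} (h : Written l σ) {V W : List ℕ}
    (hag : Agree V W σ τ) (h1 : 10 ∉ V := by decide) (h2 : 1 ∉ W := by decide) : Written l τ :=
  ⟨by rw [hag.int _ h1, h.pos], by rw [hag.mem _ h2]; exact h.mem⟩

/-- The program that writes a block of index `2a` or `2a + 1`, where `a` is in variable `6` and
the sign `(-1) ^ a` is in array `6`. -/
def emitBlock : Bool → Prog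
  | false => .setField 1 [.var 10, .var 10, .const 0, .sub (.const 0) (.var 6)] (.get 6 [])
  | true => .seq (.setField 1 [.var 10, .var 10, .const 0, .sub (.const (-1)) (.var 6)]
        (.sub .zero (.get 6 [])))
      (.seq (.setField 1 [.var 10, .add (.var 10) (.const 1), .const 1,
          .sub (.const (-1)) (.var 6)] (.get 6 []))
        (.setField 1 [.add (.var 10) (.const 1), .add (.var 10) (.const 1), .const 0,
          .sub (.const 0) (.var 6)] (.get 6 [])))

/-- The index `2a` or `2a + 1` of the block that is written by `emitBlock ε`. -/
def index (ε : Bool) (a : ℤ) : ℤ := 2 * a + shift ε 0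

theorem cf_smul_tp (x : ℝ) (m : ℤ) (e : Fin 2) (k : ℤ) :
    cf (x • tp m) e k = if e = 0 ∧ k = m then x else 0 := by
  rw [cf_smul, ← mul_one (tp m), cf_tp_mul]
  fin_cases e
  · simp [cf_one_zero, sub_eq_zero]
  · simp [cf_one_one]

theorem cf_smul_xy_tp (x : ℝ) (m : ℤ) (e : Fin 2) (k : ℤ) :
    cf (x • (xy * tp m)) e k = if e = 1 ∧ k = m then x else 0 := by
  rw [cf_smul, mul_comm xy, cf_tp_mul]
  conv_lhs => rw [← mul_one xy]
  fin_cases e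
  · change x * cf (xy * 1) 0 _ = _
    rw [cf_xy_mul_zero, cf_one_one, cf_one_one]; simp
  · change x * cf (xy * 1) 1 _ = _
    rw [cf_xy_mul_one, cf_one_zero]; simp [sub_eq_zero]

theorem cf_block_even (b r c : ℤ) (e : Fin 2) (k : ℤ) : cf (entry (block (2 * b)) r c) e k =
    if r = 0 ∧ c = 0 ∧ e = 0 ∧ k = -b then (-1 : ℝ) ^ b else 0 := by
  rw [entry_block_even]
  by_cases h : r = 0 ∧ c = 0
  · rw [if_pos h, cf_smul_tp]
    simp [h.1, h.2]
  · rw [if_neg h, cf_zero, if_neg (by tauto)]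

theorem cf_block_odd (b r c : ℤ) (e : Fin 2) (k : ℤ) : cf (entry (block (2 * b + 1)) r c) e k =
    if r = 1 ∧ c = 1 ∧ e = 0 ∧ k = -b then (-1 : ℝ) ^ b
    else if r = 0 ∧ c = 1 ∧ e = 1 ∧ k = -b - 1 then (-1) ^ b
    else if r = 0 ∧ c = 0 ∧ e = 0 ∧ k = -b - 1 then -(-1) ^ b else 0 := by
  have hpow : ((-1 : ℝ)) ^ (b + 1) = -(-1) ^ b := by
    rw [zpow_add_one₀ (by norm_num)]; ring
  rw [entry_block_odd]
  by_cases h1 : r = 0 ∧ c = 0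
  · rw [if_pos h1, cf_smul_tp]
    simp [h1.1, h1.2, hpow]
  rw [if_neg h1]
  by_cases h2 : r = 0 ∧ c = 1
  · rw [if_pos h2, cf_smul_xy_tp]
    simp [h2.1, h2.2]
  rw [if_neg h2]
  by_cases h3 : r = 1 ∧ c = 1
  · rw [if_pos h3, cf_smul_tp]
    simp [h3.1, h3.2]
  rw [if_neg h3, cf_zero, if_neg (by tauto), if_neg (by tauto), if_neg (by tauto)]

/-- A bound for the cost of `emitBlock`. -/
def emitBlockCost : Bool → ℕ
  | false => 9
  | true => 40

theorem emitBlock_spec (ε : Bool) {l : List ℤ} {σ : State ℝ} {a : ℤ} (h : Written l σ)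
    (ha : σ.int 6 = a) (hs : σ.mem 6 [] = (-1) ^ a) :
    ∃ τ, Runs (emitBlock ε) σ τ (emitBlockCost ε) ∧ ∀ r c (e : Fin 2) k,
      τ.mem 1 [r, c, ((e : ℕ) : ℤ), k] = cf (entry (blockSum (l ++ [index ε a])) r c) e k := by
  have hz : ∀ r c e k, ((totalSize l : ℤ) ≤ r ∨ (totalSize l : ℤ) ≤ c) →
      cf (entry (blockSum l) r c) e k = 0 := by
    intro r c e k hrc
    rw [entry_of_not, cf_zero]
    omega
  have he : ∀ r c, entry (blockSum (l ++ [index ε a])) r c = entry (blockSum l) r c +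
      entry (block (index ε a)) (r - totalSize l) (c - totalSize l) := by
    intro r c
    rw [entry_blockSum_append, entry_blockSum_singleton]
  cases ε
  · refine ⟨_, (Runs.setField 1 _ _ σ).mono (by simp [IExpr.cost, FExpr.cost, emitBlockCost]), ?_⟩
    intro r c e k
    have hi : index false a = 2 * a := by simp [index, shift]
    have hX := hz r c e k
    rw [he, cf_add, hi, cf_block_even]
    simp only [List.map_cons, List.map_nil, IExpr.eval, FExpr.eval, h.pos, ha, hs, State.setMem,
      Function.update_self, Function.update_apply, List.cons.injEq, and_true, h.mem]
    have hcond : (r = totalSize l ∧ c = totalSize l ∧ ((e : ℕ) : ℤ) = 0 ∧ k = 0 - a) ↔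
        (r - totalSize l = 0 ∧ c - totalSize l = 0 ∧ e = 0 ∧ k = -a) := by
      rw [Fin.ext_iff, Fin.val_zero]; omega
    simp only [hcond]
    split_ifs with h1
    · rw [hX (by omega), zero_add]
    · rw [add_zero]
  · refine ⟨_, ((Runs.setField 1 _ _ σ).seq ((Runs.setField 1 _ _ _).seq
      (Runs.setField 1 _ _ _))).mono (by simp [IExpr.cost, FExpr.cost, emitBlockCost]), ?_⟩
    intro r c e k
    have hi : index true a = 2 * a + 1 := by simp [index, shift]
    have hX := hz r c e k
    rw [he, cf_add, hi, cf_block_odd]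
    simp only [List.map_cons, List.map_nil, IExpr.eval, FExpr.eval, h.pos, ha, hs, State.setMem,
      Function.update_self, Function.update_apply, List.cons.injEq, and_true, h.mem,
      if_neg (show (6 : ℕ) ≠ 1 by norm_num)]
    have hc1 : (r = totalSize l + 1 ∧ c = totalSize l + 1 ∧ ((e : ℕ) : ℤ) = 0 ∧ k = 0 - a) ↔
        (r - totalSize l = 1 ∧ c - totalSize l = 1 ∧ e = 0 ∧ k = -a) := by
      rw [Fin.ext_iff, Fin.val_zero]; omega
    have hc2 : (r = totalSize l ∧ c = totalSize l + 1 ∧ ((e : ℕ) : ℤ) = 1 ∧ k = -1 - a) ↔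
        (r - totalSize l = 0 ∧ c - totalSize l = 1 ∧ e = 1 ∧ k = -a - 1) := by
      rw [Fin.ext_iff, Fin.val_one]; omega
    have hc3 : (r = totalSize l ∧ c = totalSize l ∧ ((e : ℕ) : ℤ) = 0 ∧ k = -1 - a) ↔
        (r - totalSize l = 0 ∧ c - totalSize l = 0 ∧ e = 0 ∧ k = -a - 1) := by
      rw [Fin.ext_iff, Fin.val_zero]; omega
    simp only [hc1, hc2, hc3]
    split_ifs with h1 h2 h3
    · rw [hX (by omega), zero_add]
    · rw [hX (by omega), zero_add]
    · rw [hX (by omega), zero_add, zero_sub]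
    · rw [add_zero]

/-- Blocks are written as long as the counter in variable `11` is positive. -/
def emit (ε : Bool) : Prog :=
  .while (.le (.const 1) (.var 11)) (.seq (emitBlock ε)
    (.seq (.setInt 11 (.sub (.var 11) (.const (2 * blockSize (index ε 0)))))
      (.setInt 10 (.add (.var 10) (.const (blockSize (index ε 0)))))))

theorem blockSize_index (ε : Bool) (a : ℤ) : blockSize (index ε a) = blockSize (index ε 0) := by
  cases ε
  · simp [index, shift, blockSize]
  · simp [index, shift, blockSize]

theorem emitBlock_ints (ε : Bool) : (emitBlock ε).ints = [] := by cases ε <;> rfl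

theorem emitBlock_arrs (ε : Bool) : (emitBlock ε).arrs ⊆ [1] := by cases ε <;> decide

theorem emit_spec (ε : Bool) {a : ℤ} (m : ℕ) {l : List ℤ} {σ : State ℝ} (h : Written l σ)
    (ha : σ.int 6 = a) (hs : σ.mem 6 [] = (-1) ^ a)
    (hm : σ.int 11 = 2 * blockSize (index ε a) * m) :
    ∃ τ, Runs (emit ε) σ τ (4 + m * (emitBlockCost ε + 12)) ∧
      Written (l ++ List.replicate m (index ε a)) τ := by
  induction m generalizing l σ with
  | zero =>
    refine ⟨σ, ⟨_, ?_, .while_false ?_⟩, by simpa using h⟩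
    · simp [Test.cost, IExpr.cost]
    · simp [Test.eval, IExpr.eval, hm]
  | succ m ih =>
    obtain ⟨σ₁, run₁, h₁⟩ := emitBlock_spec ε h ha hs
    have ag₁ : Agree [] [1] σ σ₁ := run₁.agree.mono (by rw [emitBlock_ints]; simp) (emitBlock_arrs ε)
    have run₂ := Runs.setInt 11 (.sub (.var 11) (.const (2 * blockSize (index ε 0)))) σ₁
    set σ₂ := σ₁.setInt 11 (IExpr.eval σ₁ (.sub (.var 11) (.const (2 * blockSize (index ε 0)))))
      with hσ₂
    have ag₂ : Agree [11] [] σ₁ σ₂ := run₂.agree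
    have run₃ := Runs.setInt 10 (.add (.var 10) (.const (blockSize (index ε 0)))) σ₂
    set σ₃ := σ₂.setInt 10 (IExpr.eval σ₂ (.add (.var 10) (.const (blockSize (index ε 0)))))
      with hσ₃
    have ag₃ : Agree [10] [] σ₂ σ₃ := run₃.agree
    have e10 : σ₃.int 10 = totalSize (l ++ [index ε a]) := by
      have : σ₃.int 10 = σ₂.int 10 + blockSize (index ε 0) := by
        simp [hσ₃, State.setInt, IExpr.eval]
      rw [this, ag₂.int 10 (by decide), ag₁.int 10 (by decide), h.pos, totalSize_append,
        totalSize, totalSize, blockSize_index ε a]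
      push_cast; ring
    have e11 : σ₃.int 11 = 2 * blockSize (index ε a) * m := by
      have : σ₂.int 11 = σ₁.int 11 - 2 * blockSize (index ε 0) := by
        simp [hσ₂, State.setInt, IExpr.eval]
      rw [ag₃.int 11 (by decide), this, ag₁.int 11 (by decide), hm, blockSize_index ε a]
      push_cast; ring
    obtain ⟨τ, ⟨s, hs', run⟩, hτ⟩ := ih (l := l ++ [index ε a]) (σ := σ₃)
      ⟨e10, fun r c e k => by
        rw [ag₃.mem 1 (by decide), ag₂.mem 1 (by decide)]; exact h₁ r c e k⟩
      (by rw [ag₃.int 6 (by decide), ag₂.int 6 (by decide), ag₁.int 6 (by decide), ha])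
      (by rw [ag₃.mem 6 (by decide), ag₂.mem 6 (by decide), ag₁.mem 6 (by decide), hs]) e11
    obtain ⟨s1, hs1, r1⟩ := run₁.seq (run₂.seq run₃)
    refine ⟨τ, ⟨_, ?_, .while_true ?_ r1 run⟩, ?_⟩
    · simp only [Test.cost, IExpr.cost] at hs1 ⊢
      rw [Nat.succ_mul]
      omega
    · simp only [Test.eval, IExpr.eval, hm]
      have : 0 < blockSize (index ε a) := by rw [blockSize]; split_ifs <;> norm_num
      push_cast
      nlinarith
    · rw [List.append_assoc] at hτ
      rw [List.replicate_succ]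
      exact hτ

open AlgRAM

/-! ### The complete program -/

/-- Computes the rank of the system of linear equations for the twist of index `index ε a`, where
`a` is in variable `6`. The result is in variable `7`. -/
def rankProg (ε : Bool) : Prog := .seq (fill ε) eliminate

/-- The cost of `rankProg`. -/
def rankCost (ε : Bool) : ℕ[X] := fillListCost ε quads + eliminateCost

theorem rankProg_ints (ε : Bool) : (rankProg ε).ints ⊆
    [7, 20, 21, 22, 23, 24, 25, 26, 27, 30, 31, 32, 33, 34, 35, 36, 37] := by
  rw [rankProg, Prog.ints, List.append_subset]
  exact ⟨List.Subset.trans (fillList_ints ε quads) (by decide), by decide⟩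

theorem rankProg_arrs (ε : Bool) : (rankProg ε).arrs ⊆ [2, 4, 5] := by
  rw [rankProg, Prog.arrs, List.append_subset]
  exact ⟨List.Subset.trans (fillList_arrs ε quads) (by decide), by decide⟩

theorem rankProg_spec {n A N L B : ℕ} {M : Matrix (Fin n) (Fin n) R12} {l : List ℤ} {a : ℤ}
    (ε : Bool) (h2 : 2 ≤ B) (hn : n ≤ B) (hN : N ≤ B) (hL : L ≤ B) {σ : State ℝ}
    (h : Par n A N L σ) (hM : σ.mem 0 = (inputState M).mem 0) (ha : σ.int 6 = a)
    (hl : nullity (secMat ε a N L M) = sumDim l (index ε a)) :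
    ∃ τ, Runs (rankProg ε) σ τ ((rankCost ε).eval B) ∧
      τ.int 7 = 4 * n * N - sumDim l (index ε a) := by
  obtain ⟨σ₁, run₁, h₁⟩ := fill_spec ε h2 hn hN hL h hM ha
  have ag₁ : Agree [30, 31, 32, 33, 34, 35, 36, 37] [2] σ σ₁ :=
    run₁.agree.mono (fillList_ints ε quads) (fillList_arrs ε quads)
  obtain ⟨τ, run₂, h₂⟩ := eliminate_spec (h.congr ag₁) h2 hn hN hL
  refine ⟨τ, (run₁.seq run₂).mono (by rw [rankCost, eval_add]), ?_⟩
  rw [nullity_cell ε (mat n N L σ₁) fun r c => h₁ r.1 r.2 c.1 c.2, hl, card_colBox] at h₂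
  push_cast at h₂
  linarith

/-- Writes the blocks of index `index ε a`, where `a` is in variable `6`. Variables `8` and `9`
hold the ranks for the two preceding indices; the second difference of the ranks is the
number of the blocks times twice their size, and serves as a counter for `emit`. -/
def stepProg (ε : Bool) : Prog :=
  .seq (rankProg ε)
    (.seq (.setInt 11 (.sub (.add (.var 8) (.var 8)) (.add (.var 7) (.var 9))))
      (.seq (emit ε) (.seq (.setInt 9 (.var 8)) (.setInt 8 (.var 7)))))

/-- The cost of `stepProg`. -/
def stepCost (ε : Bool) : ℕ[X] := rankCost ε + (C 8 + (C 4 + X * C (emitBlockCost ε + 12) + C 4))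

/-- The integer variables other than `6` and the parameters that occur in the main loop. -/
abbrev stepVars : List ℕ :=
  [7, 8, 9, 10, 11, 20, 21, 22, 23, 24, 25, 26, 27, 30, 31, 32, 33, 34, 35, 36, 37]

theorem emit_ints (ε : Bool) : (emit ε).ints = [11, 10] := by
  simp [emit, Prog.ints, emitBlock_ints]

theorem emit_arrs (ε : Bool) : (emit ε).arrs ⊆ [1] := by
  simpa [emit, Prog.arrs] using emitBlock_arrs ε

theorem stepProg_ints (ε : Bool) : (stepProg ε).ints ⊆ stepVars := by
  simp only [stepProg, Prog.ints, List.append_subset, emit_ints]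
  exact ⟨List.Subset.trans (rankProg_ints ε) (by decide), by decide, by decide, by decide, by decide⟩

theorem stepProg_arrs (ε : Bool) : (stepProg ε).arrs ⊆ [1, 2, 4, 5] := by
  simp only [stepProg, Prog.arrs, List.append_subset]
  exact ⟨List.Subset.trans (rankProg_arrs ε) (by decide), by simp, List.Subset.trans (emit_arrs ε) (by decide), by simp,
    by simp⟩

/-- In an ascending list, the entries equal to `j` follow those less than `j`. -/
theorem filter_lt_add_one {l : List ℤ} (hl : l.SortedLE) (j : ℤ) :
    l.filter (· < j + 1) = l.filter (· < j) ++ List.replicate (l.count j) j := by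
  replace hl := hl.pairwise
  induction l with
  | nil => simp
  | cons i l ih =>
    rw [List.pairwise_cons] at hl
    have ih := ih hl.2
    rcases lt_trichotomy i j with h | rfl | h
    · rw [List.filter_cons_of_pos (by simp; omega), List.filter_cons_of_pos (by simpa using h),
        List.count_cons_of_ne h.ne, ih, List.cons_append]
    · have h0 : l.filter (· < i) = [] := by
        simpa [List.filter_eq_nil_iff] using hl.1
      rw [List.filter_cons_of_pos (by simp), List.filter_cons_of_neg (by simp),
        List.count_cons_self, ih, h0, List.replicate_succ, List.nil_append, List.nil_append]
    · rw [List.filter_cons_of_neg (by simp; omega), List.filter_cons_of_neg (by simp; omega),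
        List.count_cons_of_ne h.ne', ih]

/-- The blocks of index less than `j` have been written, and the ranks for the indices `j - 1` and
`j - 2` are known. -/
structure Progress (n N : ℕ) (l : List ℤ) (j : ℤ) (σ : State ℝ) : Prop where
  prev : σ.int 8 = 4 * n * N - sumDim l (j - 1)
  prev_prev : σ.int 9 = 4 * n * N - sumDim l (j - 2)
  written : Written (l.filter (· < j)) σ

theorem Progress.congr {n N : ℕ} {l : List ℤ} {j : ℤ} {σ τ : State ℝ} (h : Progress n N l j σ)
    {V W : List ℕ} (hag : Agree V W σ τ) (h8 : 8 ∉ V := by decide) (h9 : 9 ∉ V := by decide)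
    (h10 : 10 ∉ V := by decide) (h1 : 1 ∉ W := by decide) : Progress n N l j τ :=
  ⟨by rw [hag.int _ h8, h.prev], by rw [hag.int _ h9, h.prev_prev], h.written.congr hag h10 h1⟩

/-- The counter is `2ρ(j - 1) - ρ(j) - ρ(j - 2)` for the rank `ρ = 4nN - sumDim l`, which is twice the size
of the blocks times the multiplicity of `j`, by `sumDim_second_difference`. -/
theorem stepProg_spec {n A N L B : ℕ} {M : Matrix (Fin n) (Fin n) R12} {l : List ℤ} {a : ℤ}
    (ε : Bool) (h2 : 2 ≤ B) (hn : n ≤ B) (hN : N ≤ B) (hL : L ≤ B) {σ : State ℝ}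
    (h : Par n A N L σ) (hM : σ.mem 0 = (inputState M).mem 0) (ha : σ.int 6 = a)
    (hl : nullity (secMat ε a N L M) = sumDim l (index ε a)) (hs : l.SortedLE)
    (hc : l.length ≤ B) (hsign : σ.mem 6 [] = (-1) ^ a) (hp : Progress n N l (index ε a) σ) :
    ∃ τ, Runs (stepProg ε) σ τ ((stepCost ε).eval B) ∧ Progress n N l (index ε a + 1) τ := by
  obtain ⟨σ₁, run₁, h₁⟩ := rankProg_spec ε h2 hn hN hL h hM ha hl
  have ag₁ := run₁.agree.mono (rankProg_ints ε) (rankProg_arrs ε)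
  have p₁ := hp.congr ag₁
  have run₂ := Runs.setInt 11 (.sub (.add (.var 8) (.var 8)) (.add (.var 7) (.var 9))) σ₁
  set σ₂ := σ₁.setInt 11 (IExpr.eval σ₁ (.sub (.add (.var 8) (.var 8)) (.add (.var 7) (.var 9))))
    with hσ₂
  have ag₂ : Agree [11] [] σ₁ σ₂ := run₂.agree
  have e11 : σ₂.int 11 = 2 * blockSize (index ε a) * (l.count (index ε a) : ℕ) := by
    have : σ₂.int 11 = σ₁.int 8 + σ₁.int 8 - (σ₁.int 7 + σ₁.int 9) := by
      simp [hσ₂, State.setInt, IExpr.eval]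
    rw [this, p₁.prev, p₁.prev_prev, h₁, ← sumDim_second_difference]
    ring
  obtain ⟨σ₃, run₃, h₃⟩ := emit_spec ε (l.count (index ε a)) (p₁.congr ag₂).written
    (by rw [ag₂.int 6 (by decide), ag₁.int 6 (by decide), ha])
    (by rw [ag₂.mem 6 (by decide), ag₁.mem 6 (by decide), hsign]) e11
  rw [← filter_lt_add_one hs] at h₃
  have ag₃ : Agree [11, 10] [1] σ₂ σ₃ := run₃.agree.mono (by rw [emit_ints]; simp) (emit_arrs ε)
  have run₄ := Runs.setInt 9 (.var 8) σ₃
  set σ₄ := σ₃.setInt 9 (IExpr.eval σ₃ (.var 8)) with hσ₄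
  have ag₄ : Agree [9] [] σ₃ σ₄ := run₄.agree
  have run₅ := Runs.setInt 8 (.var 7) σ₄
  set σ₅ := σ₄.setInt 8 (IExpr.eval σ₄ (.var 7)) with hσ₅
  have ag₅ : Agree [8] [] σ₄ σ₅ := run₅.agree
  refine ⟨σ₅, (run₁.seq (run₂.seq (run₃.seq (run₄.seq run₅)))).mono ?_, ?_, ?_, ?_⟩
  · have hm : l.count (index ε a) * (emitBlockCost ε + 12) ≤ B * (emitBlockCost ε + 12) :=
      Nat.mul_le_mul_right _ (List.count_le_length.trans hc)
    simp only [stepCost, eval_add, eval_mul, eval_C, eval_X, IExpr.cost]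
    omega
  · have : σ₅.int 8 = σ₄.int 7 := by simp [hσ₅, State.setInt, IExpr.eval]
    rw [this, ag₄.int 7 (by decide), ag₃.int 7 (by decide), ag₂.int 7 (by decide), h₁,
      add_sub_cancel_right]
  · have : σ₄.int 9 = σ₃.int 8 := by simp [hσ₄, State.setInt, IExpr.eval]
    rw [ag₅.int 9 (by decide), this, ag₃.int 8 (by decide), ag₂.int 8 (by decide), p₁.prev]
    congr 3
    ring
  · exact (h₃.congr ag₄).congr ag₅

/-- Writes the canonical form, block by block. -/
def mainLoop : Prog := forLoop 6 (.sub (.const 0) (.var 3)) (.var 3)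
  (.seq (stepProg false) (.seq (stepProg true) (.setField 6 [] (.sub .zero (.get 6 [])))))

/-- The cost of `mainLoop`. -/
def mainLoopCost : ℕ[X] := C 14 + X * (stepCost false + (stepCost true + C 4) + C 11)

theorem mainLoop_spec {n A N L B : ℕ} {M : Matrix (Fin n) (Fin n) R12} {l : List ℤ}
    (h2 : 2 ≤ B) (hn : n ≤ B) (hA : 2 * A ≤ B) (hN : N ≤ B) (hL : L ≤ B) {σ : State ℝ}
    (h : Par n A N L σ) (hM : σ.mem 0 = (inputState M).mem 0)
    (hl : ∀ ε a, -(A + 1 : ℤ) ≤ a → a ≤ A →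
      nullity (secMat ε a N L M) = sumDim l (index ε a)) (hs : l.SortedLE)
    (hc : l.length ≤ B) (hsign : σ.mem 6 [] = (-1) ^ (-A : ℤ))
    (hp : Progress n N l (2 * (-A : ℤ)) σ) :
    ∃ τ, Runs mainLoop σ τ (mainLoopCost.eval B) ∧ Progress n N l (2 * (A : ℤ)) τ := by
  have hints : ∀ v ∉ stepVars, v ∉ (Prog.seq (stepProg false) (.seq (stepProg true)
      (.setField 6 [] (.sub .zero (.get 6 []))))).ints := by
    intro v hv h'
    simp only [Prog.ints, List.mem_append, List.not_mem_nil, or_false] at h'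
    rcases h' with h' | h'
    · exact hv (stepProg_ints _ h')
    · exact hv (stepProg_ints _ h')
  obtain ⟨τ, run, hτ⟩ := forLoop_rule (v := 6) (lo := .sub (.const 0) (.var 3)) (hi := .var 3)
    (B := B) (c := (stepCost false + (stepCost true + C 4)).eval B) (σ₀ := σ)
    (l := -(A : ℤ)) (h := A)
    (P := .seq (stepProg false) (.seq (stepProg true) (.setField 6 [] (.sub .zero (.get 6 [])))))
    (fun a τ => Progress n N l (2 * a) τ ∧ τ.mem 6 [] = (-1) ^ a)
    (by simp [IExpr.eval, h.A]) h.A (by omega) (by omega) (hints 6 (by decide))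
    (by
      intro u hu
      simp only [IExpr.vars, List.mem_singleton] at hu
      subst hu
      exact ⟨by decide, hints 3 (by decide)⟩)
    (fun a τ x hτ => ⟨hτ.1.congr (Agree.setInt τ 6 x), hτ.2⟩) ⟨hp, hsign⟩
    (by
      intro a σ' ha ha' hag h6 ⟨hp', hs'⟩
      have hag' : Agree (6 :: stepVars) [1, 2, 4, 5, 6] σ σ' := by
        refine hag.mono ?_ ?_
        · intro v hv
          by_contra hv'
          rw [List.mem_cons, not_or] at hv'
          rcases List.mem_cons.1 hv with hv | hv
          · exact hv'.1 hv
          · exact hints v hv'.2 hv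
        · simp only [Prog.arrs, List.append_subset]
          exact ⟨List.Subset.trans (stepProg_arrs _) (by decide), List.Subset.trans (stepProg_arrs _) (by decide),
            by decide⟩
      have h' := h.congr hag'
      have hM' : σ'.mem 0 = (inputState M).mem 0 := by rw [hag'.mem 0 (by decide), hM]
      have i0 : index false a = 2 * a := by simp [index, shift]
      have i1 : index true a = 2 * a + 1 := by simp [index, shift]
      obtain ⟨σ₁, run₁, p₁⟩ := stepProg_spec false h2 hn hN hL h' hM' h6
        (hl _ _ (by omega) (by omega)) hs hc hs' (by rw [i0]; exact hp')
      have ag₁ := run₁.agree.mono (stepProg_ints _) (stepProg_arrs _)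
      have s₁ : σ₁.mem 6 [] = (-1) ^ a := by rw [ag₁.mem 6 (by decide), hs']
      rw [i0] at p₁
      obtain ⟨σ₂, run₂, p₂⟩ := stepProg_spec true h2 hn hN hL (h'.congr ag₁)
        (by rw [ag₁.mem 0 (by decide), hM']) (by rw [ag₁.int 6 (by decide), h6])
        (hl _ _ (by omega) (by omega)) hs hc s₁ (by rw [i1]; exact p₁)
      have ag₂ := run₂.agree.mono (stepProg_ints _) (stepProg_arrs _)
      have run₃ := Runs.setField 6 [] (.sub .zero (.get 6 [])) σ₂
      refine ⟨_, (run₁.seq (run₂.seq run₃)).mono ?_, ?_, ?_⟩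
      · simp only [eval_add, eval_C, FExpr.cost, List.map_nil, List.sum_nil]
        omega
      · rw [i1] at p₂
        have e : 2 * (a + 1) = 2 * a + 1 + 1 := by ring
        rw [e]
        exact p₂.congr run₃.agree (by decide) (by decide) (by decide) (by decide)
      · simp only [State.setMem, List.map_nil, Function.update_self, FExpr.eval]
        rw [ag₂.mem 6 (by decide), s₁, zpow_add_one₀ (by norm_num)]
        ring)
  refine ⟨τ, run.mono ?_, hτ.1⟩
  simp only [mainLoopCost, eval_add, eval_mul, eval_C, eval_X, IExpr.cost]
  rw [Nat.add_assoc _ 1 10]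

/-- Computes the parameters of the main loop from `n` and the width `w`. Since multiplication of
integers is not an operation of the machine, `n w` is obtained by a loop. With `C = 2 n w + n`, which
bounds the exponents of the inverse matrix, the parameters are `A = 2 C + 4`, `N = A + C + 2` and `L = A + N + w + 1`. -/
def setup : Prog :=
  .seq (forLoop 12 (.const 0) (.var 1) (.setInt 2 (.add (.var 2) (.var 0))))
    (.seq (.setInt 2 (.add (.add (.var 2) (.var 2)) (.var 0)))
      (.seq (.setInt 3 (.add (.add (.var 2) (.var 2)) (.const 4)))
        (.seq (.setInt 4 (.add (.add (.var 3) (.var 2)) (.const 2)))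
          (.seq (.setInt 5 (.add (.add (.add (.var 3) (.var 4)) (.var 1)) (.const 1)))
            (.setInt 6 (.sub (.const (-1)) (.var 3)))))))

/-- The cost of `setup`. -/
def setupCost : ℕ[X] := C 42 + X * C 15

theorem setup_spec {n w C A N L B : ℕ} (hC : C = 2 * n * w + n) (hA : A = 2 * C + 4)
    (hN : N = A + C + 2) (hL : L = A + N + w + 1) (hw : w ≤ B) {σ : State ℝ}
    (h0 : σ.int 0 = n) (h1 : σ.int 1 = w) (h2 : σ.int 2 = 0) :
    ∃ τ, Runs setup σ τ (setupCost.eval B) ∧ Par n A N L τ ∧ τ.int 6 = -(A : ℤ) - 1 := by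
  obtain ⟨σ₁, run₁, e2⟩ := forLoop_rule (v := 12) (lo := .const 0) (hi := .var 1)
    (P := .setInt 2 (.add (.var 2) (.var 0))) (B := B) (c := 4) (σ₀ := σ) (l := 0) (h := w)
    (fun i τ => τ.int 2 = n * i) rfl h1 (by omega) (by omega) (by decide) (by decide)
    (fun i τ x h => by
      rw [(Agree.setInt τ 12 x).int 2 (by decide)]; exact h) (by simpa using h2)
    (by
      intro i τ _ _ hag _ h
      refine ⟨_, Runs.setInt 2 (.add (.var 2) (.var 0)) τ, ?_⟩
      have : τ.int 0 = n := by rw [hag.int 0 (by decide), h0]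
      simp only [State.setInt, Function.update_self, IExpr.eval, h, this]
      ring)
  have ag₁ : Agree [12, 2] [] σ σ₁ := run₁.agree.mono (by decide) (by decide)
  have e0 : σ₁.int 0 = n := by rw [ag₁.int 0 (by decide), h0]
  have e1 : σ₁.int 1 = w := by rw [ag₁.int 1 (by decide), h1]
  refine ⟨_, (run₁.seq ((Runs.setInt _ _ _).seq ((Runs.setInt _ _ _).seq
    ((Runs.setInt _ _ _).seq ((Runs.setInt _ _ _).seq (Runs.setInt _ _ _)))))).mono ?_, ⟨?_, ?_, ?_, ?_⟩, ?_⟩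
  · simp only [setupCost, eval_add, eval_mul, eval_C, eval_X, IExpr.cost]
    omega
  all_goals
    simp [State.setInt, IExpr.eval, e0, e1, e2, hL, hN, hA, hC]
  all_goals ring

/-- The complete program. It reads the size `n` in variable `0`, the width `w` in variable `1`, and the
matrix in array `0`, and leaves the canonical form in array `1`. Initially the ranks for the indices
`-2A - 2` and `-2A - 1` are computed, so that the main loop may start with the index `-2A`. -/
def canonicalForm : Prog :=
  .seq setup (.seq (rankProg false) (.seq (.setInt 9 (.var 7)) (.seq (rankProg true)
    (.seq (.setInt 8 (.var 7)) (.seq (.setField 6 [] .one) (.seq mainLoop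
      (.setInt 1 (.add (.var 3) (.const 2)))))))))

/-- The cost of `canonicalForm`. -/
def canonicalFormCost : ℕ[X] :=
  setupCost + (rankCost false + (C 2 + (rankCost true + (C 2 + (C 2 + (mainLoopCost + C 4))))))

theorem length_le_totalSize (l : List ℤ) : l.length ≤ totalSize l := by
  induction l with
  | nil => simp [totalSize]
  | cons i l ih =>
    have : 1 ≤ blockSize i := by rw [blockSize]; split_ifs <;> norm_num
    rw [totalSize, List.length_cons]
    omega

theorem mainLoop_ints : mainLoop.ints ⊆ 6 :: stepVars := by
  intro v hv
  simp only [mainLoop, forLoop, Prog.ints, List.mem_append, List.mem_singleton, List.not_mem_nil,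
    or_false] at hv
  rcases hv with hv | (hv | hv) | hv
  · simp [hv]
  · exact List.mem_cons_of_mem _ (stepProg_ints _ hv)
  · exact List.mem_cons_of_mem _ (stepProg_ints _ hv)
  · simp [hv]

theorem canonicalForm_spec {n w D A N L : ℕ} (hD : D = 2 * n * w + n) (hA : A = 2 * D + 4)
    (hN : N = A + D + 2) (hL : L = A + N + w + 1) {M : Matrix (Fin n) (Fin n) R12}
    (hw : width M = w) {l : List ℤ} (hs : l.SortedLE) (hlen : l.length ≤ n)
    (hl : ∀ ε a, -(A + 1 : ℤ) ≤ a → a ≤ A →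
      nullity (secMat ε a N L M) = sumDim l (index ε a))
    (hmem : ∀ i ∈ l, -2 * (A : ℤ) ≤ i ∧ i < 2 * A) :
    ∃ τ, Runs canonicalForm (inputState M) τ (canonicalFormCost.eval L) ∧
      τ.int 1 = A + 2 ∧ Written l τ := by
  have h2 : 2 ≤ L := by omega
  have hn : n ≤ L := by omega
  have hN' : N ≤ L := by omega
  obtain ⟨σ₁, run₁, h₁, e6⟩ := setup_spec hD hA hN hL (B := L) (by omega) (σ := inputState M) rfl
    (by simp [inputState, hw]) rfl
  have ag₁ : Agree [12, 2, 3, 4, 5, 6] [] (inputState M) σ₁ :=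
    run₁.agree.mono (by decide) (by decide)
  have m₁ := ag₁.mem 0 (by decide)
  obtain ⟨σ₂, run₂, r₂⟩ := rankProg_spec (l := l) false h2 hn hN' le_rfl h₁ m₁ e6
    (hl _ _ (by omega) (by omega))
  have ag₂ := run₂.agree.mono (rankProg_ints _) (rankProg_arrs _)
  have run₃ := Runs.setInt 9 (.var 7) σ₂
  set σ₃ := σ₂.setInt 9 (IExpr.eval σ₂ (.var 7)) with hσ₃
  have ag₃ : Agree [9] [] σ₂ σ₃ := run₃.agree
  have h₃ := (h₁.congr ag₂).congr ag₃
  have m₃ : σ₃.mem 0 = (inputState M).mem 0 := by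
    rw [ag₃.mem 0 (by decide), ag₂.mem 0 (by decide), m₁]
  obtain ⟨σ₄, run₄, r₄⟩ := rankProg_spec (l := l) true h2 hn hN' le_rfl h₃ m₃
    (a := -(A : ℤ) - 1) (by rw [ag₃.int 6 (by decide), ag₂.int 6 (by decide), e6])
    (hl _ _ (by omega) (by omega))
  have ag₄ := run₄.agree.mono (rankProg_ints _) (rankProg_arrs _)
  have run₅ := Runs.setInt 8 (.var 7) σ₄
  set σ₅ := σ₄.setInt 8 (IExpr.eval σ₄ (.var 7)) with hσ₅
  have ag₅ : Agree [8] [] σ₄ σ₅ := run₅.agree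
  have run₆ := Runs.setField 6 [] .one σ₅
  set σ₆ := σ₅.setMem 6 (([] : List IExpr).map (IExpr.eval σ₅)) (FExpr.one.eval σ₅) with hσ₆
  have ag₆ : Agree [] [6] σ₅ σ₆ := run₆.agree
  have h₆ := ((h₃.congr ag₄).congr ag₅).congr ag₆
  have m₆ : σ₆.mem 0 = (inputState M).mem 0 := by
    rw [ag₆.mem 0 (by decide), ag₅.mem 0 (by decide), ag₄.mem 0 (by decide), m₃]
  have s₆ : σ₆.mem 6 [] = (-1) ^ (-A : ℤ) := by
    have : σ₆.mem 6 [] = 1 := by simp [hσ₆, State.setMem, FExpr.eval]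
    rw [this, Even.neg_one_zpow]
    exact ⟨-(D + 2 : ℤ), by rw [hA]; push_cast; ring⟩
  have hnil : l.filter (· < 2 * (-A : ℤ)) = [] := by
    simp only [List.filter_eq_nil_iff, decide_eq_true_eq, not_lt]
    intro i hi
    linarith [(hmem i hi).1]
  have p₆ : Progress n N l (2 * (-A : ℤ)) σ₆ := by
    refine ⟨?_, ?_, ?_⟩
    · have : σ₅.int 8 = σ₄.int 7 := by simp [hσ₅, State.setInt, IExpr.eval]
      rw [ag₆.int 8 (by decide), this, r₄]
      congr 3
      simp [index, shift]; ring
    · have : σ₃.int 9 = σ₂.int 7 := by simp [hσ₃, State.setInt, IExpr.eval]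
      rw [ag₆.int 9 (by decide), ag₅.int 9 (by decide), ag₄.int 9 (by decide), this, r₂]
      congr 3
      simp [index, shift]; ring
    · rw [hnil]
      refine ⟨?_, ?_⟩
      · rw [ag₆.int 10 (by decide), ag₅.int 10 (by decide), ag₄.int 10 (by decide),
          ag₃.int 10 (by decide), ag₂.int 10 (by decide), ag₁.int 10 (by decide)]
        rfl
      · intro r c e k
        rw [ag₆.mem 1 (by decide), ag₅.mem 1 (by decide), ag₄.mem 1 (by decide),
          ag₃.mem 1 (by decide), ag₂.mem 1 (by decide), ag₁.mem 1 (by decide),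
          entry_of_not _ (by simp only [totalSize]; omega), cf_zero]
        rfl
  obtain ⟨σ₇, run₇, p₇⟩ := mainLoop_spec h2 hn (by omega) hN' le_rfl h₆ m₆ hl hs (by omega) s₆ p₆
  have e3 : σ₇.int 3 = A := by
    rw [run₇.agree.int 3 fun h => absurd (mainLoop_ints h) (by decide), h₆.A]
  have run₈ := Runs.setInt 1 (.add (.var 3) (.const 2)) σ₇
  refine ⟨_, (run₁.seq (run₂.seq (run₃.seq (run₄.seq (run₅.seq (run₆.seq
    (run₇.seq run₈))))))).mono ?_, ?_, ?_⟩
  · simp only [canonicalFormCost, eval_add, eval_C, IExpr.cost, FExpr.cost, List.map_nil,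
      List.sum_nil]
    omega
  · simp [State.setInt, IExpr.eval, e3]
  · have hall : l.filter (· < 2 * (A : ℤ)) = l := by
      simp only [List.filter_eq_self, decide_eq_true_eq]
      exact fun i hi => (hmem i hi).2
    have := p₇.written
    rw [hall] at this
    exact this.congr run₈.agree (by decide) (by decide)

theorem natAbs_le_of_cf_blockSum {l : List ℤ} {b : ℕ} (hl : ∀ i ∈ l, i.natAbs ≤ 2 * b) {r c : ℤ}
    {e : Fin 2} {k : ℤ} (h : cf (entry (blockSum l) r c) e k ≠ 0) : k.natAbs ≤ b + 1 := by
  induction l generalizing r c with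
  | nil =>
    rw [entry_of_not _ (by simp only [totalSize]; omega), cf_zero] at h
    exact absurd rfl h
  | cons i l ih =>
    have h1 := entry_fromBlocks (block i) (blockSum l) r c
    change entry (blockSum (i :: l)) r c = _ at h1
    rw [h1, cf_add] at h
    by_cases h2 : cf (entry (block i) r c) e k = 0
    · rw [h2, zero_add] at h
      exact ih (fun i hi => hl i (List.mem_cons_of_mem _ hi)) h
    · have hi := hl i List.mem_cons_self
      obtain ⟨a, rfl | rfl⟩ := even_or_odd_form i
      · rw [cf_block_even] at h2
        split_ifs at h2 with h3
        · omega
        · exact absurd rfl h2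
      · rw [cf_block_odd] at h2
        split_ifs at h2 with h3 h4 h5
        · omega
        · omega
        · omega
        · exact absurd rfl h2

theorem Written.isOutput {l : List ℤ} {n b : ℕ} (h : totalSize l = n)
    (hl : ∀ i ∈ l, i.natAbs ≤ 2 * b) {τ : State ℝ} (h1 : τ.int 1 = b + 2) (hτ : Written l τ) :
    IsOutput τ ((blockSum l).reindex (finCongr h) (finCongr h)) := by
  subst h
  have he : ∀ i j, (blockSum l).reindex (finCongr rfl) (finCongr rfl) i j =
      entry (blockSum l) ((i : ℕ) : ℤ) ((j : ℕ) : ℤ) := fun i j => (entry_coe _ i j).symm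
  constructor
  · rw [h1]
    have : width ((blockSum l).reindex (finCongr rfl) (finCongr rfl)) ≤ b + 1 := by
      refine width_le fun i j e k hk => ?_
      rw [he] at hk
      exact natAbs_le_of_cf_blockSum hl hk
    omega
  · intro i j e k _
    rw [hτ.mem, he]
    rfl

theorem eval_le_eval (p : ℕ[X]) {a b : ℕ} (h : a ≤ b) : p.eval a ≤ p.eval b := by
  rw [eval_eq_sum, eval_eq_sum]
  exact Finset.sum_le_sum fun i _ => Nat.mul_le_mul_left _ (Nat.pow_le_pow_left h i)

/-- The bound for the number of loop steps, as a polynomial in the size and the degree. -/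
def stepBound : MvPolynomial (Fin 2) ℕ :=
  10 * .X 0 * .X 1 + 5 * .X 0 + .X 1 + 11

theorem eval_aeval_stepBound (p : ℕ[X]) (n d : ℕ) :
    MvPolynomial.eval ![n, d] (aeval stepBound p) = p.eval (10 * n * d + 5 * n + d + 11) := by
  rw [aeval_def, hom_eval₂]
  have : (MvPolynomial.eval ![n, d]).comp (algebraMap ℕ (MvPolynomial (Fin 2) ℕ)) = RingHom.id ℕ :=
    Subsingleton.elim _ _
  rw [this, ← eval₂_id]
  congr 1
  simp [stepBound]

end Conic

end

theorem theorem4p6 : ∃ (P : AlgRAM.Prog) (p : MvPolynomial (Fin 2) ℕ),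
    ∀ (n : ℕ), 1 ≤ n → ∀ M : GL (Fin n) Conic.R12,
      ∃ (s : ℕ) (τ : AlgRAM.State ℝ) (D : Matrix (Fin n) (Fin n) Conic.R12),
        AlgRAM.Run P (Conic.inputState (M : Matrix (Fin n) (Fin n) Conic.R12)) s τ ∧
        s ≤ MvPolynomial.eval
          ![n, Conic.dw ((M : Matrix (Fin n) (Fin n) Conic.R12).map Conic.phiInv)] p ∧
        Conic.IsOutput τ D ∧
        Conic.IsCanonical D ∧
        Conic.Reduces (M : Matrix (Fin n) (Fin n) Conic.R12) D ∧
        ∀ D' : Matrix (Fin n) (Fin n) Conic.R12, Conic.IsCanonical D' →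
          Conic.Reduces (M : Matrix (Fin n) (Fin n) Conic.R12) D' → D' = D := by
  open Conic AlgRAM in
  refine ⟨canonicalForm, aeval stepBound canonicalFormCost, fun n hn M => ?_⟩
  obtain ⟨l, hs, h, hred⟩ := exists_canonical M
  have hl : Eqv (M : Matrix (Fin n) (Fin n) R12) (blockSum l) :=
    hred.eqv.trans (eqv_reindex h).symm
  have hMN : (M : Matrix (Fin n) (Fin n) R12) * ((M⁻¹ : GL (Fin n) R12) : Matrix (Fin n) (Fin n) R12)
      = 1 := by rw [← Units.val_mul, mul_inv_cancel]; rfl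
  have hNM : ((M⁻¹ : GL (Fin n) R12) : Matrix (Fin n) (Fin n) R12) * (M : Matrix (Fin n) (Fin n) R12)
      = 1 := by rw [← Units.val_mul, inv_mul_cancel]; rfl
  set w := width (M : Matrix (Fin n) (Fin n) R12) with hw
  have hS2 := InT_S2_width (M : Matrix (Fin n) (Fin n) R12)
  have hS1 := InT_S1_width (M : Matrix (Fin n) (Fin n) R12)
  rw [← hw] at hS1 hS2
  have hinv := inverse_bounds hn hMN hS2 hS1
  obtain ⟨D, hD⟩ : ∃ D, D = 2 * n * w + n := ⟨_, rfl⟩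
  obtain ⟨A, hA⟩ : ∃ A, A = 2 * D + 4 := ⟨_, rfl⟩
  obtain ⟨N, hN⟩ : ∃ N, N = A + D + 2 := ⟨_, rfl⟩
  obtain ⟨L, hL⟩ : ∃ L, L = A + N + w + 1 := ⟨_, rfl⟩
  have hcast : (2 * n * w + n : ℤ) = D := by rw [hD]; push_cast; ring
  rw [hcast] at hinv
  have hwD : w ≤ D := by nlinarith
  have hmem : ∀ i ∈ l, -2 * (A : ℤ) ≤ i ∧ i < 2 * A := by
    intro i hi
    have h1 := le_of_mem_list hNM hS1 hl hi
    have h2 := mem_list_le hMN (fun i j => (hinv i j).2) hl hi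
    omega
  obtain ⟨τ, ⟨s, hsc, run⟩, h1, hτ⟩ := canonicalForm_spec hD hA hN hL hw.symm hs
    ((length_le_totalSize l).trans h.le)
    (fun ε a ha ha' => nullity_secMat hNM hS2 (fun i j => (hinv i j).1) ε hN hL ha ha' hl) hmem
  refine ⟨s, τ, _, run, ?_, hτ.isOutput h (b := A) (fun i hi => ?_) h1, ⟨l, hs, h, rfl⟩, hred,
    fun D' hD' hred' => canonical_unique ⟨l, hs, h, rfl⟩ hD' hred hred'⟩
  · rw [eval_aeval_stepBound]
    refine hsc.trans (eval_le_eval _ ?_)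
    have hd := width_le_dw (M : Matrix (Fin n) (Fin n) R12)
    rw [← hw] at hd
    have : n * w ≤ n * dw ((M : Matrix (Fin n) (Fin n) R12).map phiInv) :=
      Nat.mul_le_mul_left _ hd
    rw [hL, hN, hA, hD]
    nlinarith
  · have := hmem i hi
    omega
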